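/- Let $D\subset\mathbb{R}^d$, $d\ge 1$, be a bounded open set, let $V=H^1_0(D)$ with the norm $\|v\|_V=\|\nabla v\|_{L^2(D)}$, and let $f\in H^{-1}(D)=V'$. Let $(\psi_j)_{j\ge 1}$ be functions in $L^\infty(D)$ of wavelet type: each $\psi_j$ has a scale level $l(j)\in\{0,1,2,\dots\}$; there is an integer $M$ such that, for almost every $x\in D$ and every level $l$, $$\#\{j : l(j)=l,\ \psi_j(x)\ne 0\}\le M;$$ and there are constants $C>0$, $\alpha>0$ such that $\|\psi_j\|_{L^\infty(D)}=C2^{-\alpha l(j)}$ for all $j$. Let $\gamma$ be the product on $U=\mathbb{R}^{\mathbb{N}}$ of standard Gaussian measures. For $y\in U$ let $b(y)=\sum_{j\ge1}y_j\psi_j$, with convergence of the partial sums in $L^\infty(D)$, and let $u(y)\in V$ be the weak solution of $$-\operatorname{div}\bigl(e^{b(y)}\nabla u(y)\bigr)=f .$$ Let $\mathcal F$ be the set of finitely supported sequences $\nu=(\nu_j)_{j\ge1}$ of nonnegative integers. For $\nu\in\mathcal F$ let $H_\nu(y)=\prod_{j}H_{\nu_j}(y_j)$, where $H_k$ is the Hermite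 polynomial of degree $k$ normalized in $L^2$ of the standard Gaussian measure on $\mathbb{R}$, and let $u_\nu=\int_U u(y)H_\nu(y)\,d\gamma(y)\in V$. Let $0<q<\infty$ and suppose that $(\|\psi_j\|_{L^\infty(D)})_{j\ge1}\in\ell^q(\mathbb{N})$. Then: 1. For $\gamma$-almost every $y$ the series $b(y)$ converges in $L^\infty(D)$ and the weak solution $u(y)$ exists and is unique; moreover $u\in L^2(U,V,\gamma)$. 2. $(\|u_\nu\|_V)_{\nu\in\mathcal F}\in\ell^p(\mathcal F)$ for every $0<p<2$ with $\frac{2p}{2-p}>q$. 3. Best $n$-term Hermite approximations converge in $L^2(U,V,\gamma)$ with rate $n^{-s}$ for every $s<\frac1q$. That is, for every $n$ there is a set $\Lambda\subset\mathcal F$ of $n$ indices with the $n$ largest values of $\|u_\nu\|_V$, and for every $s<\frac1q$ there is a constant $K$ such that for all $n\ge1$ and all such sets $\Lambda$ with $\#\Lambda=n$, $$\Bigl\|u-\sum_{\nu\in\Lambda}u_\nu H_\nu\Bigr\|_{L^2(U,V,\gamma)}\le K n^{-s}.$$ -/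

import Mathlib

open MeasureTheory ProbabilityTheory Filter Topology
open scoped ENNReal ContDiff

noncomputable section

namespace Lognormal

/-- The space `ℝ^d` with its Euclidean norm. -/
abbrev E (d : ℕ) : Type := EuclideanSpace ℝ (Fin d)

/-- `L^∞(D)`, with the essential supremum norm. -/
abbrev LInfty {d : ℕ} (D : Set (E d)) : Type := Lp ℝ ∞ ((volume : Measure (E d)).restrict D)

/-- The Hilbert space `L²(D) × L²(D; ℝ^d)` that contains the pairs `(v, ∇v)` with `v ∈ H¹(D)`;
its norm is `(‖v‖² + ‖∇v‖²)^{1/2}`. -/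
abbrev GradPair {d : ℕ} (D : Set (E d)) : Type :=
  WithLp 2 (Lp ℝ 2 ((volume : Measure (E d)).restrict D) ×
    Lp (E d) 2 ((volume : Measure (E d)).restrict D))

/-- `φ` belongs to `C_c^∞(D)`. -/
def IsTestFunction {d : ℕ} (D : Set (E d)) (φ : E d → ℝ) : Prop :=
  ContDiff ℝ ∞ φ ∧ HasCompactSupport φ ∧ tsupport φ ⊆ D

/-- The subspace of all pairs `(φ, ∇φ)` with `φ ∈ C_c^∞(D)`. -/
def testPairs {d : ℕ} (D : Set (E d)) : Submodule ℝ (GradPair D) where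
  carrier := {w | ∃ φ : E d → ℝ, IsTestFunction D φ ∧
    w.fst =ᵐ[(volume : Measure (E d)).restrict D] φ ∧
    w.snd =ᵐ[(volume : Measure (E d)).restrict D] gradient φ}
  zero_mem' := by
    refine ⟨0, ⟨contDiff_const, HasCompactSupport.zero, by simp [tsupport]⟩, ?_, ?_⟩
    · exact Lp.coeFn_zero _ _ _
    · refine (Lp.coeFn_zero _ _ _).trans (Eventually.of_forall fun x => ?_)
      simp [gradient]
  add_mem' := by
    rintro v w ⟨φ, ⟨h1, h2, h3⟩, h4, h5⟩ ⟨χ, ⟨k1, k2, k3⟩, k4, k5⟩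
    refine ⟨φ + χ, ⟨h1.add k1, h2.add k2,
      (tsupport_add φ χ).trans (Set.union_subset h3 k3)⟩, ?_, ?_⟩
    · exact (Lp.coeFn_add _ _).trans (h4.add k4)
    · refine (Lp.coeFn_add _ _).trans ((h5.add k5).trans (Eventually.of_forall fun x => ?_))
      have hφ := (h1.differentiable (by simp)) x
      have hχ := (k1.differentiable (by simp)) x
      simp [gradient, fderiv_add hφ hχ]
  smul_mem' := by
    rintro c w ⟨φ, ⟨h1, h2, h3⟩, h4, h5⟩
    refine ⟨c • φ, ⟨contDiff_const.smul h1, h2.smul_left (f := fun _ => c),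
      (tsupport_smul_subset_right (fun _ => c) φ).trans h3⟩, ?_, ?_⟩
    · exact (Lp.coeFn_smul _ _).trans (h4.const_smul c)
    · refine (Lp.coeFn_smul _ _).trans
        ((h5.const_smul c).trans (Eventually.of_forall fun x => ?_))
      have hφ := (h1.differentiable (by simp)) x
      simp [gradient, fderiv_const_smul hφ c]

/-- `V = H¹₀(D)`: the closure of `C_c^∞(D)` in the `H¹` norm, an element `v` being
represented by the pair `(v, ∇v)` of the function and its weak gradient. -/
abbrev H10 {d : ℕ} (D : Set (E d)) : Type := (testPairs D).topologicalClosure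

/-- The weak gradient of an element of `H¹₀(D)`. -/
def grad {d : ℕ} {D : Set (E d)} (v : H10 D) : Lp (E d) 2 ((volume : Measure (E d)).restrict D) :=
  (v : GradPair D).snd

/-- The norm `‖v‖_V = ‖∇v‖_{L²(D)}`; on a bounded open set it is equivalent to the `H¹` norm,
which is the norm that the type `H10 D` carries. -/
def normV {d : ℕ} {D : Set (E d)} (v : H10 D) : ℝ := ‖grad v‖

/-- `v ∈ H¹₀(D)` is the weak solution of `-div(exp(b) ∇v) = f`, where `f ∈ H^{-1}(D)`. -/
def IsWeakSolution {d : ℕ} {D : Set (E d)} (b : LInfty D) (f : StrongDual ℝ (H10 D))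
    (v : H10 D) : Prop :=
  ∀ w : H10 D, ∫ x in D, Real.exp (b x) * inner ℝ (grad v x) (grad w x) = f w

/-- `b` is the sum in `L^∞(D)` of the series `∑ y_j ψ_j`. -/
def IsField {d : ℕ} {D : Set (E d)} (ψ : ℕ → LInfty D) (y : ℕ → ℝ) (b : LInfty D) : Prop :=
  Tendsto (fun J => ∑ j ∈ Finset.range J, y j • ψ j) atTop (𝓝 b)

open Classical in
/-- The solution map `y ↦ u(y)`: the weak solution with coefficient `exp(b(y))`, for all `y` for
which the series `b(y)` converges (and `0` for the other `y`). -/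
def solutionMap {d : ℕ} {D : Set (E d)} (ψ : ℕ → LInfty D) (f : StrongDual ℝ (H10 D))
    (y : ℕ → ℝ) : H10 D :=
  if h : ∃ v : H10 D, ∃ b : LInfty D, IsField ψ y b ∧ IsWeakSolution b f v then h.choose else 0

/-- The product measure on `ℝ^ℕ` whose factors are the standard Gaussian measure. -/
def γ : Measure (ℕ → ℝ) := Measure.infinitePi fun _ => gaussianReal 0 1

/-- The univariate Hermite polynomials, normalized in `L²` of the standard Gaussian measure. -/
def hermite1 (n : ℕ) (t : ℝ) : ℝ :=
  Polynomial.aeval t (Polynomial.hermite n) / Real.sqrt (n.factorial : ℝ)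

/-- The tensor product Hermite polynomials, for finitely supported multi-indices `ν`. -/
def hermite (ν : ℕ →₀ ℕ) (y : ℕ → ℝ) : ℝ := ∏ j ∈ ν.support, hermite1 (ν j) (y j)

/-- The Hermite coefficient `u_ν = ∫ u(y) H_ν(y) dγ(y)`, an element of `V`. -/
def hermiteCoeff {d : ℕ} {D : Set (E d)} (u : (ℕ → ℝ) → H10 D) (ν : ℕ →₀ ℕ) : H10 D :=
  ∫ y, hermite ν y • u y ∂γ

/-- `Λ` consists of indices of `n` largest values of `‖u_ν‖_V`. -/
def IsBestIndexSet {d : ℕ} {D : Set (E d)} (u : (ℕ → ℝ) → H10 D) (n : ℕ)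
    (Λ : Finset (ℕ →₀ ℕ)) : Prop :=
  Λ.card = n ∧ ∀ ν ∈ Λ, ∀ μ ∉ Λ, normV (hermiteCoeff u μ) ≤ normV (hermiteCoeff u ν)

/-- The truncation error `‖u - ∑_{ν ∈ Λ} u_ν H_ν‖` in `L²(U, V, γ)`. -/
def truncationError {d : ℕ} {D : Set (E d)} (u : (ℕ → ℝ) → H10 D)
    (Λ : Finset (ℕ →₀ ℕ)) : ℝ≥0∞ :=
  eLpNorm (fun y => normV (u y - ∑ ν ∈ Λ, hermite ν y • hermiteCoeff u ν)) 2 γ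

/-- A family of wavelet type, listed in any order; `level j` is the scale level of `ψ j`. At every
level at most `M` of the functions are nonzero at (almost) every point of `D`, and the functions
of level `l` have the `L^∞(D)` norm `C 2^{-α l}`. -/
structure IsWaveletType {d : ℕ} {D : Set (E d)} (ψ : ℕ → LInfty D) (level : ℕ → ℕ) (M : ℕ)
    (C α : ℝ) : Prop where
  C_pos : 0 < C
  α_pos : 0 < α
  overlap : ∀ᵐ x ∂(volume : Measure (E d)).restrict D,
    ∀ l : ℕ, {j : ℕ | level j = l ∧ ψ j x ≠ 0}.encard ≤ M
  norm_eq : ∀ j, ‖ψ j‖ = C * (2 : ℝ) ^ (-α * (level j : ℝ))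

end Lognormal

end

open MeasureTheory ProbabilityTheory Filter Topology
open scoped ENNReal ContDiff

noncomputable section

namespace Lognormal

/-! ### Calculus in the Banach algebra `L^∞(D)`. -/

section LInftyFacts

variable {d : ℕ} {D : Set (E d)}

/-! The Hermite coefficients of `u` are controlled by weighted square sums of its Taylor
coefficients `t_μ = ∂^μ u / μ!` in `y`. Let `ρ_j` be positive weights with `∑ ρ_j |ψ_j| ≤ K` almost
everywhere and `e^K ≤ 3/2`. Comparing coefficients in the equation for `u(y + z)` and testing with
`t_μ` gives, for `μ ≠ 0`, `∫ e^b |∇t_μ|² = -∑_{0 ≠ τ ≤ μ} ∫ e^b (ψ^τ / τ!) ∇t_{μ-τ} · ∇t_μ`. After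
multiplication by `ρ^{2μ}` and summation over `μ`, Young's inequality bounds the right side by `e^K
- 1 ≤ 1/2` times the left side, so it is absorbed and `∑ ρ^{2μ} ‖t_μ‖_V² ≤ 2 (‖f‖ P)² e^{2‖b‖}`,
where `P` is a Poincaré constant (`sum_wt_normV_taylor_le`). Only the pointwise sum of the `ρ_j
|ψ_j|` enters, and this is where the locality of wavelets pays off.

The right side is integrable over `y`: `‖b(y)‖ ≤ K sup |y_j| / ρ_j`, and this supremum has
exponential moments when some power of `1 / ρ_j` is summable (`integrable_exp_norm_field`).

Gaussian integration by parts (`integral_heM_add_smul`) turns `u_{κ+μ}` into a multiple of the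
`κ`-th Hermite coefficient of `t_μ`. Splitting `ν = κ + μ` with `μ_j = min(ν_j, r)` and using
Bessel's inequality for each `t_μ` gives `∑ W_ν ‖u_ν‖_V² < ∞` with a product weight `W_ν`, whose
factors are at least a constant times `ρ_j² ν_j^r` if `ν_j ≠ 0` (`sum_prod_factor_mul_norm_sq_le`,
`le_factor`). For `r` large, `∑ W_ν^{-p/(2-p)}` converges as soon as `∑ ρ_j^{-2p/(2-p)}` does
(`summable_prod_factor_rpow`), and an interpolation between the two sums yields `ℓ^p` summability.

For wavelets, `ρ_j = c 2^{β l(j)}` with `β < α` is allowed, and it makes `∑ ρ_j^{-q'}` finite for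
any prescribed `q' > q` (`exists_weights`). The rate then follows from completeness of the Hermite
polynomials, Parseval's identity and Stechkin's estimate. -/

lemma ae_abs_le_norm (b : LInfty D) :
    ∀ᵐ x ∂(volume : Measure (E d)).restrict D, |b x| ≤ ‖b‖ := by
  have h := ae_le_eLpNormEssSup (f := b) (μ := (volume : Measure (E d)).restrict D)
  filter_upwards [h] with x hx
  rw [← eLpNorm_exponent_top, ← Lp.enorm_def, ← ofReal_norm, ← ofReal_norm,
    ENNReal.ofReal_le_ofReal_iff (norm_nonneg _)] at hx
  exact hx

lemma norm_le_of_ae_abs_le {b : LInfty D} {c : ℝ} (hc : 0 ≤ c)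
    (h : ∀ᵐ x ∂(volume : Measure (E d)).restrict D, |b x| ≤ c) : ‖b‖ ≤ c := by
  have : ‖b‖ₑ ≤ ENNReal.ofReal c := by
    rw [Lp.enorm_def, eLpNorm_exponent_top]
    refine eLpNormEssSup_le_of_ae_bound h
  rw [← ofReal_norm] at this
  exact (ENNReal.ofReal_le_ofReal_iff hc).1 this

lemma memLp_exp (b : LInfty D) :
    MemLp (fun x => Real.exp (b x)) ∞ ((volume : Measure (E d)).restrict D) := by
  refine memLp_top_of_bound (Real.continuous_exp.comp_aestronglyMeasurable
    (Lp.aestronglyMeasurable b)) (Real.exp ‖b‖) ?_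
  filter_upwards [ae_abs_le_norm b] with x hx
  rw [Real.norm_eq_abs, abs_of_pos (Real.exp_pos _)]
  exact Real.exp_le_exp.2 ((le_abs_self _).trans hx)

/-- The coefficient `e^b`. -/
def expL (b : LInfty D) : LInfty D := (memLp_exp b).toLp _

lemma coeFn_expL (b : LInfty D) :
    expL b =ᵐ[(volume : Measure (E d)).restrict D] fun x => Real.exp (b x) :=
  MemLp.coeFn_toLp _

/-- Multiplication in `L^∞(D)`. -/
def mulL : LInfty D →L[ℝ] LInfty D →L[ℝ] LInfty D :=
  (ContinuousLinearMap.mul ℝ ℝ).holderL ((volume : Measure (E d)).restrict D) ∞ ∞ ∞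

lemma coeFn_mulL (a b : LInfty D) :
    mulL a b =ᵐ[(volume : Measure (E d)).restrict D] fun x => a x * b x := by
  simpa [mulL] using ContinuousLinearMap.coeFn_holder (r := ∞) (ContinuousLinearMap.mul ℝ ℝ) a b

/-- The remainder is `e^b (e^h - 1 - h)`, and `|e^s - 1 - s| ≤ s²` for `|s| ≤ 1` bounds it by
`e^{‖b‖} ‖h‖²`. -/
lemma hasFDerivAt_expL (b : LInfty D) : HasFDerivAt expL (mulL (expL b)) b := by
  rw [hasFDerivAt_iff_isLittleO_nhds_zero]
  refine Asymptotics.IsBigO.trans_isLittleO (g := fun h : LInfty D => ‖h‖ ^ 2) ?_ ?_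
  · refine Asymptotics.IsBigO.of_bound (Real.exp ‖b‖) ?_
    have : ∀ᶠ h : LInfty D in 𝓝 0, ‖h‖ < 1 := by
      have := (continuous_norm (E := LInfty D)).tendsto 0
      rw [norm_zero] at this
      exact this.eventually (gt_mem_nhds one_pos)
    filter_upwards [this] with h hh
    refine norm_le_of_ae_abs_le (by positivity) ?_
    filter_upwards [ae_abs_le_norm b, ae_abs_le_norm h, coeFn_expL b, coeFn_expL (b + h),
      coeFn_mulL (expL b) h, Lp.coeFn_add b h, Lp.coeFn_sub (expL (b + h) - expL b)
        (mulL (expL b) h), Lp.coeFn_sub (expL (b + h)) (expL b)] with x h1 h2 h3 h4 h5 h6 h7 h8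
    rw [h7, Pi.sub_apply, h8, Pi.sub_apply, h4, h3, h5, h6, h3, Pi.add_apply, Real.exp_add]
    have e : Real.exp (b x) * Real.exp (h x) - Real.exp (b x) - Real.exp (b x) * h x
        = Real.exp (b x) * (Real.exp (h x) - 1 - h x) := by ring
    rw [e, abs_mul, abs_of_pos (Real.exp_pos _), norm_pow, norm_norm]
    refine mul_le_mul (Real.exp_le_exp.2 ((le_abs_self _).trans h1)) ?_ (abs_nonneg _)
      (Real.exp_pos _).le
    refine (Real.abs_exp_sub_one_sub_id_le (h2.trans hh.le)).trans ?_
    rw [← sq_abs]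
    gcongr
  · exact Asymptotics.isLittleO_norm_pow_id one_lt_two

lemma memLp_prod_pow (ψ : ℕ → LInfty D) (τ : ℕ →₀ ℕ) :
    MemLp (fun x => ∏ j ∈ τ.support, (ψ j x ^ τ j / (τ j).factorial)) ∞
      ((volume : Measure (E d)).restrict D) := by
  refine memLp_top_of_bound ?_ (∏ j ∈ τ.support, (‖ψ j‖ ^ τ j / (τ j).factorial)) ?_
  · refine Finset.aestronglyMeasurable_fun_prod _ fun j _ => ?_
    exact ((Lp.aestronglyMeasurable (ψ j)).pow _).mul_const _
  · filter_upwards [ae_all_iff.2 fun j => ae_abs_le_norm (ψ j)] with x hx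
    rw [Real.norm_eq_abs, Finset.abs_prod]
    gcongr with j hj
    rw [abs_div, abs_pow, Nat.abs_cast]
    gcongr
    exact hx j

/-- The function `ψ^τ / τ!`. -/
def monoL (ψ : ℕ → LInfty D) (τ : ℕ →₀ ℕ) : LInfty D := (memLp_prod_pow ψ τ).toLp _

lemma coeFn_monoL (ψ : ℕ → LInfty D) (τ : ℕ →₀ ℕ) :
    monoL ψ τ =ᵐ[(volume : Measure (E d)).restrict D]
      fun x => ∏ j ∈ τ.support, (ψ j x ^ τ j / (τ j).factorial) := MemLp.coeFn_toLp _

/-- The factor `τ_j + 1` compensates the passage from `τ_j!` to `(τ_j + 1)!`. Hence differentiating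
`e^b ψ^τ / τ!` in the direction `ψ_j` acts like the formal derivative of a power series. -/
lemma mulL_monoL (ψ : ℕ → LInfty D) (τ : ℕ →₀ ℕ) (j : ℕ) :
    mulL (ψ j) (monoL ψ τ) = ((τ j : ℝ) + 1) • monoL ψ (τ + Finsupp.single j 1) := by
  apply Lp.ext
  filter_upwards [coeFn_mulL (ψ j) (monoL ψ τ), coeFn_monoL ψ τ,
    coeFn_monoL ψ (τ + Finsupp.single j 1),
    Lp.coeFn_smul ((τ j : ℝ) + 1) (monoL ψ (τ + Finsupp.single j 1))] with x h1 h2 h3 h4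
  rw [h1, h2, h4, Pi.smul_apply, h3, smul_eq_mul]
  have e1 : ∀ σ : ℕ →₀ ℕ, σ.support ⊆ insert j τ.support →
      ∏ i ∈ σ.support, (ψ i x ^ σ i / (σ i).factorial : ℝ)
        = ∏ i ∈ insert j τ.support, (ψ i x ^ σ i / (σ i).factorial : ℝ) := by
    intro σ hσ
    refine Finset.prod_subset hσ fun i _ hi => ?_
    simp [Finsupp.notMem_support_iff.1 hi]
  rw [e1 τ (Finset.subset_insert _ _), e1 (τ + Finsupp.single j 1)]
  · rw [← Finset.mul_prod_erase _ _ (Finset.mem_insert_self j _),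
      ← Finset.mul_prod_erase (insert j τ.support) _ (Finset.mem_insert_self j _)]
    have e2 : ∏ i ∈ (insert j τ.support).erase j,
        (ψ i x ^ (τ + Finsupp.single j 1 : ℕ →₀ ℕ) i /
          ((τ + Finsupp.single j 1 : ℕ →₀ ℕ) i).factorial : ℝ)
        = ∏ i ∈ (insert j τ.support).erase j, (ψ i x ^ τ i / (τ i).factorial : ℝ) := by
      refine Finset.prod_congr rfl fun i hi => ?_
      simp [Finsupp.single_eq_of_ne (Finset.ne_of_mem_erase hi)]
    rw [e2, ← mul_assoc, ← mul_assoc]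
    congr 1
    simp only [Finsupp.add_apply, Finsupp.single_eq_same, Nat.factorial_succ, pow_succ]
    push_cast
    field_simp
  · intro i hi
    rw [Finset.mem_insert]
    by_contra! h
    simp [Finsupp.single_eq_of_ne h.1, Finsupp.notMem_support_iff.1 h.2] at hi

lemma monoL_zero_coeFn (ψ : ℕ → LInfty D) :
    monoL ψ 0 =ᵐ[(volume : Measure (E d)).restrict D] fun _ => 1 := by
  simpa using coeFn_monoL ψ 0

end LInftyFacts

/-! ### Operators of bilinear forms. -/

section FormOperators

variable {L V H : Type*} [NormedAddCommGroup L] [NormedSpace ℝ L]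
  [NormedAddCommGroup V] [InnerProductSpace ℝ V] [CompleteSpace V]
  [NormedAddCommGroup H] [InnerProductSpace ℝ H] [CompleteSpace H]

/-- The operators `G* m(θ) G` as a function of `θ`. -/
def formOp (G : V →L[ℝ] H) (m : L →L[ℝ] H →L[ℝ] H) : L →L[ℝ] V →L[ℝ] V :=
  (ContinuousLinearMap.compL ℝ V H V (ContinuousLinearMap.adjoint G)) ∘L
    (((ContinuousLinearMap.compL ℝ V H H).flip G) ∘L m)

lemma inner_formOp (G : V →L[ℝ] H) (m : L →L[ℝ] H →L[ℝ] H) (θ : L) (v w : V) :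
    inner ℝ (formOp G m θ v) w = inner ℝ (m θ (G v)) (G w) :=
  ContinuousLinearMap.adjoint_inner_left G w (m θ (G v))

end FormOperators

/-! ### The gradient, multiplication of vector fields, and ellipticity. -/

section Operators

variable {d : ℕ} {D : Set (E d)}

/-- The space `L²(D; ℝ^d)` of the gradients. -/
abbrev VecL2 {d : ℕ} (D : Set (E d)) : Type := Lp (E d) 2 ((volume : Measure (E d)).restrict D)

/-- The weak gradient as a bounded operator. -/
def gradL : H10 D →L[ℝ] VecL2 D :=
  (WithLp.sndL 2 ℝ (Lp ℝ 2 ((volume : Measure (E d)).restrict D)) (VecL2 D)) ∘L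
    (testPairs D).topologicalClosure.subtypeL

lemma norm_gradL_apply (v : H10 D) : ‖gradL v‖ = normV v := rfl

/-- Multiplication of vector fields by bounded functions. -/
def smulVec : LInfty D →L[ℝ] VecL2 D →L[ℝ] VecL2 D :=
  (ContinuousLinearMap.lsmul ℝ ℝ).holderL ((volume : Measure (E d)).restrict D) ∞ 2 2

lemma coeFn_smulVec (a : LInfty D) (g : VecL2 D) :
    smulVec a g =ᵐ[(volume : Measure (E d)).restrict D] fun x => a x • g x := by
  simpa [smulVec] using ContinuousLinearMap.coeFn_holder (r := 2) (ContinuousLinearMap.lsmul ℝ ℝ) a g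

lemma inner_smulVec (θ : LInfty D) (g h : VecL2 D) :
    inner ℝ (smulVec θ g) h = ∫ x in D, θ x * inner ℝ (g x) (h x) := by
  rw [L2.inner_def]
  refine integral_congr_ae ?_
  filter_upwards [coeFn_smulVec θ g] with x hx
  rw [hx, real_inner_smul_left]

lemma integrable_mul_inner (θ : LInfty D) (g h : VecL2 D) :
    Integrable (fun x => θ x * inner ℝ (g x) (h x)) ((volume : Measure (E d)).restrict D) := by
  refine (L2.integrable_inner (𝕜 := ℝ) (smulVec θ g) h).congr ?_
  filter_upwards [coeFn_smulVec θ g] with x hx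
  rw [hx, real_inner_smul_left]

lemma norm_sq_eq_integral (g : VecL2 D) : ‖g‖ ^ 2 = ∫ x in D, ‖g x‖ ^ 2 := by
  rw [← real_inner_self_eq_norm_sq, L2.inner_def]
  simp

lemma norm_sq_le_inner_expL (b : LInfty D) (g : VecL2 D) :
    Real.exp (-‖b‖) * ‖g‖ ^ 2 ≤ inner ℝ (smulVec (expL b) g) g := by
  rw [inner_smulVec, norm_sq_eq_integral, ← integral_const_mul]
  refine integral_mono_ae ?_ (integrable_mul_inner _ _ _) ?_
  · have := (L2.integrable_inner (𝕜 := ℝ) g g).const_mul (Real.exp (-‖b‖))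
    simpa using this
  · filter_upwards [coeFn_expL b, ae_abs_le_norm b] with x h1 h2
    rw [h1, real_inner_self_eq_norm_sq]
    gcongr
    exact neg_le_of_abs_le h2

/-! ### The Poincaré inequality. -/

section Poincare

/-- Integration by parts against the linear coordinate `f` gives `∫ φ² = -2 ∫ f φ ∂_e φ`. As `|f| ≤
R` on the support, Young's inequality bounds this by half of `∫ φ²`, which is absorbed, plus `2 R² ∫
|∇φ|²`. -/
lemma integral_sq_le_of_hasCompactSupport {F : Type*} [NormedAddCommGroup F]
    [InnerProductSpace ℝ F] [FiniteDimensional ℝ F] [MeasurableSpace F] [BorelSpace F]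
    {φ : F → ℝ} (h1 : ContDiff ℝ 1 φ) (h2 : HasCompactSupport φ) (e : F) (he : ‖e‖ = 1)
    (f : F →L[ℝ] ℝ) (hf : f e = 1) (hf' : ∀ x, |f x| ≤ ‖x‖)
    {R : ℝ} (hR : ∀ x ∈ tsupport φ, ‖x‖ ≤ R) :
    ∫ x, φ x ^ 2 ≤ 4 * R ^ 2 * ∫ x, ‖gradient φ x‖ ^ 2 := by
  have hd : Differentiable ℝ φ := h1.differentiable (by simp)
  have hcφ' : Continuous (fderiv ℝ φ) := h1.continuous_fderiv (by simp)
  have hcf : HasCompactSupport (fderiv ℝ φ) := h2.fderiv ℝ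
  have hg : ∀ x, fderiv ℝ (fun x => φ x ^ 2) x e = 2 * φ x * fderiv ℝ φ x e := by
    intro x
    rw [((hd x).hasFDerivAt.pow 2).fderiv]
    simp
  have hgn : ∀ x, ‖gradient φ x‖ = ‖fderiv ℝ φ x‖ := by
    intro x
    rw [gradient, LinearIsometryEquiv.norm_map]
  have hs1 : HasCompactSupport fun x => φ x ^ 2 := by
    refine h2.mono fun x hx h => hx ?_
    change φ x ^ 2 = 0
    rw [h, zero_pow two_ne_zero]
  have hs2 : HasCompactSupport fun x => ‖fderiv ℝ φ x‖ ^ 2 := by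
    refine hcf.mono fun x hx h => hx ?_
    change ‖fderiv ℝ φ x‖ ^ 2 = 0
    rw [h, norm_zero, zero_pow two_ne_zero]
  have i1 : Integrable (fun x => φ x ^ 2) :=
    (h1.continuous.pow 2).integrable_of_hasCompactSupport hs1
  have i2 : Integrable (fun x => ‖gradient φ x‖ ^ 2) := by
    simp_rw [hgn]
    exact (hcφ'.norm.pow 2).integrable_of_hasCompactSupport hs2
  have hfe : ∀ x, fderiv ℝ (f) x e = 1 := by
    intro x
    rw [ContinuousLinearMap.fderiv, hf]
  have i3 : Integrable fun x => f x * (2 * φ x * fderiv ℝ φ x e) := by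
    refine Continuous.integrable_of_hasCompactSupport ?_ ?_
    · exact (f).continuous.mul ((continuous_const.mul h1.continuous).mul
        (hcφ'.clm_apply continuous_const))
    · exact (h2.mul_left (f := fun _ => (2 : ℝ))).mul_right.mul_left
  have i4 : Integrable fun x => f x * φ x ^ 2 :=
    ((f).continuous.mul (h1.continuous.pow 2)).integrable_of_hasCompactSupport
      hs1.mul_left
  have key := integral_mul_fderiv_eq_neg_fderiv_mul_of_integrable (μ := (volume : Measure F))
    (f := f) (g := fun x => φ x ^ 2) (v := e) (by simpa only [hfe, one_mul] using i1)
    (by simpa only [hg] using i3) i4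
    (fun x _ => (f).differentiableAt) (fun x _ => (hd x).pow 2)
  simp_rw [hfe, hg, one_mul] at key
  have h4 : ∫ x, φ x ^ 2 ≤ ∫ x, (1 / 2 * φ x ^ 2 + 2 * R ^ 2 * ‖gradient φ x‖ ^ 2) := by
    rw [← neg_eq_iff_eq_neg.2 key, ← integral_neg]
    refine integral_mono i3.neg ((i1.const_mul _).add (i2.const_mul _)) fun x => ?_
    dsimp only
    by_cases hx : x ∈ tsupport φ
    · have a1 : |f x| ≤ R := (hf' x).trans (hR x hx)
      have a2 : |fderiv ℝ φ x e| ≤ ‖gradient φ x‖ := by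
        rw [hgn, ← Real.norm_eq_abs]
        simpa [he] using (fderiv ℝ φ x).le_opNorm e
      have a3 : |f x * fderiv ℝ φ x e| ≤ R * ‖gradient φ x‖ := by
        rw [abs_mul]
        exact mul_le_mul a1 a2 (abs_nonneg _) ((abs_nonneg _).trans a1)
      have a4 : (f x * fderiv ℝ φ x e) ^ 2 ≤ (R * ‖gradient φ x‖) ^ 2 := by
        rw [← sq_abs]
        gcongr
      have a5 : ∀ z w p g : ℝ, (z * w) ^ 2 ≤ (R * g) ^ 2 →
          -(z * (2 * p * w)) ≤ 1 / 2 * p ^ 2 + 2 * R ^ 2 * g ^ 2 := by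
        intro z w p g h
        nlinarith [sq_nonneg (p + 2 * (z * w))]
      exact a5 _ _ _ _ a4
    · have : φ x = 0 := image_eq_zero_of_notMem_tsupport hx
      rw [this]
      simp only [mul_zero, zero_mul, neg_zero]
      positivity
  rw [integral_add (i1.const_mul _) (i2.const_mul _), integral_const_mul, integral_const_mul] at h4
  linarith

lemma norm_fst_le_of_mem_testPairs (hd : 1 ≤ d) {R : ℝ} (hR0 : 0 ≤ R) (hR : ∀ x ∈ D, ‖x‖ ≤ R)
    {w : GradPair D} (hw : w ∈ testPairs D) : ‖w.fst‖ ≤ 2 * R * ‖w.snd‖ := by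
  obtain ⟨φ, hφ, h1, h2⟩ := hw
  have h0 : ∀ x, x ∉ D → φ x = 0 ∧ gradient φ x = 0 := by
    intro x hx
    have hx' : x ∉ tsupport φ := fun h => hx (hφ.2.2 h)
    refine ⟨image_eq_zero_of_notMem_tsupport hx', ?_⟩
    have : fderiv ℝ φ x = 0 := by
      have := support_fderiv_subset ℝ (f := φ)
      by_contra h
      exact hx' (this h)
    simp [gradient, this]
  have e1 : ‖w.fst‖ ^ 2 = ∫ x, φ x ^ 2 := by
    rw [← real_inner_self_eq_norm_sq, L2.inner_def, ← setIntegral_eq_integral_of_forall_compl_eq_zero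
      (s := D) (f := fun x => φ x ^ 2) (fun x hx => by simp [(h0 x hx).1])]
    refine integral_congr_ae ?_
    filter_upwards [h1] with x hx
    rw [hx]
    simp
  have e2 : ‖w.snd‖ ^ 2 = ∫ x, ‖gradient φ x‖ ^ 2 := by
    rw [norm_sq_eq_integral, ← setIntegral_eq_integral_of_forall_compl_eq_zero
      (s := D) (f := fun x => ‖gradient φ x‖ ^ 2) (fun x hx => by simp [(h0 x hx).2])]
    refine integral_congr_ae ?_
    filter_upwards [h2] with x hx
    rw [hx]
  refine abs_le_of_sq_le_sq' ?_ (by positivity) |>.2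
  rw [mul_pow, e1, e2]
  have := integral_sq_le_of_hasCompactSupport (hφ.1.of_le (by norm_cast)) hφ.2.1
    (EuclideanSpace.single (⟨0, hd⟩ : Fin d) (1 : ℝ)) (by simp)
    (EuclideanSpace.proj ⟨0, hd⟩) (by simp) (fun x => PiLp.norm_apply_le x _) fun x hx => hR x (hφ.2.2 hx)
  linarith

/-- The Poincaré inequality, in terms of the norm of `H10 D`. -/
lemma exists_norm_le_normV (hd : 1 ≤ d) (hDb : Bornology.IsBounded D) :
    ∃ P : ℝ, 0 < P ∧ ∀ v : H10 D, ‖v‖ ≤ P * normV v := by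
  obtain ⟨R, hR0, hR⟩ := hDb.exists_pos_norm_le
  refine ⟨2 * R + 1, by positivity, fun v => ?_⟩
  -- The inequality is a closed condition on the pair, so it passes from test functions to their
  -- closure.
  have h1 : ∀ w ∈ (testPairs D).topologicalClosure, ‖w.fst‖ ≤ 2 * R * ‖w.snd‖ := by
    intro w hw
    have hcl : IsClosed {w : GradPair D | ‖w.fst‖ ≤ 2 * R * ‖w.snd‖} :=
      isClosed_le (WithLp.fstL 2 ℝ (Lp ℝ 2 ((volume : Measure (E d)).restrict D))
        (VecL2 D)).continuous.norm (continuous_const.mul (WithLp.sndL 2 ℝ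
          (Lp ℝ 2 ((volume : Measure (E d)).restrict D)) (VecL2 D)).continuous.norm)
    exact closure_minimal (fun w hw => norm_fst_le_of_mem_testPairs hd hR0.le hR hw) hcl hw
  have h2 := h1 v v.2
  have h3 : ‖v‖ ^ 2 = ‖(v : GradPair D).fst‖ ^ 2 + ‖(v : GradPair D).snd‖ ^ 2 :=
    WithLp.prod_norm_sq_eq_of_L2 _
  have h4 : normV v = ‖(v : GradPair D).snd‖ := rfl
  have h5 : 0 ≤ normV v := norm_nonneg _
  rw [← h4] at h2 h3
  have h6 : ‖v‖ ^ 2 ≤ ((2 * R + 1) * normV v) ^ 2 := by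
    rw [h3]
    nlinarith [norm_nonneg (v : GradPair D).fst, mul_self_le_mul_self (norm_nonneg _) h2,
      mul_nonneg hR0.le (sq_nonneg (normV v))]
  exact (abs_le_of_sq_le_sq' h6 (by positivity)).2

end Poincare

end Operators

/-! ### Inverses of operator-valued power series and their derivatives. -/

section PowerSeriesInverse

/-- The terms with `p.1 j = 0` vanish on the left, and the other ones are exactly the shifts by the
unit vector at `j`. -/
lemma sum_antidiagonal_add_single {M : Type*} [AddCommMonoid M] (ν : ℕ →₀ ℕ) (j : ℕ)
    (x : (ℕ →₀ ℕ) → (ℕ →₀ ℕ) → M) :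
    ∑ p ∈ Finset.HasAntidiagonal.antidiagonal (ν + Finsupp.single j 1 : ℕ →₀ ℕ), (p.1 j) • x p.1 p.2
      = ∑ p ∈ Finset.HasAntidiagonal.antidiagonal ν, (p.1 j + 1) • x (p.1 + Finsupp.single j 1) p.2 := by
  symm
  refine Finset.sum_bij_ne_zero (fun p _ _ => (p.1 + Finsupp.single j 1, p.2)) ?_ ?_ ?_ ?_
  · intro p hp _
    rw [Finset.HasAntidiagonal.mem_antidiagonal] at hp ⊢
    rw [← hp]; dsimp only; abel
  · rintro ⟨p1, p2⟩ _ _ ⟨q1, q2⟩ _ _ h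
    simpa using h
  · rintro ⟨q1, q2⟩ hq h
    rw [Finset.HasAntidiagonal.mem_antidiagonal] at hq
    have hj : q1 j ≠ 0 := fun h0 => h (by simp [h0])
    have hle : Finsupp.single j 1 ≤ q1 := by
      rw [Finsupp.single_le_iff]; omega
    have e : q1 - Finsupp.single j 1 + Finsupp.single j 1 = q1 := tsub_add_cancel_of_le hle
    have e' : (q1 - Finsupp.single j 1 : ℕ →₀ ℕ) j + 1 = q1 j := by
      simp only [Finsupp.tsub_apply, Finsupp.single_eq_same]; omega
    refine ⟨(q1 - Finsupp.single j 1, q2), ?_, ?_, ?_⟩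
    · rw [Finset.HasAntidiagonal.mem_antidiagonal]
      have : q1 - Finsupp.single j 1 + q2 + Finsupp.single j 1 = ν + Finsupp.single j 1 := by
        rw [← hq]; conv_rhs => rw [← e]
        rw [add_right_comm]
      exact add_right_cancel this
    · dsimp only; rw [e, e']; exact h
    · dsimp only; rw [e]
  · intro p _ _
    simp

lemma sum_antidiagonal_add_single' {M : Type*} [AddCommMonoid M] (ν : ℕ →₀ ℕ) (j : ℕ)
    (x : (ℕ →₀ ℕ) → (ℕ →₀ ℕ) → M) :
    ∑ p ∈ Finset.HasAntidiagonal.antidiagonal (ν + Finsupp.single j 1 : ℕ →₀ ℕ), (p.2 j) • x p.1 p.2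
      = ∑ p ∈ Finset.HasAntidiagonal.antidiagonal ν, (p.2 j + 1) • x p.1 (p.2 + Finsupp.single j 1) := by
  have h := sum_antidiagonal_add_single ν j fun a b => x b a
  have hs : ∀ (μ : ℕ →₀ ℕ) (g : (ℕ →₀ ℕ) × (ℕ →₀ ℕ) → M),
      ∑ p ∈ Finset.HasAntidiagonal.antidiagonal μ, g p.swap
        = ∑ p ∈ Finset.HasAntidiagonal.antidiagonal μ, g p := fun μ g =>
    Finset.sum_nbij' Prod.swap Prod.swap (by simp [add_comm]) (by simp [add_comm]) (by simp)
      (by simp) (by simp)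
  rw [← hs, ← hs ν]
  exact h

/-- The Leibniz rule for formal partial derivatives, in terms of coefficients. -/
lemma sum_antidiagonal_leibniz {M : Type*} [AddCommMonoid M] (ν : ℕ →₀ ℕ) (j : ℕ)
    (x : (ℕ →₀ ℕ) → (ℕ →₀ ℕ) → M) :
    (ν j + 1) • ∑ p ∈ Finset.HasAntidiagonal.antidiagonal (ν + Finsupp.single j 1 : ℕ →₀ ℕ), x p.1 p.2
      = ∑ p ∈ Finset.HasAntidiagonal.antidiagonal ν, ((p.1 j + 1) • x (p.1 + Finsupp.single j 1) p.2
        + (p.2 j + 1) • x p.1 (p.2 + Finsupp.single j 1)) := by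
  rw [Finset.sum_add_distrib, ← sum_antidiagonal_add_single, ← sum_antidiagonal_add_single',
    ← Finset.sum_add_distrib, Finset.smul_sum]
  refine Finset.sum_congr rfl fun p hp => ?_
  rw [Finset.HasAntidiagonal.mem_antidiagonal] at hp
  rw [← add_smul]
  congr 1
  have := DFunLike.congr_fun hp j
  simp at this
  omega

set_option linter.unusedSectionVars false

variable {L 𝔅 : Type*} [NormedAddCommGroup L] [NormedSpace ℝ L] [NormedRing 𝔅]
  [NormedAlgebra ℝ 𝔅]

/-- The formal power series with coefficients `a τ b`. -/
def coeffSeries (a : (ℕ →₀ ℕ) → L → 𝔅) (b : L) : MvPowerSeries ℕ 𝔅 := fun τ => a τ b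

variable {a : (ℕ →₀ ℕ) → L → 𝔅} (ha0 : ∀ b, IsUnit (a 0 b))

/-- The coefficients of the inverse of the power series `coeffSeries a b`. -/
def invCoeff (ha0 : ∀ b, IsUnit (a 0 b)) (ν : ℕ →₀ ℕ) (b : L) : 𝔅 :=
  MvPowerSeries.coeff ν (MvPowerSeries.invOfUnit (coeffSeries a b) (ha0 b).unit)

lemma sum_mul_invCoeff (ν : ℕ →₀ ℕ) (b : L) :
    ∑ p ∈ Finset.HasAntidiagonal.antidiagonal ν, a p.1 b * invCoeff ha0 p.2 b = if ν = 0 then 1 else 0 := by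
  have h := MvPowerSeries.mul_invOfUnit (coeffSeries a b) (ha0 b).unit rfl
  have h2 := congrArg (MvPowerSeries.coeff ν) h
  rw [MvPowerSeries.coeff_mul, MvPowerSeries.coeff_one] at h2
  exact h2

/-- The constant coefficient is a unit, so the whole series is invertible and can be cancelled. -/
lemma sum_mul_left_cancel (ha0 : ∀ b, IsUnit (a 0 b)) {b : L} {X Y : (ℕ →₀ ℕ) → 𝔅}
    (h : ∀ ν : ℕ →₀ ℕ, ∑ p ∈ Finset.HasAntidiagonal.antidiagonal ν, a p.1 b * X p.2
      = ∑ p ∈ Finset.HasAntidiagonal.antidiagonal ν, a p.1 b * Y p.2) : X = Y := by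
  have h1 : ∀ X Y : MvPowerSeries ℕ 𝔅, coeffSeries a b * X = coeffSeries a b * Y → X = Y := by
    intro X Y h
    have h2 := MvPowerSeries.invOfUnit_mul (coeffSeries a b) (ha0 b).unit rfl
    have h3 := congrArg (fun Z => MvPowerSeries.invOfUnit (coeffSeries a b) (ha0 b).unit * Z) h
    simpa only [← mul_assoc, h2, one_mul] using h3
  refine h1 X Y (MvPowerSeries.ext fun ν => ?_)
  exact (MvPowerSeries.coeff_mul ν (coeffSeries a b) X).trans
    ((h ν).trans (MvPowerSeries.coeff_mul ν (coeffSeries a b) Y).symm)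

variable [CompleteSpace 𝔅]

lemma differentiable_invCoeff (had : ∀ τ, Differentiable ℝ (a τ)) (ν : ℕ →₀ ℕ) :
    Differentiable ℝ (invCoeff ha0 ν) := by
  classical
  have hu : Differentiable ℝ fun b => ((ha0 b).unit⁻¹ : 𝔅ˣ).val := by
    intro b
    have h1 : (fun b => ((ha0 b).unit⁻¹ : 𝔅ˣ).val) = fun b => Ring.inverse (a 0 b) := by
      funext b
      conv_rhs => rw [← (ha0 b).unit_spec]
      rw [Ring.inverse_unit]
    rw [h1]
    have h2 : DifferentiableAt ℝ Ring.inverse (a 0 b) :=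
      differentiableAt_inverse (ha0 b)
    exact h2.comp b (had 0 b)
  -- The coefficient at `ν` is determined by those at smaller indices and the inverse of `a 0 b`,
  -- and inversion is differentiable at units.
  induction ν using WellFoundedLT.induction with
  | ind ν ih =>
    have e : invCoeff ha0 ν = fun b => if ν = 0 then ((ha0 b).unit⁻¹ : 𝔅ˣ).val else
        -((ha0 b).unit⁻¹ : 𝔅ˣ).val * ∑ x ∈ Finset.HasAntidiagonal.antidiagonal ν,
          if x.2 < ν then a x.1 b * invCoeff ha0 x.2 b else 0 := by
      funext b
      exact MvPowerSeries.coeff_invOfUnit _ _ _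
    rw [e]
    by_cases h0 : ν = 0
    · simpa only [h0, if_true] using hu
    · simp only [h0, if_false]
      refine hu.neg.mul (Differentiable.fun_sum fun x _ => ?_)
      by_cases hx : x.2 < ν
      · simp only [hx, if_true]
        exact (had x.1).mul (ih x.2 hx)
      · simp [hx]

/-- By `hfd`, the true derivative of the series `A` along `ψ_j` is its formal derivative `∂_j A`.
Let `B` be the inverse of `A`. Differentiating `A B = 1` truly and formally shows that the true and
the formal derivative of `B` both solve `A X = -(∂_j A) B`; cancelling `A` identifies them. No
iterated Fréchet derivatives are needed. -/
lemma fderiv_invCoeff (had : ∀ τ, Differentiable ℝ (a τ)) {ψ : ℕ → L}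
    (hfd : ∀ τ j b, fderiv ℝ (a τ) b (ψ j) = (τ j + 1) • a (τ + Finsupp.single j 1) b)
    (ν : ℕ →₀ ℕ) (j : ℕ) (b : L) :
    fderiv ℝ (invCoeff ha0 ν) b (ψ j) = (ν j + 1) • invCoeff ha0 (ν + Finsupp.single j 1) b := by
  have hF := differentiable_invCoeff ha0 had
  have key := sum_mul_left_cancel ha0 (b := b) (X := fun ν => fderiv ℝ (invCoeff ha0 ν) b (ψ j))
    (Y := fun ν => (ν j + 1) • invCoeff ha0 (ν + Finsupp.single j 1) b) ?_
  · exact congrFun key ν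
  · intro ν
    have h1 : HasFDerivAt (fun b => ∑ p ∈ Finset.HasAntidiagonal.antidiagonal ν, a p.1 b * invCoeff ha0 p.2 b)
        (0 : L →L[ℝ] 𝔅) b := by
      simp_rw [sum_mul_invCoeff]
      exact hasFDerivAt_const _ _
    have h2 := HasFDerivAt.fun_sum (u := Finset.HasAntidiagonal.antidiagonal ν) fun p _ =>
      ((had p.1 b).hasFDerivAt.mul' (hF p.2 b).hasFDerivAt)
    have h3 := DFunLike.congr_fun (h1.unique h2) (ψ j)
    simp only [sum_apply, add_apply, hfd, zero_apply, smul_apply,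
      MulOpposite.smul_eq_mul_unop, smul_eq_mul, MulOpposite.unop_op] at h3
    -- The formal Leibniz rule is applied at the nonzero index `ν + e_j`, where the coefficient of
    -- `A B = 1` vanishes.
    have h4 := sum_antidiagonal_leibniz ν j fun p q => a p b * invCoeff ha0 q b
    rw [sum_mul_invCoeff, if_neg (by intro h; simpa using DFunLike.congr_fun h j), smul_zero] at h4
    rw [Finset.sum_add_distrib] at h3 h4
    have h5 := h3.symm.trans h4
    simp only [smul_mul_assoc, mul_smul_comm] at h5 ⊢
    rw [add_comm] at h5
    exact add_left_cancel h5

end PowerSeriesInverse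

/-! ### The weighted convolution estimate at a fixed point of the domain. -/

section PointwiseEstimate

lemma sum_finsupp_prod (J : Finset ℕ) (t : ℕ → Finset ℕ) (F : ℕ → ℕ → ℝ) :
    ∑ τ ∈ J.finsupp t, ∏ j ∈ J, F j (τ j) = ∏ j ∈ J, ∑ n ∈ t j, F j n := by
  classical
  rw [Finset.prod_sum]
  simp only [Finset.finsupp, Finset.sum_map, Function.Embedding.coeFn_mk]
  refine Finset.sum_congr (by congr!) fun p _ => ?_
  rw [← Finset.prod_attach]
  refine Finset.prod_congr rfl fun x _ => ?_
  rw [Finsupp.indicator_of_mem x.2]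

lemma finsupp_prod_eq_prod {τ : ℕ →₀ ℕ} {J : Finset ℕ} (h : τ.support ⊆ J) {F : ℕ → ℕ → ℝ}
    (hF : ∀ j, F j 0 = 1) : τ.prod F = ∏ j ∈ J, F j (τ j) :=
  Finsupp.prod_of_support_subset τ h F fun j _ => hF j

lemma mem_box {J : Finset ℕ} {m : ℕ} {τ : ℕ →₀ ℕ} :
    τ ∈ J.finsupp (fun _ => Finset.range (m + 1)) ↔ τ.support ⊆ J ∧ ∀ j, τ j ≤ m := by
  rw [Finset.mem_finsupp_iff]
  simp only [Finset.mem_range, Nat.lt_succ_iff]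
  refine and_congr_right fun h => ⟨fun h' j => ?_, fun h' j _ => h' j⟩
  by_cases hj : j ∈ J
  · exact h' j hj
  · rw [Finsupp.notMem_support_iff.1 fun h0 => hj (h h0)]
    exact Nat.zero_le _

/-- Boxes are closed under passing to smaller multi-indices, so a box contains all indices occurring
in the recursions of its members. Sums over boxes are finite, which makes absorption legitimate. -/
lemma mem_box_of_le {J : Finset ℕ} {m : ℕ} {τ μ : ℕ →₀ ℕ} (h : τ ≤ μ)
    (hμ : μ ∈ J.finsupp (fun _ => Finset.range (m + 1))) :
    τ ∈ J.finsupp (fun _ => Finset.range (m + 1)) := by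
  rw [mem_box] at *
  refine ⟨(Finsupp.support_mono h).trans hμ.1, fun j => (h j).trans (hμ.2 j)⟩

lemma exists_subset_box (S : Finset (ℕ →₀ ℕ)) :
    ∃ (J : Finset ℕ) (m : ℕ), S ⊆ J.finsupp (fun _ => Finset.range (m + 1)) := by
  classical
  refine ⟨S.biUnion fun τ => τ.support, S.sup fun τ => τ.support.sup τ, fun τ hτ => ?_⟩
  rw [mem_box]
  refine ⟨Finset.subset_biUnion_of_mem (fun τ : ℕ →₀ ℕ => τ.support) hτ, fun j => ?_⟩
  by_cases hj : j ∈ τ.support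
  · exact (Finset.le_sup (f := τ) hj).trans
      (Finset.le_sup (f := fun τ : ℕ →₀ ℕ => τ.support.sup τ) hτ)
  · rw [Finsupp.notMem_support_iff.1 hj]
    exact Nat.zero_le _

/-- The weight `ρ^τ`. -/
def wt (ρ : ℕ → ℝ) (τ : ℕ →₀ ℕ) : ℝ := τ.prod fun j n => ρ j ^ n

lemma wt_add (ρ : ℕ → ℝ) (τ κ : ℕ →₀ ℕ) : wt ρ (τ + κ) = wt ρ τ * wt ρ κ :=
  Finsupp.prod_add_index' (fun _ => pow_zero _) fun _ _ _ => pow_add _ _ _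

lemma wt_zero (ρ : ℕ → ℝ) : wt ρ 0 = 1 := Finsupp.prod_zero_index

lemma wt_pos {ρ : ℕ → ℝ} (hρ : ∀ j, 0 < ρ j) (τ : ℕ →₀ ℕ) : 0 < wt ρ τ :=
  Finset.prod_pos fun j _ => pow_pos (hρ j) _

/-- The monomial `a^τ / τ!`. -/
def mono (a : ℕ → ℝ) (τ : ℕ →₀ ℕ) : ℝ := τ.prod fun j n => a j ^ n / (n.factorial : ℝ)

/-- The sum over a box factors into truncated exponential series, one for each `j`. -/
lemma sum_box_wt_mono_le {ρ a : ℕ → ℝ} (hρ : ∀ j, 0 < ρ j) {J : Finset ℕ} {K : ℝ} (m : ℕ)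
    (hK : ∑ j ∈ J, ρ j * |a j| ≤ K) :
    ∑ τ ∈ J.finsupp (fun _ => Finset.range (m + 1)), wt ρ τ * |mono a τ| ≤ Real.exp K := by
  have e : ∀ τ ∈ J.finsupp (fun _ => Finset.range (m + 1)), wt ρ τ * |mono a τ|
      = ∏ j ∈ J, (ρ j * |a j|) ^ τ j / ((τ j).factorial : ℝ) := by
    intro τ hτ
    rw [wt, mono, finsupp_prod_eq_prod (mem_box.1 hτ).1 (by simp),
      finsupp_prod_eq_prod (mem_box.1 hτ).1 (by simp), Finset.abs_prod, ← Finset.prod_mul_distrib]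
    refine Finset.prod_congr rfl fun j _ => ?_
    rw [abs_div, abs_pow, Nat.abs_cast, mul_pow]
    ring
  rw [Finset.sum_congr rfl e, sum_finsupp_prod J (fun _ => Finset.range (m + 1))
    fun j n => (ρ j * |a j|) ^ n / (n.factorial : ℝ)]
  refine le_trans (Finset.prod_le_prod (fun j _ => Finset.sum_nonneg fun n _ => ?_) fun j _ =>
    Real.sum_le_exp_of_nonneg (mul_nonneg (hρ j).le (abs_nonneg _)) _) ?_
  · have := (hρ j).le
    positivity
  · rw [← Real.exp_sum]
    exact Real.exp_le_exp.2 hK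

lemma sum_le_sum_of_injOn_of_maps {ι κ : Type*} [DecidableEq κ] {s : Finset ι} {t : Finset κ}
    {φ : ι → κ}
    (hφ : Set.InjOn φ s) (hm : ∀ i ∈ s, φ i ∈ t) {g : κ → ℝ} (hg : ∀ k, 0 ≤ g k) :
    ∑ i ∈ s, g (φ i) ≤ ∑ k ∈ t, g k := by
  rw [← Finset.sum_image (f := g) hφ]
  exact Finset.sum_le_sum_of_subset_of_nonneg (Finset.image_subset_iff.2 hm) fun k _ _ => hg k

/-- With `g(μ) = (ρ^μ ‖v_μ‖)²`, multiplicativity of the weight and Young's inequality bound the term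
with index `τ` by `ρ^τ |a^τ| / τ!` times the mean of `g(μ - τ)` and `g(μ)`. Summed over `μ`, that
mean is at most `∑ g`. -/
lemma sum_convolution_le {ρ a : ℕ → ℝ} (hρ : ∀ j, 0 < ρ j) {J : Finset ℕ} {K : ℝ} (m : ℕ)
    (hK : ∑ j ∈ J, ρ j * |a j| ≤ K) (hK' : Real.exp K ≤ 3 / 2)
    {F : Type*} [NormedAddCommGroup F] [InnerProductSpace ℝ F] (v : (ℕ →₀ ℕ) → F) :
    ∑ μ ∈ J.finsupp (fun _ => Finset.range (m + 1)), wt ρ μ ^ 2 *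
      ∑ p ∈ (Finset.HasAntidiagonal.antidiagonal μ).filter (fun p => p.1 ≠ 0),
        -(mono a p.1 * inner ℝ (v p.2) (v μ))
      ≤ 1 / 2 * ∑ μ ∈ J.finsupp (fun _ => Finset.range (m + 1)), wt ρ μ ^ 2 * ‖v μ‖ ^ 2 := by
  classical
  set I := J.finsupp (fun _ => Finset.range (m + 1)) with hI
  set g : (ℕ →₀ ℕ) → ℝ := fun μ => (wt ρ μ * ‖v μ‖) ^ 2 with hg
  have hg0 : ∀ μ, 0 ≤ g μ := fun μ => sq_nonneg _
  -- Dropping `τ = 0` removes the summand 1 from a sum bounded by `e^K ≤ 3/2`.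
  have hsum : ∑ τ ∈ I.erase 0, wt ρ τ * |mono a τ| ≤ 1 / 2 := by
    have h := sum_box_wt_mono_le hρ m hK
    have h0 : (0 : ℕ →₀ ℕ) ∈ I := by simp [hI, mem_box]
    rw [← hI, ← Finset.add_sum_erase _ _ h0, wt_zero] at h
    have : mono a 0 = 1 := Finsupp.prod_zero_index
    rw [this] at h
    norm_num at h
    linarith
  have h1 : ∀ μ ∈ I, wt ρ μ ^ 2 *
      ∑ p ∈ (Finset.HasAntidiagonal.antidiagonal μ).filter (fun p => p.1 ≠ 0),
        -(mono a p.1 * inner ℝ (v p.2) (v μ))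
      ≤ ∑ τ ∈ I.erase 0, if τ ≤ μ then wt ρ τ * |mono a τ| * (1 / 2 * (g (μ - τ) + g μ))
        else 0 := by
    intro μ hμ
    rw [← Finset.sum_filter, Finset.mul_sum]
    calc _ ≤ ∑ p ∈ (Finset.HasAntidiagonal.antidiagonal μ).filter (fun p => p.1 ≠ 0),
          (fun τ => wt ρ τ * |mono a τ| * (1 / 2 * (g (μ - τ) + g μ))) p.1 := by
          refine Finset.sum_le_sum fun p hp => ?_
          rw [Finset.mem_filter, Finset.HasAntidiagonal.mem_antidiagonal] at hp
          have e : μ - p.1 = p.2 := by rw [← hp.1, add_tsub_cancel_left]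
          simp only [e]
          have h2 : -(mono a p.1 * inner ℝ (v p.2) (v μ)) ≤ |mono a p.1| * (‖v p.2‖ * ‖v μ‖) := by
            refine (neg_le_abs _).trans ?_
            rw [abs_mul]
            gcongr
            exact abs_real_inner_le_norm _ _
          have h3 : wt ρ μ = wt ρ p.1 * wt ρ p.2 := by rw [← hp.1, wt_add]
          have hp1 := wt_pos hρ p.1
          calc _ ≤ wt ρ μ ^ 2 * (|mono a p.1| * (‖v p.2‖ * ‖v μ‖)) := by gcongr
            _ = wt ρ p.1 * |mono a p.1| * ((wt ρ p.2 * ‖v p.2‖) * (wt ρ μ * ‖v μ‖)) := by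
              rw [sq]; nth_rewrite 1 [h3]; ring
            _ ≤ _ := by
              refine mul_le_mul_of_nonneg_left ?_ (by positivity)
              simp only [hg]
              nlinarith [sq_nonneg (wt ρ p.2 * ‖v p.2‖ - wt ρ μ * ‖v μ‖)]
      _ ≤ _ := by
          refine sum_le_sum_of_injOn_of_maps (φ := Prod.fst)
            (g := fun τ => wt ρ τ * |mono a τ| * (1 / 2 * (g (μ - τ) + g μ))) ?_ ?_ ?_
          · rintro ⟨p1, p2⟩ hp ⟨q1, q2⟩ hq h
            simp only [Finset.coe_filter, Finset.HasAntidiagonal.mem_antidiagonal, Set.mem_ofPred_eq] at hp hq h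
            subst h
            rw [Prod.mk.injEq]
            exact ⟨rfl, add_left_cancel (hp.1.trans hq.1.symm)⟩
          · intro p hp
            rw [Finset.mem_filter, Finset.HasAntidiagonal.mem_antidiagonal] at hp
            have : p.1 ≤ μ := by rw [← hp.1]; exact le_self_add
            rw [Finset.mem_filter, Finset.mem_erase]
            exact ⟨⟨hp.2, mem_box_of_le this hμ⟩, this⟩
          · intro τ
            have h1 := (wt_pos hρ τ).le
            have h2 := hg0 (μ - τ)
            have h3 := hg0 μ
            positivity
  refine (Finset.sum_le_sum h1).trans ?_
  rw [Finset.sum_comm]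
  have h2 : ∀ τ ∈ I.erase 0, (∑ μ ∈ I, if τ ≤ μ then wt ρ τ * |mono a τ| *
      (1 / 2 * (g (μ - τ) + g μ)) else 0) ≤ wt ρ τ * |mono a τ| * ∑ μ ∈ I, g μ := by
    intro τ _
    rw [← Finset.sum_filter, ← Finset.mul_sum, ← Finset.mul_sum, Finset.sum_add_distrib]
    -- Subtraction of `τ` is injective on `μ ≥ τ` and does not leave the box.
    have h4 : ∑ μ ∈ I.filter (fun μ => τ ≤ μ), g (μ - τ) ≤ ∑ μ ∈ I, g μ := by
      refine sum_le_sum_of_injOn_of_maps (φ := fun μ => μ - τ) ?_ ?_ hg0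
      · intro μ hμ κ hκ h
        simp only [Finset.coe_filter, Set.mem_ofPred_eq] at hμ hκ h
        rw [← tsub_add_cancel_of_le hμ.2, ← tsub_add_cancel_of_le hκ.2, h]
      · intro μ hμ
        exact mem_box_of_le tsub_le_self (Finset.mem_filter.1 hμ).1
    have h5 : ∑ μ ∈ I.filter (fun μ => τ ≤ μ), g μ ≤ ∑ μ ∈ I, g μ :=
      Finset.sum_le_sum_of_subset_of_nonneg (Finset.filter_subset _ _) fun _ _ _ => hg0 _
    have h1 := (wt_pos hρ τ).le
    gcongr
    linarith
  refine (Finset.sum_le_sum h2).trans ?_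
  rw [← Finset.sum_mul]
  simp only [hg, mul_pow]
  gcongr

end PointwiseEstimate

/-! ### The Lax–Milgram theorem. -/

section LaxMilgram

variable {V : Type*} [NormedAddCommGroup V] [InnerProductSpace ℝ V] [CompleteSpace V]

lemma isUnit_of_coercive {T : V →L[ℝ] V} {c : ℝ} (hc : 0 < c)
    (h : ∀ v, c * ‖v‖ ^ 2 ≤ inner ℝ (T v) v) : IsUnit T := by
  have hB : IsCoercive ((innerSL ℝ : V →L[ℝ] V →L[ℝ] ℝ) ∘L T) :=
    ⟨c, hc, fun v => by
      rw [mul_assoc, ← sq]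
      exact h v⟩
  have e : T = (hB.continuousLinearEquivOfBilin : V →L[ℝ] V) := by
    ext v
    exact hB.unique_continuousLinearEquivOfBilin fun w => rfl
  rw [e]
  exact (ContinuousLinearEquiv.toUnit hB.continuousLinearEquivOfBilin).isUnit

end LaxMilgram

/-! ### Taylor coefficients for an abstract exponential coefficient. -/

section ExpForm

/-- A family of coercive forms `⟪m(e^b) G v, G w⟫` whose coefficients `e^b` depend on `b` like an
exponential in a commutative Banach algebra, together with directions `ψ_j` and the monomials
`ψ^τ / τ!`. -/
structure ExpForm (L V H : Type*) [NormedAddCommGroup L] [NormedSpace ℝ L]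
    [NormedAddCommGroup V] [InnerProductSpace ℝ V] [NormedAddCommGroup H]
    [InnerProductSpace ℝ H] where
  G : V →L[ℝ] H
  m : L →L[ℝ] H →L[ℝ] H
  mul : L →L[ℝ] L →L[ℝ] L
  expo : L → L
  ψ : ℕ → L
  mon : (ℕ →₀ ℕ) → L
  mul_assoc : ∀ a b c, mul (mul a b) c = mul a (mul b c)
  hasFDerivAt_expo : ∀ b, HasFDerivAt expo (mul (expo b)) b
  mul_mon_zero : ∀ a, mul a (mon 0) = a
  mul_mon : ∀ τ j, mul (ψ j) (mon τ) = ((τ j : ℝ) + 1) • mon (τ + Finsupp.single j 1)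
  coercive : ∀ b, ∃ c > 0, ∀ v, c * ‖v‖ ^ 2 ≤ inner ℝ (m (expo b) (G v)) (G v)

namespace ExpForm

variable {L V H : Type*} [NormedAddCommGroup L] [NormedSpace ℝ L]
  [NormedAddCommGroup V] [InnerProductSpace ℝ V] [CompleteSpace V]
  [NormedAddCommGroup H] [InnerProductSpace ℝ H] [CompleteSpace H] (X : ExpForm L V H)

/-- The operators with the coefficients `e^b ψ^τ / τ!`. -/
def coeffOp (τ : ℕ →₀ ℕ) (b : L) : V →L[ℝ] V := formOp X.G X.m (X.mul (X.expo b) (X.mon τ))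

lemma isUnit_coeffOp_zero (b : L) : IsUnit (X.coeffOp 0 b) := by
  obtain ⟨c, hc, h⟩ := X.coercive b
  refine isUnit_of_coercive hc fun v => ?_
  rw [coeffOp, X.mul_mon_zero, inner_formOp]
  exact h v

lemma hasFDerivAt_coeffOp (τ : ℕ →₀ ℕ) (b : L) :
    HasFDerivAt (X.coeffOp τ)
      (formOp X.G X.m ∘L ((X.mul.flip (X.mon τ)) ∘L X.mul (X.expo b))) b :=
  ((formOp X.G X.m).hasFDerivAt (x := X.mul.flip (X.mon τ) (X.expo b))).comp b
    (((X.mul.flip (X.mon τ)).hasFDerivAt (x := X.expo b)).comp b (X.hasFDerivAt_expo b))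

lemma fderiv_coeffOp (τ : ℕ →₀ ℕ) (j : ℕ) (b : L) :
    fderiv ℝ (X.coeffOp τ) b (X.ψ j) = (τ j + 1) • X.coeffOp (τ + Finsupp.single j 1) b := by
  have h : formOp X.G X.m (X.mul (X.mul (X.expo b) (X.ψ j)) (X.mon τ))
      = (τ j + 1) • X.coeffOp (τ + Finsupp.single j 1) b := by
    rw [X.mul_assoc, X.mul_mon, map_smul, map_smul, coeffOp, ← Nat.cast_smul_eq_nsmul ℝ]
    push_cast
    rfl
  rw [(X.hasFDerivAt_coeffOp τ b).fderiv]
  exact h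

lemma differentiable_coeffOp (τ : ℕ →₀ ℕ) : Differentiable ℝ (X.coeffOp τ) :=
  fun b => (X.hasFDerivAt_coeffOp τ b).differentiableAt

variable (f : StrongDual ℝ V)

/-- The Taylor coefficients `(1 / ν!) ∂^ν u` of the solution at the coefficient `e^b` with respect
to the directions `ψ_j`. -/
def taylor (ν : ℕ →₀ ℕ) (b : L) : V :=
  invCoeff X.isUnit_coeffOp_zero ν b ((InnerProductSpace.toDual ℝ V).symm f)

/-- The identity `A B = 1` of power series is applied to the Riesz representative of `f` and tested
with `w`. This is the differentiated weak equation. -/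
lemma sum_inner_taylor (ν : ℕ →₀ ℕ) (b : L) (w : V) :
    ∑ p ∈ Finset.HasAntidiagonal.antidiagonal ν,
      inner ℝ (X.m (X.mul (X.expo b) (X.mon p.1)) (X.G (X.taylor f p.2 b))) (X.G w)
      = if ν = 0 then f w else 0 := by
  have h := DFunLike.congr_fun (sum_mul_invCoeff X.isUnit_coeffOp_zero ν b)
    ((InnerProductSpace.toDual ℝ V).symm f)
  rw [sum_apply] at h
  have h2 := congrArg (fun z => inner ℝ z w) h
  simp only [sum_inner] at h2
  refine (Finset.sum_congr rfl fun p _ => ?_).trans (h2.trans ?_)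
  · exact (inner_formOp X.G X.m _ _ _).symm
  · split_ifs
    · exact InnerProductSpace.toDual_symm_apply
    · exact inner_zero_left _

lemma inner_taylor_zero (b : L) (w : V) :
    inner ℝ (X.m (X.expo b) (X.G (X.taylor f 0 b))) (X.G w) = f w := by
  have h := X.sum_inner_taylor f 0 b w
  rwa [if_pos rfl, Finset.HasAntidiagonal.antidiagonal_zero, Finset.sum_singleton,
    X.mul_mon_zero] at h

lemma eq_taylor_zero {b : L} {v : V}
    (hv : ∀ w, inner ℝ (X.m (X.expo b) (X.G v)) (X.G w) = f w) : v = X.taylor f 0 b := by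
  obtain ⟨c, hc, h⟩ := X.coercive b
  have h2 := h (v - X.taylor f 0 b)
  rw [map_sub X.G v, map_sub (X.m (X.expo b)), inner_sub_left, ← map_sub X.G v, hv,
    X.inner_taylor_zero, sub_self] at h2
  have h3 : ‖v - X.taylor f 0 b‖ ^ 2 = 0 := le_antisymm (by
    by_contra! h4
    nlinarith [mul_pos hc h4]) (sq_nonneg _)
  rwa [sq_eq_zero_iff, norm_eq_zero, sub_eq_zero] at h3

lemma differentiable_taylor (ν : ℕ →₀ ℕ) : Differentiable ℝ (X.taylor f ν) := fun b =>
  ((differentiable_invCoeff X.isUnit_coeffOp_zero X.differentiable_coeffOp ν b).clm_apply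
    (differentiableAt_const _))

lemma fderiv_taylor (ν : ℕ →₀ ℕ) (j : ℕ) (b : L) :
    fderiv ℝ (X.taylor f ν) b (X.ψ j)
      = ((ν j : ℝ) + 1) • X.taylor f (ν + Finsupp.single j 1) b := by
  have h1 := (differentiable_invCoeff X.isUnit_coeffOp_zero
    X.differentiable_coeffOp ν b).hasFDerivAt.clm_apply
      (hasFDerivAt_const ((InnerProductSpace.toDual ℝ V).symm f) b)
  have h2 := fderiv_invCoeff X.isUnit_coeffOp_zero X.differentiable_coeffOp X.fderiv_coeffOp ν j b
  have h3 : fderiv ℝ (X.taylor f ν) b (X.ψ j)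
      = fderiv ℝ (invCoeff X.isUnit_coeffOp_zero ν) b (X.ψ j)
        ((InnerProductSpace.toDual ℝ V).symm f) := by
    have : HasFDerivAt (X.taylor f ν) _ b := h1
    rw [this.fderiv]
    simp
  rw [h3, h2, taylor, smul_apply, ← Nat.cast_smul_eq_nsmul ℝ]
  push_cast
  rfl

lemma hasDerivAt_taylor (ν : ℕ →₀ ℕ) (j : ℕ) (b : L) (s : ℝ) :
    HasDerivAt (fun s : ℝ => X.taylor f ν (b + s • X.ψ j))
      (((ν j : ℝ) + 1) • X.taylor f (ν + Finsupp.single j 1) (b + s • X.ψ j)) s := by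
  rw [← fderiv_taylor]
  have h1 : HasDerivAt (fun s : ℝ => b + s • X.ψ j) (X.ψ j) s := by
    simpa using ((hasDerivAt_id s).smul_const (X.ψ j)).const_add b
  exact (X.differentiable_taylor f ν _).hasFDerivAt.comp_hasDerivAt s h1

end ExpForm

end ExpForm

/-! ### Estimates of the Taylor coefficients of the diffusion problem. -/

section Taylor

variable {d : ℕ} {D : Set (E d)}

lemma mulL_monoL_zero (a : LInfty D) (ψ : ℕ → LInfty D) : mulL a (monoL ψ 0) = a := by
  apply Lp.ext
  filter_upwards [coeFn_mulL a (monoL ψ 0), monoL_zero_coeFn ψ] with x h1 h2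
  rw [h1, h2, mul_one]

lemma mulL_assoc (a b c : LInfty D) : mulL (mulL a b) c = mulL a (mulL b c) := by
  apply Lp.ext
  filter_upwards [coeFn_mulL a b, coeFn_mulL (mulL a b) c, coeFn_mulL b c,
    coeFn_mulL a (mulL b c)] with x h1 h2 h3 h4
  rw [h2, h1, h4, h3, mul_assoc]

/-- The forms `∫ e^b ∇v ⬝ ∇w` on `H¹₀(D)`. -/
def diffusionForm (ψ : ℕ → LInfty D) {P : ℝ} (hP0 : 0 < P)
    (hP : ∀ v : H10 D, ‖v‖ ≤ P * normV v) : ExpForm (LInfty D) (H10 D) (VecL2 D) where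
  G := gradL
  m := smulVec
  mul := mulL
  expo := expL
  ψ := ψ
  mon := monoL ψ
  mul_assoc := mulL_assoc
  hasFDerivAt_expo := hasFDerivAt_expL
  mul_mon_zero := fun a => mulL_monoL_zero a ψ
  mul_mon := mulL_monoL ψ
  coercive := fun b => by
    refine ⟨Real.exp (-‖b‖) / P ^ 2, by positivity, fun v => ?_⟩
    refine le_trans ?_ (norm_sq_le_inner_expL b (gradL v))
    rw [norm_gradL_apply, div_mul_eq_mul_div, div_le_iff₀ (by positivity), mul_assoc]
    gcongr
    rw [← mul_pow, mul_comm]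
    gcongr
    exact hP v

variable {P : ℝ} (hP0 : 0 < P) (hP : ∀ v : H10 D, ‖v‖ ≤ P * normV v)
  (ψ : ℕ → LInfty D) (f : StrongDual ℝ (H10 D))

/-- The Taylor coefficients `(1 / ν!) ∂^ν u` of the weak solution at the coefficient `e^b`. -/
def taylor (ν : ℕ →₀ ℕ) (b : LInfty D) : H10 D := (diffusionForm ψ hP0 hP).taylor f ν b

lemma isWeakSolution_iff (b : LInfty D) (v : H10 D) : IsWeakSolution b f v ↔
    ∀ w : H10 D, inner ℝ (smulVec (expL b) (gradL v)) (gradL w) = f w := by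
  refine forall_congr' fun w => ?_
  have key : inner ℝ (smulVec (expL b) (gradL v)) (gradL w)
      = ∫ x in D, Real.exp (b x) * inner ℝ (grad v x) (grad w x) := by
    rw [inner_smulVec]
    refine integral_congr_ae ?_
    filter_upwards [coeFn_expL b] with x hx
    rw [hx]; rfl
  rw [key]

lemma inner_expL_taylor_zero (b : LInfty D) (w : H10 D) :
    inner ℝ (smulVec (expL b) (gradL (taylor hP0 hP ψ f 0 b))) (gradL w) = f w :=
  (diffusionForm ψ hP0 hP).inner_taylor_zero f b w

lemma isWeakSolution_iff_eq_taylor (b : LInfty D) (v : H10 D) :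
    IsWeakSolution b f v ↔ v = taylor hP0 hP ψ f 0 b := by
  rw [isWeakSolution_iff]
  refine ⟨fun h => (diffusionForm ψ hP0 hP).eq_taylor_zero f h, ?_⟩
  rintro rfl
  exact inner_expL_taylor_zero hP0 hP ψ f b

lemma sum_inner_taylor (ν : ℕ →₀ ℕ) (b : LInfty D) (w : H10 D) :
    ∑ p ∈ Finset.HasAntidiagonal.antidiagonal ν,
      inner ℝ (smulVec (mulL (expL b) (monoL ψ p.1)) (gradL (taylor hP0 hP ψ f p.2 b))) (gradL w)
      = if ν = 0 then f w else 0 :=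
  (diffusionForm ψ hP0 hP).sum_inner_taylor f ν b w

lemma continuous_taylor (ν : ℕ →₀ ℕ) : Continuous (taylor hP0 hP ψ f ν) :=
  ((diffusionForm ψ hP0 hP).differentiable_taylor f ν).continuous

lemma hasDerivAt_taylor (ν : ℕ →₀ ℕ) (j : ℕ) (b : LInfty D) (s : ℝ) :
    HasDerivAt (fun s : ℝ => taylor hP0 hP ψ f ν (b + s • ψ j))
      (((ν j : ℝ) + 1) • taylor hP0 hP ψ f (ν + Finsupp.single j 1) (b + s • ψ j)) s :=
  (diffusionForm ψ hP0 hP).hasDerivAt_taylor f ν j b s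

include hP in
lemma abs_apply_le_normV (w : H10 D) : |f w| ≤ ‖f‖ * P * normV w := by
  refine (f.le_opNorm w).trans ?_
  rw [mul_assoc]
  gcongr
  exact hP w

/-- Test the equation with the solution itself and use `e^b ≥ e^{-‖b‖}`. -/
lemma normV_taylor_zero_le (b : LInfty D) :
    normV (taylor hP0 hP ψ f 0 b) ≤ ‖f‖ * P * Real.exp ‖b‖ := by
  set u := taylor hP0 hP ψ f 0 b
  have h1 := norm_sq_le_inner_expL b (gradL u)
  rw [inner_expL_taylor_zero, norm_gradL_apply] at h1
  have h2 := (le_abs_self _).trans (abs_apply_le_normV hP f u)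
  have h3 : 0 ≤ normV u := norm_nonneg _
  rcases h3.eq_or_lt with h0 | h0
  · rw [← h0]; positivity
  · have h4 : Real.exp (-‖b‖) * normV u ≤ ‖f‖ * P := by
      refine le_of_mul_le_mul_right ?_ h0
      linarith
    rw [Real.exp_neg, inv_mul_le_iff₀ (Real.exp_pos _)] at h4
    linarith

/-- `sum_convolution_le` is applied at almost every `x` with `a_j = ψ_j(x)`, multiplied by
`e^{b(x)}` and integrated. -/
lemma integral_convolution_le {ψ : ℕ → LInfty D} {ρ : ℕ → ℝ} (hρ : ∀ j, 0 < ρ j) {K : ℝ}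
    (hK' : Real.exp K ≤ 3 / 2)
    (hK : ∀ᵐ x ∂(volume : Measure (E d)).restrict D, ∀ J : Finset ℕ, ∑ j ∈ J, ρ j * |ψ j x| ≤ K)
    (J : Finset ℕ) (m : ℕ) (b : LInfty D) (v : (ℕ →₀ ℕ) → VecL2 D) :
    ∑ μ ∈ J.finsupp (fun _ => Finset.range (m + 1)),
      ∑ p ∈ (Finset.HasAntidiagonal.antidiagonal μ).filter (fun p => p.1 ≠ 0),
        wt ρ μ ^ 2 * -∫ x in D, mulL (expL b) (monoL ψ p.1) x * inner ℝ (v p.2 x) (v μ x)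
      ≤ ∑ μ ∈ J.finsupp (fun _ => Finset.range (m + 1)),
        1 / 2 * (wt ρ μ ^ 2 * ∫ x in D, expL b x * inner ℝ (v μ x) (v μ x)) := by
  have i1 : ∀ (μ : ℕ →₀ ℕ) (p : (ℕ →₀ ℕ) × (ℕ →₀ ℕ)), Integrable (fun x => wt ρ μ ^ 2 *
      -(mulL (expL b) (monoL ψ p.1) x * inner ℝ (v p.2 x) (v μ x)))
      ((volume : Measure (E d)).restrict D) := fun μ p =>
    ((integrable_mul_inner _ _ _).neg).const_mul _
  have i2 : ∀ μ : ℕ →₀ ℕ, Integrable (fun x => 1 / 2 * (wt ρ μ ^ 2 *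
      (expL b x * inner ℝ (v μ x) (v μ x)))) ((volume : Measure (E d)).restrict D) := fun μ =>
    ((integrable_mul_inner _ _ _).const_mul _).const_mul _
  have e1 : ∀ (μ : ℕ →₀ ℕ) (p : (ℕ →₀ ℕ) × (ℕ →₀ ℕ)),
      wt ρ μ ^ 2 * -∫ x in D, mulL (expL b) (monoL ψ p.1) x * inner ℝ (v p.2 x) (v μ x)
      = ∫ x in D, wt ρ μ ^ 2 *
        -(mulL (expL b) (monoL ψ p.1) x * inner ℝ (v p.2 x) (v μ x)) := fun μ p => by
    rw [integral_const_mul, integral_neg]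
  have e2 : ∀ μ : ℕ →₀ ℕ, 1 / 2 * (wt ρ μ ^ 2 * ∫ x in D, expL b x * inner ℝ (v μ x) (v μ x))
      = ∫ x in D, 1 / 2 * (wt ρ μ ^ 2 * (expL b x * inner ℝ (v μ x) (v μ x))) := fun μ => by
    rw [integral_const_mul, integral_const_mul]
  have e3 : ∀ μ : ℕ →₀ ℕ,
      ∑ p ∈ (Finset.HasAntidiagonal.antidiagonal μ).filter (fun p => p.1 ≠ 0),
        ∫ x in D, wt ρ μ ^ 2 * -(mulL (expL b) (monoL ψ p.1) x * inner ℝ (v p.2 x) (v μ x))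
      = ∫ x in D, ∑ p ∈ (Finset.HasAntidiagonal.antidiagonal μ).filter (fun p => p.1 ≠ 0),
        wt ρ μ ^ 2 * -(mulL (expL b) (monoL ψ p.1) x * inner ℝ (v p.2 x) (v μ x)) := fun μ =>
    (integral_finsetSum _ fun p _ => i1 μ p).symm
  simp only [e1, e2]
  rw [Finset.sum_congr rfl fun μ _ => e3 μ,
    ← integral_finsetSum _ fun μ _ => integrable_finsetSum _ fun p _ => i1 μ p,
    ← integral_finsetSum _ fun μ _ => i2 μ]
  refine integral_mono_ae (integrable_finsetSum _ fun μ _ => integrable_finsetSum _ fun p _ =>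
    i1 μ p) (integrable_finsetSum _ fun μ _ => i2 μ) ?_
  filter_upwards [hK, coeFn_expL b, ae_all_iff.2 fun τ => coeFn_monoL ψ τ,
    ae_all_iff.2 fun τ => coeFn_mulL (expL b) (monoL ψ τ)] with x h1 h2 h3 h4
  have key := sum_convolution_le (a := fun j => ψ j x) hρ m (h1 J) hK' fun μ => v μ x
  have key2 := mul_le_mul_of_nonneg_left key (Real.exp_pos (b x)).le
  refine le_trans (le_of_eq ?_) (key2.trans (le_of_eq ?_))
  · simp only [Finset.mul_sum]
    refine Finset.sum_congr rfl fun μ _ => Finset.sum_congr rfl fun p _ => ?_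
    rw [h4, h2, h3]
    simp only [mono, Finsupp.prod]
    ring
  · simp only [Finset.mul_sum]
    refine Finset.sum_congr rfl fun μ _ => ?_
    rw [h2, real_inner_self_eq_norm_sq]
    ring

/-- The recursion is tested with the coefficient at `μ` itself, and the term `τ = 0` is isolated. -/
lemma integral_expL_taylor (μ : ℕ →₀ ℕ) (b : LInfty D) :
    ∫ x in D, expL b x * inner ℝ (gradL (taylor hP0 hP ψ f μ b) x)
        (gradL (taylor hP0 hP ψ f μ b) x)
      = (if μ = 0 then f (taylor hP0 hP ψ f μ b) else 0) +
      ∑ p ∈ (Finset.HasAntidiagonal.antidiagonal μ).filter (fun p => p.1 ≠ 0),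
        -∫ x in D, mulL (expL b) (monoL ψ p.1) x *
          inner ℝ (gradL (taylor hP0 hP ψ f p.2 b) x) (gradL (taylor hP0 hP ψ f μ b) x) := by
  have h1 := sum_inner_taylor hP0 hP ψ f μ b (taylor hP0 hP ψ f μ b)
  rw [← Finset.sum_filter_add_sum_filter_not _ (fun p => p.1 ≠ 0)] at h1
  have h2 : (Finset.HasAntidiagonal.antidiagonal μ).filter (fun p => ¬ p.1 ≠ 0) = {(0, μ)} := by
    ext ⟨p1, p2⟩
    simp only [Finset.mem_filter, Finset.HasAntidiagonal.mem_antidiagonal, Finset.mem_singleton,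
      not_not, Prod.mk.injEq]
    constructor
    · rintro ⟨h, rfl⟩; exact ⟨rfl, by simpa using h⟩
    · rintro ⟨rfl, rfl⟩; simp
  rw [h2, Finset.sum_singleton] at h1
  simp only [mulL_monoL_zero, inner_smulVec] at h1
  rw [← h1, Finset.sum_neg_distrib, add_comm _ (∫ x in D, _), add_neg_cancel_right]

/-- If `N` is the weighted energy over a box, `hv` and the convolution estimate give `N ≤ c 0 + N /
2`, hence `N ≤ 2 c 0`. Ellipticity costs the factor `e^{‖b‖}`. -/
lemma sum_wt_norm_sq_le {ψ : ℕ → LInfty D} {ρ : ℕ → ℝ} (hρ : ∀ j, 0 < ρ j) {K : ℝ}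
    (hK' : Real.exp K ≤ 3 / 2)
    (hK : ∀ᵐ x ∂(volume : Measure (E d)).restrict D, ∀ J : Finset ℕ, ∑ j ∈ J, ρ j * |ψ j x| ≤ K)
    (S : Finset (ℕ →₀ ℕ)) (b : LInfty D) (v : (ℕ →₀ ℕ) → VecL2 D) {c : (ℕ →₀ ℕ) → ℝ}
    (hv : ∀ μ, ∫ x in D, expL b x * inner ℝ (v μ x) (v μ x) = (if μ = 0 then c μ else 0) +
      ∑ p ∈ (Finset.HasAntidiagonal.antidiagonal μ).filter (fun p => p.1 ≠ 0),
        -∫ x in D, mulL (expL b) (monoL ψ p.1) x * inner ℝ (v p.2 x) (v μ x)) :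
    ∑ μ ∈ S, wt ρ μ ^ 2 * ‖v μ‖ ^ 2 ≤ Real.exp ‖b‖ * (2 * c 0) := by
  obtain ⟨J, m, hS⟩ := exists_subset_box S
  have hN := integral_convolution_le hρ hK' hK J m b v
  have h0I : (0 : ℕ →₀ ℕ) ∈ J.finsupp (fun _ => Finset.range (m + 1)) := by simp [mem_box]
  rw [← Finset.mul_sum] at hN
  have h1 : ∑ μ ∈ J.finsupp (fun _ => Finset.range (m + 1)), wt ρ μ ^ 2 *
      ∫ x in D, expL b x * inner ℝ (v μ x) (v μ x) ≤ 2 * c 0 := by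
    have h2 : ∑ μ ∈ J.finsupp (fun _ => Finset.range (m + 1)), wt ρ μ ^ 2 *
        (if μ = 0 then c μ else 0) = c 0 := by
      rw [Finset.sum_eq_single_of_mem 0 h0I fun μ _ h => by rw [if_neg h, mul_zero], if_pos rfl,
        wt_zero, one_pow, one_mul]
    have h3 : ∑ μ ∈ J.finsupp (fun _ => Finset.range (m + 1)), wt ρ μ ^ 2 *
        ∫ x in D, expL b x * inner ℝ (v μ x) (v μ x) = c 0 +
        ∑ μ ∈ J.finsupp (fun _ => Finset.range (m + 1)),
        ∑ p ∈ (Finset.HasAntidiagonal.antidiagonal μ).filter (fun p => p.1 ≠ 0),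
          wt ρ μ ^ 2 * -∫ x in D, mulL (expL b) (monoL ψ p.1) x * inner ℝ (v p.2 x) (v μ x) := by
      rw [← h2, ← Finset.sum_add_distrib]
      refine Finset.sum_congr rfl fun μ _ => ?_
      rw [hv, mul_add, Finset.mul_sum]
    linarith
  have h7 : ∀ μ, ‖v μ‖ ^ 2 ≤ Real.exp ‖b‖ * ∫ x in D, expL b x * inner ℝ (v μ x) (v μ x) := by
    intro μ
    have := norm_sq_le_inner_expL b (v μ)
    rwa [Real.exp_neg, inv_mul_le_iff₀ (Real.exp_pos _), inner_smulVec] at this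
  calc ∑ μ ∈ S, wt ρ μ ^ 2 * ‖v μ‖ ^ 2
      ≤ ∑ μ ∈ J.finsupp (fun _ => Finset.range (m + 1)), wt ρ μ ^ 2 * ‖v μ‖ ^ 2 :=
        Finset.sum_le_sum_of_subset_of_nonneg hS fun _ _ _ => by positivity
    _ ≤ ∑ μ ∈ J.finsupp (fun _ => Finset.range (m + 1)), wt ρ μ ^ 2 * (Real.exp ‖b‖ *
          ∫ x in D, expL b x * inner ℝ (v μ x) (v μ x)) :=
        Finset.sum_le_sum fun μ _ => mul_le_mul_of_nonneg_left (h7 μ) (sq_nonneg _)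
    _ = Real.exp ‖b‖ * ∑ μ ∈ J.finsupp (fun _ => Finset.range (m + 1)), wt ρ μ ^ 2 *
          ∫ x in D, expL b x * inner ℝ (v μ x) (v μ x) := by
        rw [Finset.mul_sum]
        exact Finset.sum_congr rfl fun _ _ => by ring
    _ ≤ _ := mul_le_mul_of_nonneg_left h1 (Real.exp_pos _).le

/-- Weighted square summability of the Taylor coefficients. -/
lemma sum_wt_normV_taylor_le {ρ : ℕ → ℝ} (hρ : ∀ j, 0 < ρ j) {K : ℝ} (hK' : Real.exp K ≤ 3 / 2)
    (hK : ∀ᵐ x ∂(volume : Measure (E d)).restrict D, ∀ J : Finset ℕ, ∑ j ∈ J, ρ j * |ψ j x| ≤ K)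
    (S : Finset (ℕ →₀ ℕ)) (b : LInfty D) :
    ∑ μ ∈ S, wt ρ μ ^ 2 * normV (taylor hP0 hP ψ f μ b) ^ 2
      ≤ 2 * (‖f‖ * P) ^ 2 * Real.exp (2 * ‖b‖) := by
  have h1 := sum_wt_norm_sq_le hρ hK' hK S b _ fun μ => integral_expL_taylor hP0 hP ψ f μ b
  -- The quantity `c 0` is `f(t_0) ≤ (‖f‖ P)² e^{‖b‖}`, which supplies the second factor `e^{‖b‖}`.
  have h4 := (le_abs_self _).trans (abs_apply_le_normV hP f (taylor hP0 hP ψ f 0 b))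
  have h5 := mul_le_mul_of_nonneg_left (normV_taylor_zero_le hP0 hP ψ f b)
    (mul_nonneg (norm_nonneg f) hP0.le)
  refine (h1.trans (mul_le_mul_of_nonneg_left (mul_le_mul_of_nonneg_left (h4.trans h5)
    zero_le_two) (Real.exp_pos _).le)).trans (le_of_eq ?_)
  rw [two_mul ‖b‖, Real.exp_add]
  ring

end Taylor

/-! ### Hermite polynomials in one variable. -/

section UnivariateHermite

open Polynomial in
/-- The probabilists' Hermite polynomials with real coefficients. -/
def hePoly (n : ℕ) : ℝ[X] := (Polynomial.hermite n).map (Int.castRingHom ℝ)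

open Polynomial in
lemma hePoly_succ (n : ℕ) : hePoly (n + 1) = X * hePoly n - derivative (hePoly n) := by
  simp [hePoly, Polynomial.hermite_succ, derivative_map]

lemma hePoly_zero : hePoly 0 = 1 := by simp [hePoly]

lemma hePoly_monic (n : ℕ) : (hePoly n).Monic := (Polynomial.hermite_monic n).map _

lemma natDegree_hePoly (n : ℕ) : (hePoly n).natDegree = n := by
  rw [hePoly, (Polynomial.hermite_monic n).natDegree_map, Polynomial.natDegree_hermite]

/-- The value of the Hermite polynomial of degree `n` that is not normalized. -/
def he (n : ℕ) (t : ℝ) : ℝ := (hePoly n).eval t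

lemma he_zero (t : ℝ) : he 0 t = 1 := by simp [he, hePoly_zero]

lemma hermite1_eq (n : ℕ) (t : ℝ) : hermite1 n t = he n t / Real.sqrt (n.factorial : ℝ) := by
  rw [hermite1, he, hePoly, Polynomial.eval_map, Polynomial.aeval_def]
  rfl

lemma hermite1_zero (t : ℝ) : hermite1 0 t = 1 := by simp [hermite1_eq, he_zero]

/-- The standard Gaussian measure on `ℝ`. -/
abbrev gauss : Measure ℝ := gaussianReal 0 1

lemma integrable_gauss_iff {H : Type*} [NormedAddCommGroup H] [NormedSpace ℝ H] {g : ℝ → H} :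
    Integrable g gauss ↔ Integrable fun t => gaussianPDFReal 0 1 t • g t := by
  rw [gauss, gaussianReal_of_var_ne_zero _ one_ne_zero,
    integrable_withDensity_iff_integrable_smul' (measurable_gaussianPDF 0 1)
      (ae_of_all _ fun _ => gaussianPDF_lt_top)]
  simp_rw [toReal_gaussianPDF]

lemma hasDerivAt_gaussianPDFReal (t : ℝ) :
    HasDerivAt (gaussianPDFReal 0 1) (-t * gaussianPDFReal 0 1 t) t := by
  have h : gaussianPDFReal 0 1 = fun t => (Real.sqrt (2 * Real.pi))⁻¹ * Real.exp (-t ^ 2 / 2) := by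
    funext t
    simp [gaussianPDFReal]
  rw [h]
  have h1 : HasDerivAt (fun t : ℝ => -t ^ 2 / 2) (-t) t := by
    have := ((hasDerivAt_pow 2 t).neg).div_const 2
    convert! this using 1
    simp only [Nat.cast_ofNat]
    ring
  convert! (h1.exp.const_mul _) using 1
  ring

/-- The density has derivative `-t` times itself, which matches the recursion `He_{n+1} = t He_n -
He_n'`. -/
lemma hasDerivAt_pdf_mul_he (n : ℕ) (t : ℝ) :
    HasDerivAt (fun t => gaussianPDFReal 0 1 t * he n t)
      (-(gaussianPDFReal 0 1 t * he (n + 1) t)) t := by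
  have h := (hasDerivAt_gaussianPDFReal t).mul ((hePoly n).hasDerivAt t)
  convert! h using 1
  simp only [he, hePoly_succ, Polynomial.eval_sub, Polynomial.eval_mul, Polynomial.eval_X]
  ring

lemma integral_he_succ_smul {H : Type*} [NormedAddCommGroup H] [NormedSpace ℝ H]
    {g g' : ℝ → H} (n : ℕ) (hg : ∀ s, HasDerivAt g (g' s) s)
    (h1 : Integrable (fun s => he (n + 1) s • g s) gauss)
    (h2 : Integrable (fun s => he n s • g' s) gauss)
    (h3 : Integrable (fun s => he n s • g s) gauss) :
    ∫ s, he (n + 1) s • g s ∂gauss = ∫ s, he n s • g' s ∂gauss := by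
  rw [integrable_gauss_iff] at h1 h2 h3
  simp only [smul_smul] at h1 h2 h3
  have key := integral_bilinear_hasDerivAt_right_eq_neg_left_of_integrable
    (L := ContinuousLinearMap.lsmul ℝ ℝ) (u := fun t => gaussianPDFReal 0 1 t * he n t)
    (u' := fun t => -(gaussianPDFReal 0 1 t * he (n + 1) t)) (v := g) (v' := g')
    (fun t _ => hasDerivAt_pdf_mul_he n t) (fun t _ => hg t) h2
    (by simpa using h1.neg) h3
  simp only [ContinuousLinearMap.lsmul_apply, neg_smul, integral_neg, neg_neg] at key
  rw [integral_gaussianReal_eq_integral_smul one_ne_zero,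
    integral_gaussianReal_eq_integral_smul one_ne_zero]
  simp only [smul_smul]
  exact key.symm

lemma integrable_abs_pow_mul_exp_gauss (n : ℕ) (k : ℝ) :
    Integrable (fun t : ℝ => |t| ^ n * Real.exp (k * |t|)) gauss := by
  have h := integrable_pow_abs_mul_exp_add_of_integrable_exp_mul (μ := gauss) (X := fun t => t)
    (v := 0) (t := |k| + 1) (x := |k|) (by simpa using integrable_exp_mul_gaussianReal _)
    (by simpa using integrable_exp_mul_gaussianReal _) (abs_nonneg k)
    (by rw [abs_of_pos (a := |k| + 1) (by positivity)]; linarith) n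
  refine h.mono' (by fun_prop) (ae_of_all _ fun t => ?_)
  rw [Real.norm_of_nonneg (by positivity)]
  gcongr
  rw [zero_mul, zero_add]
  gcongr
  exact le_abs_self k

lemma integrable_eval_gauss (p : Polynomial ℝ) : Integrable (fun t => p.eval t) gauss := by
  simp_rw [Polynomial.eval_eq_sum_range]
  refine integrable_finsetSum _ fun i _ => Integrable.const_mul ?_ _
  refine (integrable_abs_pow_mul_exp_gauss i 0).mono' (by fun_prop) (ae_of_all _ fun t => ?_)
  simp

/-- Integration by parts moves `n` derivatives onto `p`. Applied to Hermite polynomials, this gives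
both orthogonality and the norms. -/
lemma integral_he_mul_eval (n : ℕ) (p : Polynomial ℝ) :
    ∫ t, he n t * p.eval t ∂gauss = ∫ t, (Polynomial.derivative^[n] p).eval t ∂gauss := by
  induction n generalizing p with
  | zero => simp [he_zero]
  | succ n ih =>
    have hint : ∀ (m : ℕ) (q : Polynomial ℝ), Integrable (fun t => he m t • q.eval t) gauss := by
      intro m q
      simpa [he, Polynomial.eval_mul] using integrable_eval_gauss (hePoly m * q)
    rw [Function.iterate_succ_apply, ← ih]
    exact integral_he_succ_smul n (fun s => p.hasDerivAt s) (hint _ _) (hint _ _) (hint _ _)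

lemma integral_he_mul_he_of_lt {m n : ℕ} (h : m < n) : ∫ t, he n t * he m t ∂gauss = 0 := by
  have := integral_he_mul_eval n (hePoly m)
  rw [Polynomial.iterate_derivative_eq_zero (by rwa [natDegree_hePoly])] at this
  simpa [he] using this

lemma integral_he_mul_self (n : ℕ) : ∫ t, he n t * he n t ∂gauss = n.factorial := by
  have h1 := integral_he_mul_eval n (hePoly n)
  have h2 : Polynomial.derivative^[n] (hePoly n) = Polynomial.C (n.factorial : ℝ) := by
    ext m
    rw [Polynomial.coeff_iterate_derivative, Polynomial.coeff_C]
    split_ifs with hm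
    · have h3 := (hePoly_monic n).coeff_natDegree
      rw [natDegree_hePoly] at h3
      rw [hm, zero_add, h3, Nat.descFactorial_self]
      simp
    · rw [Polynomial.coeff_eq_zero_of_natDegree_lt, smul_zero]
      rw [natDegree_hePoly]
      omega
  rw [h2] at h1
  simpa [he] using h1

lemma integral_hermite1_mul (m n : ℕ) :
    ∫ t, hermite1 m t * hermite1 n t ∂gauss = if m = n then 1 else 0 := by
  have h : ∀ t, hermite1 m t * hermite1 n t = (Real.sqrt (m.factorial : ℝ))⁻¹ *
      (Real.sqrt (n.factorial : ℝ))⁻¹ * (he m t * he n t) := fun t => by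
    rw [hermite1_eq, hermite1_eq]; ring
  simp_rw [h, integral_const_mul]
  rcases lt_trichotomy m n with hmn | rfl | hmn
  · simp_rw [mul_comm (he m _), integral_he_mul_he_of_lt hmn, if_neg hmn.ne, mul_zero]
  · rw [integral_he_mul_self, if_pos rfl, ← mul_inv, Real.mul_self_sqrt (by positivity),
      inv_mul_cancel₀ (by positivity)]
  · rw [integral_he_mul_he_of_lt hmn, if_neg hmn.ne', mul_zero]

end UnivariateHermite

/-! ### The Gaussian product measure. -/

section ProductMeasure

instance : IsProbabilityMeasure γ := by
  rw [γ]; infer_instance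

lemma measurePreserving_eval_γ (j : ℕ) : MeasurePreserving (fun y : ℕ → ℝ => y j) γ gauss :=
  measurePreserving_eval_infinitePi (fun _ : ℕ => gauss) j

lemma integral_prod_γ (J : Finset ℕ) {F : ℕ → ℝ → ℝ} (hF : ∀ j, Integrable (F j) gauss) :
    Integrable (fun y : ℕ → ℝ => ∏ j ∈ J, F j (y j)) γ ∧
      ∫ y, ∏ j ∈ J, F j (y j) ∂γ = ∏ j ∈ J, ∫ t, F j t ∂gauss := by
  have hmap : Measure.map J.restrict γ = Measure.pi fun _ : J => gauss :=
    Measure.infinitePi_map_restrict (fun _ : ℕ => gauss)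
  have hmeas : Measurable (J.restrict : (ℕ → ℝ) → (J → ℝ)) := Finset.measurable_restrict J
  have hi : Integrable (fun z : J → ℝ => ∏ j : J, F j (z j)) (Measure.pi fun _ : J => gauss) :=
    Integrable.fintype_prod (f := fun j : J => F j) fun j => hF j
  have he : ∀ y : ℕ → ℝ, ∏ j ∈ J, F j (y j) = ∏ j : J, F j (J.restrict y j) := fun y =>
    (Finset.prod_coe_sort J fun j => F j (y j)).symm
  simp_rw [he]
  rw [← hmap] at hi
  refine ⟨(integrable_map_measure hi.1 hmeas.aemeasurable).1 hi, ?_⟩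
  rw [← integral_map (f := fun z : J → ℝ => ∏ j : J, F j (z j)) hmeas.aemeasurable hi.1, hmap,
    integral_fintype_prod_eq_prod (f := fun j : J => F j)]
  exact Finset.prod_coe_sort J fun j => ∫ t, F j t ∂gauss

/-- Resampling one coordinate independently does not change the law. With Fubini's theorem, this
reduces statements in the variable `y_j` to one-dimensional ones. -/
lemma measurePreserving_update (j : ℕ) :
    MeasurePreserving (fun p : (ℕ → ℝ) × ℝ => Function.update p.1 j p.2) (γ.prod gauss) γ := by
  have hm : Measurable fun p : (ℕ → ℝ) × ℝ => Function.update p.1 j p.2 := by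
    refine measurable_pi_lambda _ fun i => ?_
    by_cases h : i = j
    · subst h
      simpa using measurable_snd
    · simp only [Function.update_of_ne h]
      fun_prop
  refine ⟨hm, ?_⟩
  rw [γ]
  refine Measure.eq_infinitePi _ fun s t ht => ?_
  rw [Measure.map_apply hm (MeasurableSet.pi s.countable_toSet fun i _ => ht i)]
  by_cases hj : j ∈ s
  · have e : (fun p : (ℕ → ℝ) × ℝ => Function.update p.1 j p.2) ⁻¹' (Set.pi s t)
        = (Set.pi (s.erase j : Finset ℕ) t) ×ˢ t j := by
      ext ⟨y, r⟩
      simp only [Set.mem_preimage, Set.mem_pi, Set.mem_prod, Finset.mem_coe, Finset.mem_erase]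
      constructor
      · intro h
        refine ⟨fun i hi => ?_, ?_⟩
        · simpa [Function.update_of_ne hi.1] using h i hi.2
        · simpa using h j hj
      · rintro ⟨h1, h2⟩ i hi
        by_cases hij : i = j
        · subst hij; simpa using h2
        · rw [Function.update_of_ne hij]; exact h1 i ⟨hij, hi⟩
    rw [e, Measure.prod_prod, Measure.infinitePi_pi _ fun i _ => ht i,
      Finset.prod_erase_mul _ _ hj]
  · have e : (fun p : (ℕ → ℝ) × ℝ => Function.update p.1 j p.2) ⁻¹' (Set.pi s t)
        = (Set.pi s t) ×ˢ Set.univ := by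
      ext ⟨y, r⟩
      simp only [Set.mem_preimage, Set.mem_pi, Set.mem_prod, Finset.mem_coe, Set.mem_univ, and_true]
      refine forall₂_congr fun i hi => ?_
      rw [Function.update_of_ne (by rintro rfl; exact hj hi)]
    rw [e, Measure.prod_prod, Measure.infinitePi_pi _ fun i _ => ht i, measure_univ, mul_one]

end ProductMeasure

/-! ### Product Hermite polynomials and Gaussian integration by parts. -/

section MultivariateHermite

/-- The product Hermite polynomials that are not normalized. -/
def heM (ν : ℕ →₀ ℕ) (y : ℕ → ℝ) : ℝ := ν.prod fun j n => he n (y j)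

/-- The factorial `ν!` of a multi-index. -/
def mfact (ν : ℕ →₀ ℕ) : ℝ := ν.prod fun _ n => (n.factorial : ℝ)

lemma mfact_pos (ν : ℕ →₀ ℕ) : 0 < mfact ν :=
  Finset.prod_pos fun j _ => by positivity

lemma mfact_add_single (ν : ℕ →₀ ℕ) (j : ℕ) :
    mfact (ν + Finsupp.single j 1) = ((ν j : ℝ) + 1) * mfact ν := by
  have h1 : ν.support ⊆ insert j ν.support := Finset.subset_insert _ _
  have h2 : (ν + Finsupp.single j 1).support ⊆ insert j ν.support := by
    intro i hi
    rw [Finset.mem_insert]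
    by_contra! h
    simp [Finsupp.single_eq_of_ne h.1, Finsupp.notMem_support_iff.1 h.2] at hi
  rw [mfact, mfact, finsupp_prod_eq_prod h1 (by simp), finsupp_prod_eq_prod h2 (by simp),
    ← Finset.mul_prod_erase _ _ (Finset.mem_insert_self j _),
    ← Finset.mul_prod_erase (insert j ν.support) _ (Finset.mem_insert_self j _), ← mul_assoc]
  congr 1
  · simp [Nat.factorial_succ]
  · refine Finset.prod_congr rfl fun i hi => ?_
    simp [Finsupp.single_eq_of_ne (Finset.ne_of_mem_erase hi)]

lemma hermite_eq_heM (ν : ℕ →₀ ℕ) (y : ℕ → ℝ) : hermite ν y = heM ν y / Real.sqrt (mfact ν) := by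
  rw [hermite, heM, mfact, Finsupp.prod, Finsupp.prod, Real.sqrt_prod _ (fun _ _ => by positivity),
    ← Finset.prod_div_distrib]
  exact Finset.prod_congr rfl fun j _ => hermite1_eq _ _

lemma heM_eq (ν : ℕ →₀ ℕ) (y : ℕ → ℝ) : heM ν y = Real.sqrt (mfact ν) * hermite ν y := by
  rw [hermite_eq_heM, mul_div_cancel₀ _ (Real.sqrt_pos.2 (mfact_pos ν)).ne']

lemma hermite_eq_prod {ν : ℕ →₀ ℕ} {J : Finset ℕ} (h : ν.support ⊆ J) (y : ℕ → ℝ) :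
    hermite ν y = ∏ j ∈ J, hermite1 (ν j) (y j) :=
  Finset.prod_subset h fun j _ hj => by
    rw [Finsupp.notMem_support_iff.1 hj, hermite1_zero]

lemma continuous_hermite1 (n : ℕ) : Continuous (hermite1 n) := by
  have : hermite1 n = fun t => (hePoly n).eval t / Real.sqrt (n.factorial : ℝ) :=
    funext fun t => hermite1_eq n t
  rw [this]
  exact (hePoly n).continuous.div_const _

lemma continuous_hermite (ν : ℕ →₀ ℕ) : Continuous (hermite ν) :=
  continuous_finsetProd _ fun j _ => (continuous_hermite1 _).comp (continuous_apply j)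

lemma integrable_hermite1_mul (m n : ℕ) : Integrable (fun t => hermite1 m t * hermite1 n t) gauss := by
  have h : (fun t => hermite1 m t * hermite1 n t) = fun t => (Real.sqrt (m.factorial : ℝ))⁻¹ *
      (Real.sqrt (n.factorial : ℝ))⁻¹ * (hePoly m * hePoly n).eval t := funext fun t => by
    rw [hermite1_eq, hermite1_eq, Polynomial.eval_mul, he, he]; ring
  rw [h]
  exact (integrable_eval_gauss _).const_mul _

lemma integral_hermite_mul (ν μ : ℕ →₀ ℕ) : Integrable (fun y => hermite ν y * hermite μ y) γ ∧
    ∫ y, hermite ν y * hermite μ y ∂γ = if ν = μ then 1 else 0 := by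
  have e : ∀ y, hermite ν y * hermite μ y = ∏ j ∈ ν.support ∪ μ.support,
      (hermite1 (ν j) (y j) * hermite1 (μ j) (y j)) := fun y => by
    rw [hermite_eq_prod Finset.subset_union_left, hermite_eq_prod (ν := μ)
      Finset.subset_union_right, Finset.prod_mul_distrib]
  simp_rw [e]
  have h := integral_prod_γ (ν.support ∪ μ.support)
    (F := fun j t => hermite1 (ν j) t * hermite1 (μ j) t) fun j => integrable_hermite1_mul _ _
  refine ⟨h.1, h.2.trans ?_⟩
  simp_rw [integral_hermite1_mul]
  split_ifs with hνμ
  · subst hνμ; simp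
  · obtain ⟨j, hj⟩ := DFunLike.ne_iff.1 hνμ
    refine Finset.prod_eq_zero (i := j) ?_ (if_neg hj)
    rw [Finset.mem_union, Finsupp.mem_support_iff, Finsupp.mem_support_iff]
    by_contra! h
    exact hj (h.1.trans h.2.symm)

lemma memLp_hermite (ν : ℕ →₀ ℕ) : MemLp (hermite ν) 2 γ := by
  rw [memLp_two_iff_integrable_sq (continuous_hermite ν).aestronglyMeasurable]
  simpa [sq] using (integral_hermite_mul ν ν).1

variable {H : Type*} [NormedAddCommGroup H] [NormedSpace ℝ H]

lemma integrable_hermite_smul (ν : ℕ →₀ ℕ) {g : (ℕ → ℝ) → H} (hg : MemLp g 2 γ) :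
    Integrable (fun y => hermite ν y • g y) γ := by
  have h : MemLp (hermite ν • g) 1 γ := MemLp.smul (𝕜 := ℝ) (p := 2) (q := 2) hg (memLp_hermite ν)
  exact memLp_one_iff_integrable.1 h

lemma integrable_heM_smul (ν : ℕ →₀ ℕ) {g : (ℕ → ℝ) → H} (hg : MemLp g 2 γ) :
    Integrable (fun y => heM ν y • g y) γ := by
  simp_rw [heM_eq, mul_smul]
  exact Integrable.smul (Real.sqrt (mfact ν)) (integrable_hermite_smul ν hg)

lemma heM_update (ν : ℕ →₀ ℕ) (j : ℕ) (y : ℕ → ℝ) (s : ℝ) :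
    heM ν (Function.update y j s) = he (ν j) s * ∏ i ∈ ν.support.erase j, he (ν i) (y i) := by
  have h1 : ν.support ⊆ insert j ν.support := Finset.subset_insert _ _
  rw [heM, Finsupp.prod_of_support_subset ν h1 _ fun i _ => he_zero _,
    ← Finset.mul_prod_erase _ _ (Finset.mem_insert_self j _), Function.update_self,
    Finset.erase_insert_eq_erase]
  congr 1
  refine Finset.prod_congr rfl fun i hi => ?_
  rw [Function.update_of_ne (Finset.ne_of_mem_erase hi)]

lemma heM_add_single_update (ν : ℕ →₀ ℕ) (j : ℕ) (y : ℕ → ℝ) (s : ℝ) :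
    heM (ν + Finsupp.single j 1) (Function.update y j s)
      = he (ν j + 1) s * ∏ i ∈ ν.support.erase j, he (ν i) (y i) := by
  rw [heM_update]
  have e : (ν + Finsupp.single j 1 : ℕ →₀ ℕ) j = ν j + 1 := by simp
  rw [e]
  congr 1
  have e2 : (ν + Finsupp.single j 1).support.erase j = ν.support.erase j := by
    ext i
    simp only [Finset.mem_erase, Finsupp.mem_support_iff, Finsupp.add_apply]
    refine and_congr_right fun hi => ?_
    rw [Finsupp.single_eq_of_ne hi, add_zero]
  rw [e2]
  refine Finset.prod_congr rfl fun i hi => ?_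
  simp [Finsupp.single_eq_of_ne (Finset.ne_of_mem_erase hi)]

/-- Gaussian integration by parts in the variable `y_j`. -/
lemma integral_heM_add_single_smul (ν : ℕ →₀ ℕ) (j : ℕ) {g g' : (ℕ → ℝ) → H}
    (hg : MemLp g 2 γ) (hg' : MemLp g' 2 γ)
    (hd : ∀ᵐ y ∂γ, ∀ s : ℝ, HasDerivAt (fun s => g (Function.update y j s))
      (g' (Function.update y j s)) s) :
    ∫ y, heM (ν + Finsupp.single j 1) y • g y ∂γ = ∫ y, heM ν y • g' y ∂γ := by
  have hmp := measurePreserving_update j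
  have fub : ∀ F : (ℕ → ℝ) → H, Integrable F γ →
      (∀ᵐ y ∂γ, Integrable (fun s => F (Function.update y j s)) gauss) ∧
      ∫ y, F y ∂γ = ∫ y, ∫ s, F (Function.update y j s) ∂gauss ∂γ := by
    intro F hF
    have h1 : Integrable (fun p : (ℕ → ℝ) × ℝ => F (Function.update p.1 j p.2)) (γ.prod gauss) := by
      rw [← hmp.map_eq] at hF
      exact (integrable_map_measure hF.1 hmp.measurable.aemeasurable).1 hF
    refine ⟨h1.prod_right_ae, ?_⟩
    rw [← integral_prod _ h1]
    conv_lhs => rw [← hmp.map_eq]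
    rw [integral_map hmp.measurable.aemeasurable (by rw [hmp.map_eq]; exact hF.1)]
  obtain ⟨a1, b1⟩ := fub _ (integrable_heM_smul (ν + Finsupp.single j 1) hg)
  obtain ⟨a2, b2⟩ := fub _ (integrable_heM_smul ν hg')
  obtain ⟨a3, -⟩ := fub _ (integrable_heM_smul ν hg)
  rw [b1, b2]
  refine integral_congr_ae ?_
  filter_upwards [a1, a2, a3, hd] with y i1 i2 i3 hy
  simp only [heM_add_single_update, mul_smul] at i1 ⊢
  simp only [heM_update, mul_smul] at i2 i3 ⊢
  exact integral_he_succ_smul (ν j) (fun s => (hy s).const_smul _) i1 i2 i3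

/-- Hermite coefficients of a function in terms of those of its partial derivatives. -/
lemma integral_heM_add_smul {g : (ℕ →₀ ℕ) → (ℕ → ℝ) → H} (hg : ∀ μ, MemLp (g μ) 2 γ)
    (hd : ∀ μ j, ∀ᵐ y ∂γ, ∀ s : ℝ, HasDerivAt (fun s => g μ (Function.update y j s))
      (((μ j : ℝ) + 1) • g (μ + Finsupp.single j 1) (Function.update y j s)) s)
    (κ μ : ℕ →₀ ℕ) :
    ∫ y, heM (κ + μ) y • g 0 y ∂γ = mfact μ • ∫ y, heM κ y • g μ y ∂γ := by
  -- Write `μ = τ + e_j`. The induction hypothesis at `(κ + e_j, τ)` reaches `g τ`, and one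
  -- integration by parts in `y_j` removes `e_j` from the Hermite index, giving the factor `τ_j +
  -- 1`.
  induction hn : μ.degree generalizing κ μ with
  | zero =>
    rw [Finsupp.degree_eq_zero_iff] at hn
    subst hn
    simp [mfact]
  | succ n ih =>
    have hμ : μ ≠ 0 := by rintro rfl; simp at hn
    obtain ⟨j, hj⟩ := DFunLike.ne_iff.1 hμ
    have hle : Finsupp.single j 1 ≤ μ := by
      rw [Finsupp.single_le_iff]
      have : μ j ≠ 0 := hj
      omega
    obtain ⟨τ, rfl⟩ : ∃ τ, μ = τ + Finsupp.single j 1 :=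
      ⟨μ - Finsupp.single j 1, (tsub_add_cancel_of_le hle).symm⟩
    have hdeg : τ.degree = n := by
      rw [map_add, Finsupp.degree_single] at hn
      omega
    have h1 := ih (κ + Finsupp.single j 1) τ hdeg
    rw [add_right_comm, add_assoc] at h1
    rw [h1, integral_heM_add_single_smul κ j (hg τ) ((hg _).const_smul ((τ j : ℝ) + 1)) (hd τ j),
      mfact_add_single]
    have e : ∀ y, heM κ y • (((τ j : ℝ) + 1) • g (τ + Finsupp.single j 1)) y
        = ((τ j : ℝ) + 1) • heM κ y • g (τ + Finsupp.single j 1) y := fun y => by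
      rw [Pi.smul_apply, smul_comm]
    simp_rw [e]
    rw [integral_smul, smul_smul, mul_comm]

end MultivariateHermite

/-! ### Bessel and Parseval for orthogonal families of subspaces. -/

section OrthogonalExpansion

variable {ι H L : Type*} [NormedAddCommGroup H] [InnerProductSpace ℝ H]
  [NormedAddCommGroup L] [InnerProductSpace ℝ L] {T : ι → H →ₗᵢ[ℝ] L}

lemma norm_sub_sum_sq_of_orthogonalFamily (hT : OrthogonalFamily ℝ (fun _ => H) T) {G : L}
    {c : ι → H} (hc : ∀ i x, inner ℝ (T i x) G = inner ℝ x (c i)) (S : Finset ι) :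
    ‖G - ∑ i ∈ S, T i (c i)‖ ^ 2 = ‖G‖ ^ 2 - ∑ i ∈ S, ‖c i‖ ^ 2 := by
  rw [norm_sub_sq_real, hT.norm_sum, real_inner_comm, sum_inner]
  simp_rw [hc, real_inner_self_eq_norm_sq]
  ring

lemma sum_norm_sq_le_of_orthogonalFamily (hT : OrthogonalFamily ℝ (fun _ => H) T) {G : L}
    {c : ι → H} (hc : ∀ i x, inner ℝ (T i x) G = inner ℝ x (c i)) (S : Finset ι) :
    ∑ i ∈ S, ‖c i‖ ^ 2 ≤ ‖G‖ ^ 2 := by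
  have := norm_sub_sum_sq_of_orthogonalFamily hT hc S
  nlinarith [sq_nonneg ‖G - ∑ i ∈ S, T i (c i)‖]

lemma hasSum_norm_sq_of_orthogonalFamily [CompleteSpace L]
    (hT : OrthogonalFamily ℝ (fun _ => H) T)
    (htot : ∀ R : L, (∀ i x, inner ℝ (T i x) R = 0) → R = 0) {G : L}
    {c : ι → H} (hc : ∀ i x, inner ℝ (T i x) G = inner ℝ x (c i)) :
    HasSum (fun i => ‖c i‖ ^ 2) (‖G‖ ^ 2) := by
  classical
  have hs : Summable fun i => ‖c i‖ ^ 2 :=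
    summable_of_sum_le (fun _ => by positivity) (sum_norm_sq_le_of_orthogonalFamily hT hc)
  have hS := ((hT.summable_iff_norm_sq_summable c).2 hs).hasSum
  set R := ∑' i, T i (c i) with hR
  -- The remainder is orthogonal to every subspace of the family, so totality kills it.
  have h0 : G - R = 0 := by
    refine htot _ fun i x => ?_
    have h1 : HasSum (fun j => inner ℝ (T i x) (T j (c j))) (inner ℝ (T i x) R) :=
      hS.mapL (innerSL ℝ (T i x))
    have h2 : HasSum (fun j => inner ℝ (T i x) (T j (c j))) (inner ℝ (T i x) (T i (c i))) :=
      hasSum_single i fun j hj => hT hj.symm x (c j)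
    rw [inner_sub_right, hc, h1.unique h2, LinearIsometry.inner_map_map, sub_self]
  have h3 : Tendsto (fun S : Finset ι => ‖G - ∑ i ∈ S, T i (c i)‖ ^ 2) atTop
      (𝓝 (‖G - R‖ ^ 2)) := ((tendsto_const_nhds.sub hS).norm).pow 2
  simp_rw [norm_sub_sum_sq_of_orthogonalFamily hT hc, h0] at h3
  have h4 := h3.const_sub (‖G‖ ^ 2)
  simpa using! h4

end OrthogonalExpansion

/-! ### Completeness of the Hermite polynomials. -/

section Completeness

lemma derivative_hePoly (n : ℕ) :
    Polynomial.derivative (hePoly (n + 1)) = ((n + 1 : ℕ) : Polynomial ℝ) * hePoly n := by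
  induction n with
  | zero => simp [hePoly_succ, hePoly_zero]
  | succ n ih =>
    rw [hePoly_succ (n + 1), Polynomial.derivative_sub, Polynomial.derivative_mul, ih,
      Polynomial.derivative_mul, Polynomial.derivative_X, Polynomial.derivative_natCast,
      hePoly_succ n]
    push_cast
    ring

/-- The three-term recurrence. At `n = 0` the truncated index `n - 1` carries the coefficient 0. -/
lemma mul_he (n : ℕ) (t : ℝ) : t * he n t = he (n + 1) t + n * he (n - 1) t := by
  cases n with
  | zero => simp [he, hePoly_succ, hePoly_zero]
  | succ n =>
    simp only [he, hePoly_succ (n + 1), Polynomial.eval_sub, Polynomial.eval_mul,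
      Polynomial.eval_X, derivative_hePoly, Polynomial.eval_natCast, Nat.add_sub_cancel]
    push_cast
    ring

lemma heM_eq_mul_erase (ν : ℕ →₀ ℕ) (j : ℕ) (y : ℕ → ℝ) :
    heM ν y = he (ν j) (y j) * heM (ν.erase j) y :=
  (Finsupp.mul_prod_erase' ν j (fun i n => he n (y i)) fun _ => he_zero _).symm

lemma heM_erase_add_single (ν : ℕ →₀ ℕ) (j n : ℕ) (y : ℕ → ℝ) :
    heM (ν.erase j + Finsupp.single j n) y = he n (y j) * heM (ν.erase j) y := by
  rw [heM_eq_mul_erase _ j, Finsupp.erase_add, Finsupp.erase_single, add_zero, Finsupp.erase_idem]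
  simp

lemma eval_mul_heM (ν : ℕ →₀ ℕ) (j : ℕ) (y : ℕ → ℝ) :
    y j * heM ν y = heM (ν.erase j + Finsupp.single j (ν j + 1)) y +
      ν j * heM (ν.erase j + Finsupp.single j (ν j - 1)) y := by
  rw [heM_erase_add_single, heM_erase_add_single, heM_eq_mul_erase ν j, ← mul_assoc, mul_he]
  ring

/-- The span of the Hermite polynomials. -/
def hermiteSpan : Submodule ℝ ((ℕ → ℝ) → ℝ) := Submodule.span ℝ (Set.range heM)

lemma eval_mul_mem_hermiteSpan (j : ℕ) {w : (ℕ → ℝ) → ℝ} (hw : w ∈ hermiteSpan) :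
    (fun y => y j * w y) ∈ hermiteSpan := by
  induction hw using Submodule.span_induction with
  | mem w hw =>
    obtain ⟨ν, rfl⟩ := hw
    have e : (fun y : ℕ → ℝ => y j * heM ν y) = heM (ν.erase j + Finsupp.single j (ν j + 1)) +
        (ν j : ℝ) • heM (ν.erase j + Finsupp.single j (ν j - 1)) := by
      funext y
      exact eval_mul_heM ν j y
    rw [e]
    exact add_mem (Submodule.subset_span ⟨_, rfl⟩)
      (Submodule.smul_mem _ _ (Submodule.subset_span ⟨_, rfl⟩))
  | zero =>
    convert! hermiteSpan.zero_mem using 1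
    funext y
    simp
  | add v w _ _ hv hw =>
    convert! add_mem hv hw using 1
    funext y
    simp [mul_add]
  | smul a w _ hw =>
    convert! Submodule.smul_mem _ a hw using 1
    funext y
    simp [mul_left_comm]

/-- Powers of linear forms are the only polynomials needed to expand characteristic functions. -/
lemma pow_mem_hermiteSpan (J : Finset ℕ) (t : ℕ → ℝ) (k : ℕ) :
    (fun y : ℕ → ℝ => (∑ j ∈ J, t j * y j) ^ k) ∈ hermiteSpan := by
  induction k with
  | zero =>
    refine Submodule.subset_span ⟨0, ?_⟩
    funext y
    simp [heM]
  | succ k ih =>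
    have e : (fun y : ℕ → ℝ => (∑ j ∈ J, t j * y j) ^ (k + 1)) =
        ∑ j ∈ J, t j • fun y : ℕ → ℝ => y j * (∑ j ∈ J, t j * y j) ^ k := by
      funext y
      simp only [Finset.sum_apply, Pi.smul_apply, smul_eq_mul]
      rw [pow_succ', Finset.sum_mul]
      exact Finset.sum_congr rfl fun j _ => by ring
    rw [e]
    exact Submodule.sum_mem _ fun j _ => Submodule.smul_mem _ _ (eval_mul_mem_hermiteSpan j ih)

variable {φ : (ℕ → ℝ) → ℝ}

lemma integral_hermiteSpan_mul (hφ : MemLp φ 2 γ) (h0 : ∀ ν, ∫ y, hermite ν y * φ y ∂γ = 0)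
    {w : (ℕ → ℝ) → ℝ} (hw : w ∈ hermiteSpan) :
    Integrable (fun y => w y * φ y) γ ∧ ∫ y, w y * φ y ∂γ = 0 := by
  induction hw using Submodule.span_induction with
  | mem w hw =>
    obtain ⟨ν, rfl⟩ := hw
    refine ⟨integrable_heM_smul ν hφ, ?_⟩
    simp_rw [heM_eq, mul_assoc, integral_const_mul, h0, mul_zero]
  | zero => simp
  | add v w _ _ hv hw =>
    simp only [Pi.add_apply, add_mul]
    exact ⟨hv.1.add hw.1, by rw [integral_add hv.1 hw.1, hv.2, hw.2, add_zero]⟩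
  | smul a w _ hw =>
    simp only [Pi.smul_apply, smul_eq_mul, mul_assoc]
    exact ⟨hw.1.const_mul a, by rw [integral_const_mul, hw.2, mul_zero]⟩

lemma memLp_exp_abs_sum (J : Finset ℕ) (t : ℕ → ℝ) :
    MemLp (fun y : ℕ → ℝ => Real.exp |∑ j ∈ J, t j * y j|) 2 γ := by
  have hc : Continuous fun y : ℕ → ℝ => Real.exp |∑ j ∈ J, t j * y j| := by fun_prop
  rw [memLp_two_iff_integrable_sq hc.aestronglyMeasurable]
  refine ((integral_prod_γ J (F := fun j s => |s| ^ 0 * Real.exp ((2 * |t j|) * |s|)) fun j =>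
    integrable_abs_pow_mul_exp_gauss 0 _).1).mono' (hc.pow 2).aestronglyMeasurable
      (ae_of_all _ fun y => ?_)
  rw [Real.norm_of_nonneg (by positivity), ← Real.exp_nat_mul]
  simp only [pow_zero, one_mul]
  rw [← Real.exp_sum]
  refine Real.exp_le_exp.2 ?_
  push_cast
  calc (2 : ℝ) * |∑ j ∈ J, t j * y j| ≤ 2 * ∑ j ∈ J, |t j * y j| := by
        gcongr; exact Finset.abs_sum_le_sum_abs _ _
    _ = _ := by
        rw [Finset.mul_sum]
        exact Finset.sum_congr rfl fun j _ => by rw [abs_mul]; ring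

/-- Expand the exponential in powers of the linear form: every term integrates to zero against `φ`.
The partial sums are dominated by `|φ| e^{|l|}`, a product of two square integrable functions. -/
lemma integral_char_mul_eq_zero (hφ : MemLp φ 2 γ) (h0 : ∀ ν, ∫ y, hermite ν y * φ y ∂γ = 0)
    (J : Finset ℕ) (t : ℕ → ℝ) :
    ∫ y, φ y • Complex.exp ((∑ j ∈ J, t j * y j : ℝ) * Complex.I) ∂γ = 0 := by
  set l : (ℕ → ℝ) → ℝ := fun y => ∑ j ∈ J, t j * y j with hl
  have hlc : Continuous l := by fun_prop
  have key := hasSum_integral_of_dominated_convergence (μ := γ)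
    (F := fun (k : ℕ) y => φ y • (((l y : ℂ) * Complex.I) ^ k / (k.factorial : ℂ)))
    (f := fun y => φ y • Complex.exp ((l y : ℂ) * Complex.I))
    (fun k y => |φ y| * (|l y| ^ k / (k.factorial : ℝ)))
    (fun k => hφ.1.smul (Continuous.aestronglyMeasurable (by fun_prop)))
    (fun k => ae_of_all _ fun y => by simp)
    (ae_of_all _ fun y => (NormedSpace.expSeries_div_summable (𝔸 := ℝ) |l y|).mul_left _)
    (by
      have e : ∀ y, ∑' k : ℕ, |φ y| * (|l y| ^ k / (k.factorial : ℝ))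
          = Real.exp |l y| * |φ y| := fun y => by
        rw [tsum_mul_left, Real.exp_eq_exp_ℝ, NormedSpace.exp_eq_tsum_div, mul_comm]
      simp_rw [e]
      exact (memLp_exp_abs_sum J t).integrable_mul hφ.abs)
    (ae_of_all _ fun y => by
      rw [Complex.exp_eq_exp_ℂ]
      exact (NormedSpace.expSeries_div_hasSum_exp (𝔸 := ℂ) _).const_smul (φ y))
  have hz : ∀ k : ℕ, ∫ y, φ y • (((l y : ℂ) * Complex.I) ^ k / (k.factorial : ℂ)) ∂γ = 0 := by
    intro k
    have e : ∀ y, φ y • (((l y : ℂ) * Complex.I) ^ k / (k.factorial : ℂ))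
        = (Complex.I ^ k / (k.factorial : ℂ)) * ((l y ^ k * φ y : ℝ) : ℂ) := fun y => by
      rw [Complex.real_smul, mul_pow]
      push_cast
      ring
    simp_rw [e]
    rw [integral_const_mul, integral_complex_ofReal,
      (integral_hermiteSpan_mul hφ h0 (pow_mem_hermiteSpan J t k)).2]
    simp
  simp_rw [hz] at key
  exact key.unique hasSum_zero

/-- The Hermite polynomials are complete in `L²` of the Gaussian product measure. -/
theorem ae_eq_zero_of_integral_hermite_mul (hφ : MemLp φ 2 γ)
    (h0 : ∀ ν, ∫ y, hermite ν y * φ y ∂γ = 0) : φ =ᵐ[γ] 0 := by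
  have hi : Integrable φ γ := hφ.integrable one_le_two
  have hm : ∀ χ : (ℕ → ℝ) → ℝ, AEStronglyMeasurable χ γ →
      AEMeasurable (fun y => ENNReal.ofReal (χ y)) γ := fun χ h => h.aemeasurable.ennreal_ofReal
  have hfin : ∀ χ : (ℕ → ℝ) → ℝ, Integrable χ γ →
      IsFiniteMeasure (γ.withDensity fun y => ENNReal.ofReal (χ y)) :=
    fun χ h => isFiniteMeasure_withDensity_ofReal h.2
  have hneg : Integrable (fun y => -φ y) γ := hi.neg
  have := hfin φ hi
  have := hfin _ hneg
  -- The finite measures `φ⁺ γ` and `φ⁻ γ` have the same characteristic functions on each finite set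
  -- of coordinates, hence the same finite-dimensional marginals. These determine them, so `φ⁺ = φ⁻`
  -- almost everywhere.
  have hlim : ∀ J : Finset ℕ,
      (γ.withDensity fun y => ENNReal.ofReal (φ y)).map J.restrict
        = (γ.withDensity fun y => ENNReal.ofReal (-φ y)).map J.restrict := by
    intro J
    refine Measure.ext_of_charFunDual ?_
    funext L
    have hmeas : Measurable (J.restrict : (ℕ → ℝ) → (J → ℝ)) := Finset.measurable_restrict J
    have hcont : Continuous fun z : J → ℝ => Complex.exp ((L z : ℂ) * Complex.I) := by fun_prop
    rw [charFunDual_apply, charFunDual_apply,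
      integral_map hmeas.aemeasurable hcont.aestronglyMeasurable,
      integral_map hmeas.aemeasurable hcont.aestronglyMeasurable,
      integral_withDensity_eq_integral_toReal_smul₀ (hm _ hi.1) (ae_of_all _ fun _ => by simp),
      integral_withDensity_eq_integral_toReal_smul₀ (hm _ hneg.1) (ae_of_all _ fun _ => by simp),
      ← sub_eq_zero]
    have hb : ∀ χ : (ℕ → ℝ) → ℝ, Integrable χ γ → Integrable (fun y => (ENNReal.ofReal (χ y)).toReal •
        Complex.exp ((L (J.restrict y) : ℂ) * Complex.I)) γ := by
      intro χ hχ
      refine hχ.norm.mono' ((hm _ hχ.1).ennreal_toReal.aestronglyMeasurable.smul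
        (hcont.measurable.comp hmeas).aestronglyMeasurable) (ae_of_all _ fun y => ?_)
      rw [norm_smul, Complex.norm_exp_ofReal_mul_I, mul_one, ENNReal.toReal_ofReal',
        Real.norm_of_nonneg (le_max_right _ _)]
      exact max_le (le_abs_self _) (abs_nonneg _)
    rw [← integral_sub (hb _ hi) (hb _ hneg)]
    classical
    let t : ℕ → ℝ := fun j => if h : j ∈ J then L (Pi.single ⟨j, h⟩ 1) else 0
    have hL : ∀ y : ℕ → ℝ, L (J.restrict y) = ∑ j ∈ J, t j * y j := by
      intro y
      refine (LinearMap.pi_apply_eq_sum_univ L.toLinearMap (J.restrict y)).trans ?_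
      rw [← Finset.sum_coe_sort J fun j => t j * y j]
      refine Finset.sum_congr rfl fun j _ => ?_
      simp only [t, j.2, dif_pos, Finset.restrict, smul_eq_mul]
      rw [mul_comm]
      refine congrArg (fun z => L z * y j) ?_
      funext i
      simp [Pi.single_apply, eq_comm]
    rw [← integral_char_mul_eq_zero hφ h0 J t]
    refine integral_congr_ae (ae_of_all _ fun y => ?_)
    simp only [hL]
    rw [← sub_smul, ENNReal.toReal_ofReal', ENNReal.toReal_ofReal', max_zero_sub_eq_self]
  have heq := IsProjectiveLimit.unique
    (P := fun J => (γ.withDensity fun y => ENNReal.ofReal (-φ y)).map J.restrict)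
    hlim (fun J => rfl)
  rw [withDensity_eq_iff_of_sigmaFinite (hm _ hi.1) (hm _ hneg.1)] at heq
  filter_upwards [heq] with y hy
  change φ y = (0 : ℝ)
  rcases le_total 0 (φ y) with h | h
  · rw [ENNReal.ofReal_of_nonpos (p := -φ y) (by linarith), ENNReal.ofReal_eq_zero] at hy
    exact le_antisymm hy h
  · rw [ENNReal.ofReal_of_nonpos h, eq_comm, ENNReal.ofReal_eq_zero] at hy
    exact le_antisymm h (by linarith)

end Completeness

/-! ### Hermite expansions of Hilbert space valued functions. -/

section VectorValued

variable {H : Type*} [NormedAddCommGroup H] [InnerProductSpace ℝ H]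

lemma memLp_hermite_smul_const (ν : ℕ →₀ ℕ) (x : H) : MemLp (fun y => hermite ν y • x) 2 γ := by
  refine ((memLp_hermite ν).norm.mul_const ‖x‖).of_le
    ((continuous_hermite ν).smul continuous_const).aestronglyMeasurable (ae_of_all _ fun y => ?_)
  simp [norm_smul]

lemma norm_toLp_sq {g : (ℕ → ℝ) → H} (hg : MemLp g 2 γ) : ‖hg.toLp g‖ ^ 2 = ∫ y, ‖g y‖ ^ 2 ∂γ := by
  rw [← real_inner_self_eq_norm_sq, L2.inner_def]
  refine integral_congr_ae ?_
  filter_upwards [hg.coeFn_toLp] with y hy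
  rw [hy, real_inner_self_eq_norm_sq]

lemma integral_hermite_smul_inner (ν μ : ℕ →₀ ℕ) (x z : H) :
    ∫ y, inner ℝ (hermite ν y • x) (hermite μ y • z) ∂γ = if ν = μ then inner ℝ x z else 0 := by
  have e : ∀ y, inner ℝ (hermite ν y • x) (hermite μ y • z)
      = (hermite ν y * hermite μ y) * inner ℝ x z := fun y => by
    rw [real_inner_smul_left, real_inner_smul_right, mul_assoc]
  simp_rw [e, integral_mul_const, (integral_hermite_mul ν μ).2]
  split_ifs <;> simp

/-- The isometric embedding `x ↦ H_ν x` into the square integrable functions. -/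
def hermiteEmbedding (ν : ℕ →₀ ℕ) : H →ₗᵢ[ℝ] Lp H 2 γ where
  toFun x := (memLp_hermite_smul_const ν x).toLp _
  map_add' x z := by
    rw [← MemLp.toLp_add]
    simp only [smul_add]
    rfl
  map_smul' a x := by
    rw [RingHom.id_apply, ← MemLp.toLp_const_smul]
    simp only [smul_comm _ a x]
    rfl
  norm_map' x := by
    rw [← sq_eq_sq₀ (norm_nonneg _) (norm_nonneg _)]
    refine (norm_toLp_sq (memLp_hermite_smul_const ν x)).trans ?_
    simp_rw [← real_inner_self_eq_norm_sq]
    rw [integral_hermite_smul_inner, if_pos rfl]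

lemma inner_hermiteEmbedding [CompleteSpace H] (ν : ℕ →₀ ℕ) (x : H) {g : (ℕ → ℝ) → H}
    (hg : MemLp g 2 γ) :
    inner ℝ (hermiteEmbedding ν x) (hg.toLp g) = inner ℝ x (∫ y, hermite ν y • g y ∂γ) := by
  rw [L2.inner_def, ← integral_inner (integrable_hermite_smul ν hg)]
  refine integral_congr_ae ?_
  filter_upwards [hg.coeFn_toLp, (memLp_hermite_smul_const ν x).coeFn_toLp] with y h1 h2
  change inner ℝ ((memLp_hermite_smul_const ν x).toLp _ y) _ = _
  rw [h1, h2, real_inner_smul_left, real_inner_smul_right]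

lemma orthogonalFamily_hermiteEmbedding :
    OrthogonalFamily ℝ (fun _ : ℕ →₀ ℕ => H) hermiteEmbedding := by
  intro ν μ h x z
  rw [L2.inner_def, ← if_neg (α := ℝ) (t := inner ℝ x z) (e := 0) h,
    ← integral_hermite_smul_inner ν μ x z]
  refine integral_congr_ae ?_
  filter_upwards [(memLp_hermite_smul_const μ z).coeFn_toLp,
    (memLp_hermite_smul_const ν x).coeFn_toLp] with y h1 h2
  change inner ℝ ((memLp_hermite_smul_const ν x).toLp _ y)
    ((memLp_hermite_smul_const μ z).toLp _ y) = _
  rw [h1, h2]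

variable [CompleteSpace H]

/-- Each functional `c ∘ R` has vanishing Hermite coefficients, so it is zero almost everywhere. The
exceptional null set depends on `c`; essential separability of the range of `R` removes this
dependence. -/
lemma eq_zero_of_inner_hermiteEmbedding (R : Lp H 2 γ)
    (h : ∀ ν x, inner ℝ (hermiteEmbedding ν x) R = 0) : R = 0 := by
  have hR := Lp.memLp R
  have hc : ∀ ν, ∫ y, hermite ν y • R y ∂γ = 0 := by
    intro ν
    have := h ν (∫ y, hermite ν y • R y ∂γ)
    rw [← Lp.toLp_coeFn R hR, inner_hermiteEmbedding] at this
    simpa using this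
  obtain ⟨t, ht, hRt⟩ := hR.1.isSeparable_ae_range
  have h0 : R =ᵐ[γ] 0 := by
    refine ae_eq_zero_of_forall_dual_of_isSeparable ℝ ht (fun c => ?_) hRt
    refine ae_eq_zero_of_integral_hermite_mul (c.comp_memLp' hR) fun ν => ?_
    have e : ∀ y, hermite ν y * c (R y) = c (hermite ν y • R y) := fun y => by simp
    change ∫ y, hermite ν y * c (R y) ∂γ = 0
    simp_rw [e]
    rw [c.integral_comp_comm (integrable_hermite_smul ν hR), hc, map_zero]
  exact (Lp.eq_zero_iff_ae_eq_zero).2 h0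

lemma sum_norm_integral_hermite_smul_sq_le {g : (ℕ → ℝ) → H} (hg : MemLp g 2 γ)
    (S : Finset (ℕ →₀ ℕ)) :
    ∑ ν ∈ S, ‖∫ y, hermite ν y • g y ∂γ‖ ^ 2 ≤ ∫ y, ‖g y‖ ^ 2 ∂γ := by
  rw [← norm_toLp_sq hg]
  exact sum_norm_sq_le_of_orthogonalFamily orthogonalFamily_hermiteEmbedding
    (fun ν x => inner_hermiteEmbedding ν x hg) S

/-- Parseval's identity for the remainder of a Hermite expansion. -/
theorem hasSum_norm_integral_hermite_smul_sq {g : (ℕ → ℝ) → H} (hg : MemLp g 2 γ)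
    (S : Finset (ℕ →₀ ℕ)) :
    HasSum (fun ν : {ν // ν ∉ S} => ‖∫ y, hermite (ν : ℕ →₀ ℕ) y • g y ∂γ‖ ^ 2)
      (∫ y, ‖g y - ∑ ν ∈ S, hermite ν y • ∫ z, hermite ν z • g z ∂γ‖ ^ 2 ∂γ) := by
  set c : (ℕ →₀ ℕ) → H := fun ν => ∫ y, hermite ν y • g y ∂γ with hcdef
  have hc : ∀ ν x, inner ℝ (hermiteEmbedding ν x) (hg.toLp g) = inner ℝ x (c ν) :=
    fun ν x => inner_hermiteEmbedding ν x hg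
  have h1 := hasSum_norm_sq_of_orthogonalFamily orthogonalFamily_hermiteEmbedding
    eq_zero_of_inner_hermiteEmbedding hc
  have h2 := norm_sub_sum_sq_of_orthogonalFamily orthogonalFamily_hermiteEmbedding hc S
  have h3 : MemLp (fun y => g y - ∑ ν ∈ S, hermite ν y • c ν) 2 γ :=
    hg.sub (memLp_finsetSum S fun ν _ => memLp_hermite_smul_const ν (c ν))
  have h4 : h3.toLp _ = hg.toLp g - ∑ ν ∈ S, hermiteEmbedding ν (c ν) := by
    rw [Lp.ext_iff]
    have h5 : ∀ ν ∈ S, ∀ᵐ y ∂γ, (hermiteEmbedding ν (c ν) : Lp H 2 γ) y = hermite ν y • c ν :=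
      fun ν _ => (memLp_hermite_smul_const ν (c ν)).coeFn_toLp
    filter_upwards [h3.coeFn_toLp, hg.coeFn_toLp, Lp.coeFn_sub (hg.toLp g)
      (∑ ν ∈ S, hermiteEmbedding ν (c ν)), Lp.coeFn_finsetSum S fun ν => hermiteEmbedding ν (c ν),
      (Finset.eventually_all S).2 h5] with y e1 e2 e3 e4 e5
    rw [e1, e3, Pi.sub_apply, e2, e4, Finset.sum_apply]
    congr 1
    exact Finset.sum_congr rfl fun ν hν => (e5 ν hν).symm
  have h6 := norm_toLp_sq h3
  rw [h4, h2] at h6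
  rw [← h6]
  refine (Finset.hasSum_compl_iff (f := fun ν => ‖c ν‖ ^ 2) S).2 ?_
  rw [sub_add_cancel]
  exact h1

end VectorValued

/-! ### Construction of the weights from the wavelet structure. -/

section Weights

variable {d : ℕ} {D : Set (E d)}

lemma sum_le_card_mul_of_encard_le {J : Finset ℕ} {a : ℕ → ℝ} {M : ℕ} {B : ℝ} (hB : 0 ≤ B)
    (ha : ∀ j ∈ J, a j ≤ B) (hM : {j | j ∈ J ∧ a j ≠ 0}.encard ≤ M) :
    ∑ j ∈ J, a j ≤ M * B := by
  classical
  have e : {j | j ∈ J ∧ a j ≠ 0} = ((J.filter fun j => a j ≠ 0 : Finset ℕ) : Set ℕ) := by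
    ext j; simp
  rw [e, Set.encard_coe_eq_coe_finsetCard, Nat.cast_le] at hM
  rw [← Finset.sum_filter_ne_zero]
  refine (Finset.sum_le_card_nsmul _ _ B fun j hj => ha j (Finset.mem_filter.1 hj).1).trans ?_
  rw [nsmul_eq_mul]
  gcongr

/-- Weights for a family of wavelet type. -/
lemma exists_weights {ψ : ℕ → LInfty D} {level : ℕ → ℕ} {M : ℕ} {C α : ℝ}
    (h : IsWaveletType ψ level M C α) {q q' : ℝ} (hq : 0 < q) (hqq : q < q')
    (hsum : Summable fun j => ‖ψ j‖ ^ q) {K : ℝ} (hK : 0 < K) :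
    ∃ (ρ : ℕ → ℝ) (c : ℝ), 0 < c ∧ (∀ j, c ≤ ρ j) ∧
      (∀ᵐ x ∂(volume : Measure (E d)).restrict D, ∀ J : Finset ℕ,
        ∑ j ∈ J, ρ j * |ψ j x| ≤ K) ∧ Summable fun j => ρ j ^ (-q') := by
  have hC := h.C_pos
  have hα := h.α_pos
  have hq' : 0 < q' := hq.trans hqq
  -- The choice `β q' = α q` makes `ρ_j^{-q'}` proportional to `‖ψ_j‖^q`. As `q < q'`, also `β < α`,
  -- so `ρ_j |ψ_j|` decays geometrically in the level.
  set β : ℝ := α * q / q' with hβ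
  have hβ0 : 0 < β := by positivity
  have hβα : β < α := by
    rw [hβ, div_lt_iff₀ hq']
    exact mul_lt_mul_of_pos_left hqq hα
  set r : ℝ := (2 : ℝ) ^ (β - α) with hr
  have hr0 : 0 < r := by positivity
  have hr1 : r < 1 := Real.rpow_lt_one_of_one_lt_of_neg one_lt_two (by linarith)
  -- The geometric series over the levels then sums to at most `K M / (M + 1)`; the `M + 1` also
  -- covers `M = 0`.
  set c : ℝ := K * (1 - r) / ((M + 1) * C) with hc
  have hc0 : 0 < c := by
    have : 0 < 1 - r := by linarith
    positivity
  refine ⟨fun j => c * (2 : ℝ) ^ (β * level j), c, hc0, fun j => ?_, ?_, ?_⟩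
  · exact le_mul_of_one_le_right hc0.le
      (Real.one_le_rpow one_le_two (by positivity))
  · have h1 : ∀ᵐ x ∂(volume : Measure (E d)).restrict D, ∀ j, |ψ j x| ≤ ‖ψ j‖ :=
      ae_all_iff.2 fun j => ae_abs_le_norm (ψ j)
    filter_upwards [h1, h.overlap] with x hx hov J
    have hb : ∀ j, c * (2 : ℝ) ^ (β * level j) * |ψ j x| ≤ c * C * r ^ level j := by
      intro j
      calc c * (2 : ℝ) ^ (β * level j) * |ψ j x|
          ≤ c * (2 : ℝ) ^ (β * level j) * (C * (2 : ℝ) ^ (-α * (level j : ℝ))) := by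
            gcongr
            rw [← h.norm_eq]
            exact hx j
        _ = c * C * ((2 : ℝ) ^ (β * level j) * (2 : ℝ) ^ (-α * (level j : ℝ))) := by ring
        _ = c * C * r ^ level j := by
            rw [← Real.rpow_add two_pos, hr, ← Real.rpow_natCast, ← Real.rpow_mul two_pos.le]
            ring_nf
    calc ∑ j ∈ J, c * (2 : ℝ) ^ (β * level j) * |ψ j x|
        = ∑ l ∈ J.image level, ∑ j ∈ J with level j = l,
            c * (2 : ℝ) ^ (β * level j) * |ψ j x| :=
          (Finset.sum_fiberwise_of_maps_to (fun j hj => Finset.mem_image_of_mem _ hj) _).symm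
      _ ≤ ∑ l ∈ J.image level, M * (c * C * r ^ l) := by
          refine Finset.sum_le_sum fun l _ => sum_le_card_mul_of_encard_le (by positivity) ?_ ?_
          · intro j hj
            rw [← (Finset.mem_filter.1 hj).2]
            exact hb j
          · refine (Set.encard_le_encard ?_).trans (hov l)
            rintro j ⟨hj, hj'⟩
            exact ⟨(Finset.mem_filter.1 hj).2, fun h0 => hj' (by rw [h0, abs_zero, mul_zero])⟩
      _ = M * (c * C) * ∑ l ∈ J.image level, r ^ l := by
          rw [Finset.mul_sum]
          exact Finset.sum_congr rfl fun l _ => by ring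
      _ ≤ M * (c * C) * (1 - r)⁻¹ := by
          gcongr
          rw [← tsum_geometric_of_lt_one hr0.le hr1]
          exact (summable_geometric_of_lt_one hr0.le hr1).sum_le_tsum _ fun _ _ => by positivity
      _ = K * (M / (M + 1)) := by
          have : 1 - r ≠ 0 := by linarith
          rw [hc]
          field_simp
      _ ≤ K := mul_le_of_le_one_right hK.le (div_le_one_of_le₀ (by linarith) (by positivity))
  · have e : (fun j => (c * (2 : ℝ) ^ (β * level j)) ^ (-q')) =
        fun j => c ^ (-q') * (C ^ q)⁻¹ * ‖ψ j‖ ^ q := by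
      funext j
      rw [h.norm_eq, Real.mul_rpow hc0.le (by positivity), Real.mul_rpow hC.le (by positivity),
        ← Real.rpow_mul two_pos.le, ← Real.rpow_mul two_pos.le]
      have e1 : β * level j * -q' = -α * level j * q := by
        rw [hβ]
        field_simp
      have : C ^ q ≠ 0 := (by positivity : (0 : ℝ) < C ^ q).ne'
      rw [e1]
      field_simp
    simp only [e]
    exact hsum.mul_left _

end Weights

/-! ### Convergence and exponential moments of the random field. -/

section Field

variable {d : ℕ} {D : Set (E d)} {ψ : ℕ → LInfty D} {ρ : ℕ → ℝ} {K : ℝ}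

/-- The sequences `y` with `y_j = o(ρ_j)`. -/
def IsTame (ρ y : ℕ → ℝ) : Prop := Tendsto (fun j => |y j| / ρ j) cofinite (𝓝 0)

lemma norm_sum_smul_le (hρ : ∀ j, 0 < ρ j) (hK0 : 0 ≤ K)
    (hK : ∀ᵐ x ∂(volume : Measure (E d)).restrict D, ∀ J : Finset ℕ, ∑ j ∈ J, ρ j * |ψ j x| ≤ K)
    {A : ℝ} (hA : 0 ≤ A) (J : Finset ℕ) {y : ℕ → ℝ} (hy : ∀ j ∈ J, |y j| / ρ j ≤ A) :
    ‖∑ j ∈ J, y j • ψ j‖ ≤ A * K := by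
  refine norm_le_of_ae_abs_le (by positivity) ?_
  have h1 : ∀ j ∈ J, ∀ᵐ x ∂(volume : Measure (E d)).restrict D, (y j • ψ j : LInfty D) x
      = y j * ψ j x := fun j _ => by
    filter_upwards [Lp.coeFn_smul (y j) (ψ j)] with x hx
    rw [hx, Pi.smul_apply, smul_eq_mul]
  filter_upwards [hK, Lp.coeFn_finsetSum J fun j => y j • ψ j,
    (Finset.eventually_all J).2 h1] with x hx e1 e2
  rw [e1, Finset.sum_apply]
  calc |∑ j ∈ J, (y j • ψ j : LInfty D) x| ≤ ∑ j ∈ J, |(y j • ψ j : LInfty D) x| :=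
        Finset.abs_sum_le_sum_abs _ _
    _ ≤ ∑ j ∈ J, A * (ρ j * |ψ j x|) := by
        refine Finset.sum_le_sum fun j hj => ?_
        rw [e2 j hj, abs_mul, ← mul_assoc]
        gcongr
        exact (div_le_iff₀ (hρ j)).1 (hy j hj)
    _ ≤ A * K := by
        rw [← Finset.mul_sum]
        gcongr
        exact hx J

/-- Off a finite set `|y_j| ≤ ε ρ_j`, so finite sums there have norm at most `ε K`: this is Cauchy's
criterion. -/
lemma IsTame.summable (hρ : ∀ j, 0 < ρ j) (hK0 : 0 ≤ K)
    (hK : ∀ᵐ x ∂(volume : Measure (E d)).restrict D, ∀ J : Finset ℕ, ∑ j ∈ J, ρ j * |ψ j x| ≤ K)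
    {y : ℕ → ℝ} (hy : IsTame ρ y) : Summable fun j => y j • ψ j := by
  rw [summable_iff_vanishing_norm]
  intro ε hε
  have hε' : 0 < ε / (K + 1) := by positivity
  have h1 := (hy.eventually (gt_mem_nhds hε'))
  rw [eventually_cofinite] at h1
  refine ⟨h1.toFinset, fun t ht => ?_⟩
  refine (norm_sum_smul_le hρ hK0 hK hε'.le t fun j hj => ?_).trans_lt ?_
  · by_contra hlt
    exact Finset.disjoint_left.1 ht hj (by simpa using (not_le.1 hlt).le)
  · rw [div_mul_eq_mul_div, div_lt_iff₀ (by positivity)]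
    nlinarith

/-- The random field `b(y) = ∑ y_j ψ_j`. -/
def field (ψ : ℕ → LInfty D) (y : ℕ → ℝ) : LInfty D := ∑' j, y j • ψ j

/-- The norm is at most `K` times the supremum of the `|y_j| / ρ_j`. If some ratio exceeds 1,
tameness provides a largest one, and its term of the series alone dominates. The extra power `m`
costs nothing there, and it makes the expectations summable in `j`. -/
lemma IsTame.exp_norm_field_le (hρ : ∀ j, 0 < ρ j) (hK0 : 0 ≤ K)
    (hK : ∀ᵐ x ∂(volume : Measure (E d)).restrict D, ∀ J : Finset ℕ, ∑ j ∈ J, ρ j * |ψ j x| ≤ K)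
    {y : ℕ → ℝ} (hy : IsTame ρ y) {k : ℝ} (hk : 0 ≤ k) (m : ℕ) :
    ENNReal.ofReal (Real.exp (k * ‖field ψ y‖)) ≤ ENNReal.ofReal (Real.exp (k * K)) +
      ∑' j, ENNReal.ofReal ((|y j| / ρ j) ^ m * Real.exp (k * K * (|y j| / ρ j))) := by
  have hb : ∀ A : ℝ, 0 ≤ A → (∀ j, |y j| / ρ j ≤ A) → ‖field ψ y‖ ≤ A * K := fun A hA h =>
    le_of_tendsto (hy.summable hρ hK0 hK).hasSum.norm
      (Eventually.of_forall fun J => norm_sum_smul_le hρ hK0 hK hA J fun j _ => h j)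
  by_cases h1 : ∀ j, |y j| / ρ j ≤ 1
  · refine le_add_right (ENNReal.ofReal_le_ofReal (Real.exp_le_exp.2 ?_))
    gcongr
    simpa using hb 1 zero_le_one h1
  · push Not at h1
    obtain ⟨i, hi⟩ := h1
    have hfin := hy.eventually (gt_mem_nhds one_pos)
    rw [eventually_cofinite] at hfin
    obtain ⟨j, hj, hmax⟩ := hfin.toFinset.exists_max_image (fun j => |y j| / ρ j)
      ⟨i, by simpa using hi.le⟩
    have hj1 : 1 ≤ |y j| / ρ j := by simpa using hj
    refine le_add_left (le_trans ?_ (ENNReal.le_tsum j))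
    refine ENNReal.ofReal_le_ofReal ?_
    have h2 : ‖field ψ y‖ ≤ |y j| / ρ j * K := by
      refine hb _ (by linarith) fun l => ?_
      by_cases hl : |y l| / ρ l < 1
      · exact hl.le.trans hj1
      · exact hmax l (by simpa using hl)
    calc Real.exp (k * ‖field ψ y‖) ≤ Real.exp (k * K * (|y j| / ρ j)) := by
          refine Real.exp_le_exp.2 ?_
          rw [mul_assoc, mul_comm K]
          gcongr
      _ ≤ _ := le_mul_of_one_le_left (Real.exp_pos _).le (one_le_pow₀ hj1)

lemma tsum_lintegral_pow_mul_exp_ne_top {c : ℝ} (hc : 0 < c) (hcρ : ∀ j, c ≤ ρ j) {m : ℕ}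
    (hm : Summable fun j => (ρ j ^ m)⁻¹) {k : ℝ} (hk : 0 ≤ k) :
    ∫⁻ y, ∑' j, ENNReal.ofReal ((|y j| / ρ j) ^ m * Real.exp (k * (|y j| / ρ j))) ∂γ ≠ ⊤ := by
  have hρ : ∀ j, 0 < ρ j := fun j => hc.trans_le (hcρ j)
  have hmeas : ∀ (m : ℕ) (a b : ℝ), Measurable fun t : ℝ =>
      ENNReal.ofReal ((|t| / a) ^ m * Real.exp (b * (|t| / a))) := fun m a b => by fun_prop
  rw [lintegral_tsum fun j => Measurable.aemeasurable (by fun_prop)]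
  set I := ∫⁻ t, ENNReal.ofReal (|t| ^ m * Real.exp (k / c * |t|)) ∂gauss with hI
  have hIfin : I ≠ ⊤ := (integrable_abs_pow_mul_exp_gauss m (k / c)).lintegral_lt_top.ne
  have hle : ∀ j, ∫⁻ y : ℕ → ℝ, ENNReal.ofReal ((|y j| / ρ j) ^ m *
      Real.exp (k * (|y j| / ρ j))) ∂γ ≤ ENNReal.ofReal ((ρ j ^ m)⁻¹) * I := by
    intro j
    rw [(measurePreserving_eval_γ j).lintegral_comp (hmeas m (ρ j) k), hI,
      ← lintegral_const_mul' _ _ ENNReal.ofReal_ne_top]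
    refine lintegral_mono fun t => ?_
    have h0 := hρ j
    rw [← ENNReal.ofReal_mul (by positivity), ← mul_assoc, div_pow, div_eq_inv_mul]
    refine ENNReal.ofReal_le_ofReal ?_
    have : k * (|t| / ρ j) ≤ k / c * |t| := by
      rw [div_mul_eq_mul_div, ← mul_div_assoc]
      gcongr
      exact hcρ j
    gcongr
  refine ne_top_of_le_ne_top ?_ (ENNReal.tsum_le_tsum hle)
  rw [ENNReal.tsum_mul_right]
  refine ENNReal.mul_ne_top ?_ hIfin
  rw [← ENNReal.ofReal_tsum_of_nonneg (fun j => by have := hρ j; positivity) hm]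
  exact ENNReal.ofReal_ne_top

/-- For exponent `k = 0` the series of the `(|y_j| / ρ_j)^m` has finite expectation, so it converges
almost surely and its terms tend to zero. -/
lemma ae_isTame {c : ℝ} (hc : 0 < c) (hcρ : ∀ j, c ≤ ρ j) {m : ℕ} (hm0 : m ≠ 0)
    (hm : Summable fun j => (ρ j ^ m)⁻¹) : ∀ᵐ y ∂γ, IsTame ρ y := by
  have hρ : ∀ j, 0 < ρ j := fun j => hc.trans_le (hcρ j)
  have hmeas : Measurable fun y : ℕ → ℝ =>
      ∑' j, ENNReal.ofReal ((|y j| / ρ j) ^ m * Real.exp (0 * (|y j| / ρ j))) :=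
    Measurable.tsum fun j => by fun_prop
  have h := ae_lt_top hmeas (tsum_lintegral_pow_mul_exp_ne_top hc hcρ hm le_rfl)
  filter_upwards [h] with y hy
  have h1 := ENNReal.tendsto_cofinite_zero_of_tsum_ne_top hy.ne
  have h2 := (ENNReal.tendsto_toReal ENNReal.zero_ne_top).comp h1
  have e : ∀ j, (ENNReal.ofReal ((|y j| / ρ j) ^ m * Real.exp (0 * (|y j| / ρ j)))).toReal
      = (|y j| / ρ j) ^ m := fun j => by
    have := hρ j
    rw [zero_mul, Real.exp_zero, mul_one, ENNReal.toReal_ofReal (by positivity)]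
  simp only [Function.comp_def, e, ENNReal.toReal_zero] at h2
  have h3 := (h2.rpow_const (p := 1 / (m : ℝ)) (Or.inr (by positivity)))
  rw [Real.zero_rpow (by positivity)] at h3
  refine h3.congr fun j => ?_
  have := hρ j
  rw [one_div, Real.pow_rpow_inv_natCast (by positivity) hm0]

lemma aestronglyMeasurable_field (h : ∀ᵐ y ∂γ, Summable fun j => y j • ψ j) :
    AEStronglyMeasurable (field ψ) γ := by
  refine aestronglyMeasurable_of_tendsto_ae atTop
    (f := fun n (y : ℕ → ℝ) => ∑ j ∈ Finset.range n, y j • ψ j) (fun n => ?_) ?_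
  · exact Continuous.aestronglyMeasurable (by fun_prop)
  · filter_upwards [h] with y hy
    exact hy.hasSum.tendsto_sum_nat

lemma integrable_exp_norm_field {c : ℝ} (hc : 0 < c) (hcρ : ∀ j, c ≤ ρ j) {m : ℕ} (hm0 : m ≠ 0)
    (hm : Summable fun j => (ρ j ^ m)⁻¹) (hK0 : 0 ≤ K)
    (hK : ∀ᵐ x ∂(volume : Measure (E d)).restrict D, ∀ J : Finset ℕ, ∑ j ∈ J, ρ j * |ψ j x| ≤ K)
    {k : ℝ} (hk : 0 ≤ k) : Integrable (fun y => Real.exp (k * ‖field ψ y‖)) γ := by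
  have hρ : ∀ j, 0 < ρ j := fun j => hc.trans_le (hcρ j)
  have ht := ae_isTame hc hcρ hm0 hm
  refine ⟨Real.continuous_exp.comp_aestronglyMeasurable ((aestronglyMeasurable_field
    (ht.mono fun y hy => hy.summable hρ hK0 hK)).norm.const_mul k), ?_⟩
  rw [hasFiniteIntegral_iff_ofReal (ae_of_all _ fun _ => (Real.exp_pos _).le)]
  refine (lintegral_mono_ae (ht.mono fun y hy => hy.exp_norm_field_le hρ hK0 hK hk m)).trans_lt ?_
  rw [lintegral_add_left measurable_const, lintegral_const]
  exact ENNReal.add_lt_top.2 ⟨by simp,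
    (tsum_lintegral_pow_mul_exp_ne_top hc hcρ hm (by positivity)).lt_top⟩

end Field

/-! ### Taylor coefficients along the random field. -/

section TaylorField

variable {d : ℕ} {D : Set (E d)} {ψ : ℕ → LInfty D} {ρ : ℕ → ℝ} {c K : ℝ} {m : ℕ}

/-- Weights for which the Taylor coefficients of the solution map can be estimated. -/
structure IsAdmissible (ψ : ℕ → LInfty D) (ρ : ℕ → ℝ) (c K : ℝ) (m : ℕ) : Prop where
  c_pos : 0 < c
  c_le : ∀ j, c ≤ ρ j
  nonneg : 0 ≤ K
  exp_le : Real.exp K ≤ 3 / 2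
  sum_le : ∀ᵐ x ∂(volume : Measure (E d)).restrict D, ∀ J : Finset ℕ, ∑ j ∈ J, ρ j * |ψ j x| ≤ K
  ne_zero : m ≠ 0
  summable : Summable fun j => (ρ j ^ m)⁻¹

namespace IsAdmissible

variable (h : IsAdmissible ψ ρ c K m)
include h

lemma pos (j : ℕ) : 0 < ρ j := h.c_pos.trans_le (h.c_le j)

lemma ae_tame : ∀ᵐ y ∂γ, IsTame ρ y := ae_isTame h.c_pos h.c_le h.ne_zero h.summable

lemma summable_smul {y : ℕ → ℝ} (hy : IsTame ρ y) : Summable fun j => y j • ψ j :=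
  hy.summable h.pos h.nonneg h.sum_le

lemma isField {y : ℕ → ℝ} (hy : IsTame ρ y) : IsField ψ y (field ψ y) :=
  (h.summable_smul hy).hasSum.tendsto_sum_nat

/-- Varying `y_j` moves the field along a line in the direction `ψ_j`, so partial derivatives in
`y_j` become directional derivatives in `L^∞(D)`. -/
lemma field_update {y : ℕ → ℝ} (hy : IsTame ρ y) (j : ℕ) (s : ℝ) :
    field ψ (Function.update y j s) = (field ψ y - y j • ψ j) + s • ψ j := by
  have h1 := (h.summable_smul hy).hasSum.update j (s • ψ j)
  have e : Function.update (fun j => y j • ψ j) j (s • ψ j)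
      = fun i => Function.update y j s i • ψ i := by
    funext i
    by_cases hi : i = j
    · subst hi; simp
    · simp [Function.update_of_ne hi]
  rw [e] at h1
  have h2 : field ψ (Function.update y j s) = s • ψ j - y j • ψ j + field ψ y := h1.tsum_eq
  rw [h2]
  abel

lemma aestronglyMeasurable : AEStronglyMeasurable (field ψ) γ :=
  aestronglyMeasurable_field (h.ae_tame.mono fun _ hy => h.summable_smul hy)

lemma integrable_exp : Integrable (fun y => Real.exp (2 * ‖field ψ y‖)) γ :=
  integrable_exp_norm_field h.c_pos h.c_le h.ne_zero h.summable h.nonneg h.sum_le zero_le_two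

variable {P : ℝ} (hP0 : 0 < P) (hP : ∀ v : H10 D, ‖v‖ ≤ P * normV v) (f : StrongDual ℝ (H10 D))

lemma aestronglyMeasurable_taylor (μ : ℕ →₀ ℕ) :
    AEStronglyMeasurable (fun y => taylor hP0 hP ψ f μ (field ψ y)) γ :=
  (continuous_taylor hP0 hP ψ f μ).comp_aestronglyMeasurable h.aestronglyMeasurable

lemma memLp_gradL_taylor (μ : ℕ →₀ ℕ) :
    MemLp (fun y => gradL (taylor hP0 hP ψ f μ (field ψ y))) 2 γ := by
  have hm : AEStronglyMeasurable (fun y => gradL (taylor hP0 hP ψ f μ (field ψ y))) γ :=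
    gradL.continuous.comp_aestronglyMeasurable (h.aestronglyMeasurable_taylor hP0 hP f μ)
  rw [memLp_two_iff_integrable_sq_norm hm]
  refine (h.integrable_exp.const_mul ((wt ρ μ ^ 2)⁻¹ * (2 * (‖f‖ * P) ^ 2))).mono'
    (hm.norm.pow 2) (ae_of_all _ fun y => ?_)
  have h1 := sum_wt_normV_taylor_le hP0 hP ψ f h.pos h.exp_le h.sum_le {μ} (field ψ y)
  rw [Finset.sum_singleton] at h1
  have h2 := wt_pos h.pos μ
  rw [norm_gradL_apply, Real.norm_of_nonneg (by positivity), mul_assoc, ← div_eq_inv_mul,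
    le_div_iff₀ (by positivity), mul_comm]
  exact h1

lemma sum_wt_integral_le (S : Finset (ℕ →₀ ℕ)) :
    ∑ μ ∈ S, wt ρ μ ^ 2 * ∫ y, ‖gradL (taylor hP0 hP ψ f μ (field ψ y))‖ ^ 2 ∂γ
      ≤ ∫ y, 2 * (‖f‖ * P) ^ 2 * Real.exp (2 * ‖field ψ y‖) ∂γ := by
  have hi : ∀ μ, Integrable (fun y =>
      wt ρ μ ^ 2 * ‖gradL (taylor hP0 hP ψ f μ (field ψ y))‖ ^ 2) γ := fun μ =>
    ((h.memLp_gradL_taylor hP0 hP f μ).integrable_norm_pow two_ne_zero).const_mul _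
  simp_rw [← integral_const_mul]
  rw [← integral_finsetSum _ fun μ _ => hi μ]
  refine integral_mono (integrable_finsetSum _ fun μ _ => hi μ)
    (h.integrable_exp.const_mul _) fun y => ?_
  exact sum_wt_normV_taylor_le hP0 hP ψ f h.pos h.exp_le h.sum_le S (field ψ y)

lemma hasDerivAt_gradL_taylor (μ : ℕ →₀ ℕ) (j : ℕ) : ∀ᵐ y ∂γ, ∀ s : ℝ,
    HasDerivAt (fun s => gradL (taylor hP0 hP ψ f μ (field ψ (Function.update y j s))))
      (((μ j : ℝ) + 1) • gradL (taylor hP0 hP ψ f (μ + Finsupp.single j 1)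
        (field ψ (Function.update y j s)))) s := by
  filter_upwards [h.ae_tame] with y hy s
  simp_rw [h.field_update hy j]
  rw [← map_smul]
  exact (gradL (D := D)).hasFDerivAt.comp_hasDerivAt s
    (hasDerivAt_taylor hP0 hP ψ f μ j (field ψ y - y j • ψ j) s)

lemma isWeakSolution_iff_of_isField {y : ℕ → ℝ} (hy : IsTame ρ y) {b : LInfty D}
    (hb : IsField ψ y b) (v : H10 D) :
    IsWeakSolution b f v ↔ v = taylor hP0 hP ψ f 0 (field ψ y) := by
  rw [tendsto_nhds_unique hb (h.isField hy)]
  exact isWeakSolution_iff_eq_taylor hP0 hP ψ f _ v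

/-- The limit `b` and the weak solution are unique, so the choice made in `solutionMap` is forced.
-/
lemma solutionMap_eq {y : ℕ → ℝ} (hy : IsTame ρ y) :
    solutionMap ψ f y = taylor hP0 hP ψ f 0 (field ψ y) := by
  have hex : ∃ v : H10 D, ∃ b : LInfty D, IsField ψ y b ∧ IsWeakSolution b f v :=
    ⟨taylor hP0 hP ψ f 0 (field ψ y), field ψ y, h.isField hy,
      (h.isWeakSolution_iff_of_isField hP0 hP f hy (h.isField hy) _).2 rfl⟩
  rw [solutionMap, dif_pos hex]
  obtain ⟨b, hb, hw⟩ := hex.choose_spec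
  exact (h.isWeakSolution_iff_of_isField hP0 hP f hy hb _).1 hw

include hP0 hP

lemma exists_isField_and_forall_isWeakSolution_iff : ∀ᵐ y ∂γ, ∃ b : LInfty D, IsField ψ y b ∧
    ∀ v : H10 D, IsWeakSolution b f v ↔ v = solutionMap ψ f y := by
  filter_upwards [h.ae_tame] with y hy
  refine ⟨field ψ y, h.isField hy, fun v => ?_⟩
  rw [h.solutionMap_eq hP0 hP f hy]
  exact h.isWeakSolution_iff_of_isField hP0 hP f hy (h.isField hy) v

lemma solutionMap_ae_eq :
    solutionMap ψ f =ᵐ[γ] fun y => taylor hP0 hP ψ f 0 (field ψ y) :=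
  h.ae_tame.mono fun _ hy => h.solutionMap_eq hP0 hP f hy

lemma memLp_solutionMap : MemLp (solutionMap ψ f) 2 γ := by
  refine MemLp.ae_eq (h.solutionMap_ae_eq hP0 hP f).symm ?_
  refine ((h.memLp_gradL_taylor hP0 hP f 0).norm.const_mul P).of_le
    (h.aestronglyMeasurable_taylor hP0 hP f 0) (ae_of_all _ fun y => ?_)
  refine (hP _).trans (le_trans ?_ (le_abs_self _))
  rw [norm_gradL_apply]

end IsAdmissible

end TaylorField

/-! ### Weighted square summability of the Hermite coefficients. -/

section WeightedBessel

/-- The multi-index with the entries `min ν_j r`. -/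
def cut (r : ℕ) (ν : ℕ →₀ ℕ) : ℕ →₀ ℕ := ν.mapRange (fun n => min n r) (Nat.zero_min r)

/-- The multi-index with the entries `ν_j - r`. -/
def excess (r : ℕ) (ν : ℕ →₀ ℕ) : ℕ →₀ ℕ := ν.mapRange (fun n => n - r) (Nat.zero_sub r)

lemma excess_add_cut (r : ℕ) (ν : ℕ →₀ ℕ) : excess r ν + cut r ν = ν := by
  ext j
  simp only [excess, cut, Finsupp.add_apply, Finsupp.mapRange_apply]
  omega

/-- The factors of the weights in the estimate of the Hermite coefficients. -/
def factor (r : ℕ) (a : ℝ) (n : ℕ) : ℝ :=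
  (a ^ min n r) ^ 2 * (n.factorial / ((min n r).factorial ^ 2 * (n - r).factorial))

lemma factor_zero (r : ℕ) (a : ℝ) : factor r a 0 = 1 := by simp [factor]

lemma factor_pos (r : ℕ) {a : ℝ} (ha : 0 < a) (n : ℕ) : 0 < factor r a n := by
  unfold factor; positivity

lemma prod_factor (r : ℕ) (ρ : ℕ → ℝ) (ν : ℕ →₀ ℕ) :
    (ν.prod fun j n => factor r (ρ j) n) = wt ρ (cut r ν) ^ 2 *
      (mfact ν / (mfact (cut r ν) ^ 2 * mfact (excess r ν))) := by
  have h1 : (cut r ν).support ⊆ ν.support := Finsupp.support_mapRange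
  have h2 : (excess r ν).support ⊆ ν.support := Finsupp.support_mapRange
  rw [wt, mfact, mfact, mfact, finsupp_prod_eq_prod h1 (by simp),
    finsupp_prod_eq_prod h1 (by simp), finsupp_prod_eq_prod h2 (by simp), Finsupp.prod,
    Finsupp.prod, ← Finset.prod_pow, ← Finset.prod_pow, ← Finset.prod_mul_distrib,
    ← Finset.prod_div_distrib, ← Finset.prod_mul_distrib]
  exact Finset.prod_congr rfl fun j _ => rfl

variable {H : Type*} [NormedAddCommGroup H] [InnerProductSpace ℝ H]

/-- This is the squared norm of `integral_heM_add_smul`; the factorials come from `μ!` there and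
from normalizing `He_{κ+μ}` and `He_κ`. -/
lemma norm_integral_hermite_add_smul_sq {g : (ℕ →₀ ℕ) → (ℕ → ℝ) → H}
    (hg : ∀ μ, MemLp (g μ) 2 γ)
    (hd : ∀ μ j, ∀ᵐ y ∂γ, ∀ s : ℝ, HasDerivAt (fun s => g μ (Function.update y j s))
      (((μ j : ℝ) + 1) • g (μ + Finsupp.single j 1) (Function.update y j s)) s)
    (κ μ : ℕ →₀ ℕ) :
    mfact (κ + μ) / (mfact μ ^ 2 * mfact κ) * ‖∫ y, hermite (κ + μ) y • g 0 y ∂γ‖ ^ 2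
      = ‖∫ y, hermite κ y • g μ y ∂γ‖ ^ 2 := by
  have h := congrArg (fun v => ‖v‖ ^ 2) (integral_heM_add_smul hg hd κ μ)
  simp only [heM_eq, mul_smul, integral_smul, norm_smul, mul_pow, Real.norm_eq_abs, sq_abs,
    Real.sq_sqrt (mfact_pos _).le] at h
  have h1 := mfact_pos μ
  have h2 := mfact_pos κ
  rw [div_mul_eq_mul_div, h]
  field_simp

/-- Group the `ν` by `μ = cut r ν`. Inside a group `ν` is determined by its excess, so Bessel's
inequality for `g μ` bounds the group, and `hB` sums the groups. -/
lemma sum_prod_factor_mul_norm_sq_le [CompleteSpace H] {g : (ℕ →₀ ℕ) → (ℕ → ℝ) → H}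
    (hg : ∀ μ, MemLp (g μ) 2 γ)
    (hd : ∀ μ j, ∀ᵐ y ∂γ, ∀ s : ℝ, HasDerivAt (fun s => g μ (Function.update y j s))
      (((μ j : ℝ) + 1) • g (μ + Finsupp.single j 1) (Function.update y j s)) s)
    {ρ : ℕ → ℝ} {B : ℝ}
    (hB : ∀ S : Finset (ℕ →₀ ℕ), ∑ μ ∈ S, wt ρ μ ^ 2 * ∫ y, ‖g μ y‖ ^ 2 ∂γ ≤ B) (r : ℕ)
    (S : Finset (ℕ →₀ ℕ)) :
    ∑ ν ∈ S, (ν.prod fun j n => factor r (ρ j) n) * ‖∫ y, hermite ν y • g 0 y ∂γ‖ ^ 2 ≤ B := by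
  classical
  have e : ∀ ν, (ν.prod fun j n => factor r (ρ j) n) * ‖∫ y, hermite ν y • g 0 y ∂γ‖ ^ 2
      = wt ρ (cut r ν) ^ 2 * ‖∫ y, hermite (excess r ν) y • g (cut r ν) y ∂γ‖ ^ 2 := by
    intro ν
    have h1 := norm_integral_hermite_add_smul_sq hg hd (excess r ν) (cut r ν)
    rw [excess_add_cut] at h1
    rw [prod_factor, mul_assoc, h1]
  simp_rw [e]
  rw [← Finset.sum_fiberwise_of_maps_to (t := S.image (cut r))
    (fun ν hν => Finset.mem_image_of_mem (cut r) hν)]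
  refine le_trans (Finset.sum_le_sum fun μ _ => ?_) (hB (S.image (cut r)))
  have hinj : Set.InjOn (excess r) (S.filter fun ν => cut r ν = μ : Finset (ℕ →₀ ℕ)) := by
    intro ν hν ν' hν' h
    rw [Finset.mem_coe, Finset.mem_filter] at hν hν'
    rw [← excess_add_cut r ν, ← excess_add_cut r ν', h, hν.2, hν'.2]
  calc ∑ ν ∈ S with cut r ν = μ,
        wt ρ (cut r ν) ^ 2 * ‖∫ y, hermite (excess r ν) y • g (cut r ν) y ∂γ‖ ^ 2
      = ∑ ν ∈ S with cut r ν = μ, wt ρ μ ^ 2 * ‖∫ y, hermite (excess r ν) y • g μ y ∂γ‖ ^ 2 :=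
        Finset.sum_congr rfl fun ν hν => by rw [(Finset.mem_filter.1 hν).2]
    _ = wt ρ μ ^ 2 * ∑ κ ∈ (S.filter fun ν => cut r ν = μ).image (excess r),
          ‖∫ y, hermite κ y • g μ y ∂γ‖ ^ 2 := by
        rw [Finset.sum_image hinj, Finset.mul_sum]
    _ ≤ wt ρ μ ^ 2 * ∫ y, ‖g μ y‖ ^ 2 ∂γ :=
        mul_le_mul_of_nonneg_left (sum_norm_integral_hermite_smul_sq_le (hg μ) _) (sq_nonneg _)

end WeightedBessel

/-! ### Summability of negative powers of the weights. -/

section Weights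

/-- For `n ≥ r`, `n! / (n - r)! ≥ (n + 1 - r)^r ≥ (n / r)^r`; for `n ≤ r` only constants are
involved. Powers of `a` beyond the second are bounded below through `a ≥ c`. The growth `n^r` makes
sums over `n` converge. -/
lemma le_factor {r : ℕ} (hr : 0 < r) {c a : ℝ} (hc : 0 < c) (hc1 : c ≤ 1) (hca : c ≤ a) {n : ℕ}
    (hn : n ≠ 0) :
    c ^ (2 * r) / (r ^ r * (r.factorial : ℝ) ^ 2) * a ^ 2 * (n : ℝ) ^ r ≤ factor r a n := by
  have ha : 0 < a := hc.trans_le hca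
  have hr' : (0 : ℝ) < r := by exact_mod_cast hr
  have h1 : (n : ℝ) ^ r / (r ^ r * (r.factorial : ℝ) ^ 2) ≤
      n.factorial / ((min n r).factorial ^ 2 * (n - r).factorial) := by
    rcases le_total n r with h | h
    · rw [min_eq_left h, Nat.sub_eq_zero_of_le h, Nat.factorial_zero, Nat.cast_one, mul_one,
        div_le_div_iff₀ (by positivity) (by positivity)]
      have e1 : (n : ℝ) ^ r ≤ (r : ℝ) ^ r := by gcongr
      have e2 : (n.factorial : ℝ) ^ 2 ≤ n.factorial * (r.factorial : ℝ) ^ 2 := by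
        rw [sq]
        have e3 : (n.factorial : ℝ) ≤ r.factorial := by exact_mod_cast Nat.factorial_le h
        have e4 : (1 : ℝ) ≤ r.factorial := by exact_mod_cast Nat.factorial_pos r
        have e5 : (n.factorial : ℝ) ≤ (r.factorial : ℝ) ^ 2 := e3.trans (le_self_pow₀ e4 two_ne_zero)
        gcongr
      calc (n : ℝ) ^ r * (n.factorial : ℝ) ^ 2
          ≤ (r : ℝ) ^ r * (n.factorial * (r.factorial : ℝ) ^ 2) := by gcongr
        _ = _ := by ring
    · rw [min_eq_right h]
      have e1 : (n.factorial : ℝ) = (n - r).factorial * n.descFactorial r := by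
        exact_mod_cast (Nat.factorial_mul_descFactorial h).symm
      have e2 : ((n + 1 - r : ℕ) : ℝ) ^ r ≤ n.descFactorial r := by
        exact_mod_cast Nat.pow_sub_le_descFactorial n r
      have e3 : (n : ℝ) ≤ r * (n + 1 - r : ℕ) := by
        have : n ≤ r * (n + 1 - r) := by
          obtain ⟨k, rfl⟩ := Nat.exists_eq_add_of_le h
          obtain ⟨s, rfl⟩ := Nat.exists_eq_succ_of_ne_zero hr.ne'
          have : s.succ + k + 1 - s.succ = k + 1 := by omega
          rw [this]
          simp only [Nat.succ_eq_add_one]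
          nlinarith
        exact_mod_cast this
      have e4 : (n : ℝ) ^ r ≤ r ^ r * n.descFactorial r := by
        calc (n : ℝ) ^ r ≤ (r * (n + 1 - r : ℕ)) ^ r := by gcongr
          _ = r ^ r * ((n + 1 - r : ℕ) : ℝ) ^ r := mul_pow _ _ _
          _ ≤ _ := by gcongr
      rw [div_le_div_iff₀ (by positivity) (by positivity), e1]
      calc (n : ℝ) ^ r * ((r.factorial : ℝ) ^ 2 * (n - r).factorial)
          ≤ (r ^ r * n.descFactorial r) * ((r.factorial : ℝ) ^ 2 * (n - r).factorial) := by gcongr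
        _ = _ := by ring
  have h2 : c ^ (2 * r) * a ^ 2 ≤ (a ^ min n r) ^ 2 := by
    obtain ⟨s, hs⟩ : ∃ s, min n r = s + 1 := Nat.exists_eq_succ_of_ne_zero (by omega)
    have hsr : 2 * s ≤ 2 * r := by omega
    calc c ^ (2 * r) * a ^ 2 ≤ c ^ (2 * s) * a ^ 2 := by
          gcongr ?_ * _
          exact pow_le_pow_of_le_one hc.le hc1 hsr
      _ ≤ a ^ (2 * s) * a ^ 2 := by gcongr
      _ = (a ^ min n r) ^ 2 := by rw [hs]; ring
  calc c ^ (2 * r) / (r ^ r * (r.factorial : ℝ) ^ 2) * a ^ 2 * (n : ℝ) ^ r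
      = (c ^ (2 * r) * a ^ 2) * ((n : ℝ) ^ r / (r ^ r * (r.factorial : ℝ) ^ 2)) := by ring
    _ ≤ factor r a n := by
        unfold factor
        gcongr

/-- The sum over a box factors. Since `r t > 1`, each factor is at most `1 + A ρ_j^{-2t} ≤ exp(A
ρ_j^{-2t})` with `A` independent of `j`, and the product is bounded by the exponential of a
convergent sum. -/
lemma summable_prod_factor_rpow {ρ : ℕ → ℝ} {c : ℝ} (hc : 0 < c) (hc1 : c ≤ 1)
    (hcρ : ∀ j, c ≤ ρ j) {t : ℝ} (ht : 0 < t) {r : ℕ} (hr : 1 < r * t)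
    (hs : Summable fun j => ρ j ^ (-(2 * t))) :
    Summable fun ν : ℕ →₀ ℕ => (ν.prod fun j n => factor r (ρ j) n) ^ (-t) := by
  have hρ : ∀ j, 0 < ρ j := fun j => hc.trans_le (hcρ j)
  have hr0 : 0 < r := by
    rcases Nat.eq_zero_or_pos r with rfl | h
    · norm_num at hr
    · exact h
  set b : ℝ := c ^ (2 * r) / (r ^ r * (r.factorial : ℝ) ^ 2) with hb
  have hr' : (0 : ℝ) < r := by exact_mod_cast hr0
  have hb0 : 0 < b := by positivity
  have hz : Summable fun n : ℕ => (n : ℝ) ^ (-(r * t)) := Real.summable_nat_rpow.2 (by linarith)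
  set Z := ∑' n : ℕ, (n : ℝ) ^ (-(r * t)) with hZ
  have hZ0 : 0 ≤ Z := tsum_nonneg fun n => by positivity
  have hfac : ∀ j n, n ≠ 0 →
      factor r (ρ j) n ^ (-t) ≤ b ^ (-t) * ρ j ^ (-(2 * t)) * (n : ℝ) ^ (-(r * t)) := by
    intro j n hn
    have h0 := hρ j
    have hn' : (0 : ℝ) < n := by exact_mod_cast Nat.pos_of_ne_zero hn
    refine (Real.rpow_le_rpow_of_nonpos (by positivity)
      (le_factor hr0 hc hc1 (hcρ j) hn) (by linarith)).trans_eq ?_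
    rw [Real.mul_rpow (by positivity) (by positivity), Real.mul_rpow (by positivity) (by positivity),
      ← Real.rpow_natCast (ρ j), ← Real.rpow_natCast (n : ℝ), ← Real.rpow_mul h0.le,
      ← Real.rpow_mul hn'.le]
    push_cast
    rw [mul_neg, mul_neg]
  have hone : ∀ j (k : ℕ), ∑ n ∈ Finset.range (k + 1), factor r (ρ j) n ^ (-t)
      ≤ Real.exp (b ^ (-t) * Z * ρ j ^ (-(2 * t))) := by
    intro j k
    have h0 := hρ j
    rw [Finset.sum_range_succ', factor_zero, Real.one_rpow]
    refine le_trans (add_le_add_left ?_ 1) (Real.add_one_le_exp _)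
    calc ∑ n ∈ Finset.range k, factor r (ρ j) (n + 1) ^ (-t)
        ≤ ∑ n ∈ Finset.range k,
            b ^ (-t) * ρ j ^ (-(2 * t)) * ((n + 1 : ℕ) : ℝ) ^ (-(r * t)) :=
          Finset.sum_le_sum fun n _ => hfac j (n + 1) n.succ_ne_zero
      _ = b ^ (-t) * ρ j ^ (-(2 * t)) * ∑ n ∈ Finset.range k, ((n + 1 : ℕ) : ℝ) ^ (-(r * t)) :=
          (Finset.mul_sum _ _ _).symm
      _ ≤ b ^ (-t) * ρ j ^ (-(2 * t)) * Z := by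
          gcongr
          refine le_trans ?_ (hz.sum_le_tsum (Finset.range (k + 1)) fun n _ => by positivity)
          rw [Finset.sum_range_succ']
          exact le_add_of_nonneg_right (by positivity)
      _ = b ^ (-t) * Z * ρ j ^ (-(2 * t)) := by ring
  refine summable_of_sum_le (c := Real.exp (b ^ (-t) * Z * ∑' j, ρ j ^ (-(2 * t))))
    (fun ν => Real.rpow_nonneg (Finset.prod_nonneg fun j _ => (factor_pos r (hρ j) _).le) _)
    fun S => ?_
  obtain ⟨J, k, hS⟩ := exists_subset_box S
  have e : ∀ ν ∈ J.finsupp (fun _ => Finset.range (k + 1)),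
      (ν.prod fun j n => factor r (ρ j) n) ^ (-t) = ∏ j ∈ J, factor r (ρ j) (ν j) ^ (-t) := by
    intro ν hν
    rw [finsupp_prod_eq_prod (mem_box.1 hν).1 fun j => factor_zero r _,
      Real.finsetProd_rpow _ _ fun j _ => (factor_pos r (hρ j) _).le]
  calc ∑ ν ∈ S, (ν.prod fun j n => factor r (ρ j) n) ^ (-t)
      ≤ ∑ ν ∈ J.finsupp (fun _ => Finset.range (k + 1)),
          (ν.prod fun j n => factor r (ρ j) n) ^ (-t) :=
        Finset.sum_le_sum_of_subset_of_nonneg hS fun ν _ _ =>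
          Real.rpow_nonneg (Finset.prod_nonneg fun j _ => (factor_pos r (hρ j) _).le) _
    _ = ∏ j ∈ J, ∑ n ∈ Finset.range (k + 1), factor r (ρ j) n ^ (-t) := by
        rw [Finset.sum_congr rfl e]
        exact sum_finsupp_prod J _ fun j n => factor r (ρ j) n ^ (-t)
    _ ≤ ∏ j ∈ J, Real.exp (b ^ (-t) * Z * ρ j ^ (-(2 * t))) :=
        Finset.prod_le_prod (fun j _ => Finset.sum_nonneg fun n _ =>
          Real.rpow_nonneg (factor_pos r (hρ j) _).le _) fun j _ => hone j k
    _ = Real.exp (b ^ (-t) * Z * ∑ j ∈ J, ρ j ^ (-(2 * t))) := by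
        rw [← Real.exp_sum, Finset.mul_sum]
    _ ≤ _ := by
        refine Real.exp_le_exp.2 (mul_le_mul_of_nonneg_left ?_ (by positivity))
        exact hs.sum_le_tsum _ fun j _ => Real.rpow_nonneg (hρ j).le _

/-- Write `a^p = (W a²)^{p/2} (W^{-p/(2-p)})^{1-p/2}` and apply the weighted inequality of the
means. -/
lemma summable_rpow_of_weights {ι : Type*} {a W : ι → ℝ} (ha : ∀ i, 0 ≤ a i) (hW : ∀ i, 0 < W i)
    {p : ℝ} (hp : 0 < p) (hp2 : p < 2) (h1 : Summable fun i => W i * a i ^ 2)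
    (h2 : Summable fun i => W i ^ (-(p / (2 - p)))) : Summable fun i => a i ^ p := by
  refine Summable.of_nonneg_of_le (fun i => Real.rpow_nonneg (ha i) _) (fun i => ?_)
    ((h1.mul_left (p / 2)).add (h2.mul_left (1 - p / 2)))
  have h3 := Real.geom_mean_le_arith_mean2_weighted (w₁ := p / 2) (w₂ := 1 - p / 2)
    (p₁ := W i * a i ^ 2) (p₂ := W i ^ (-(p / (2 - p)))) (by positivity) (by linarith)
    (mul_nonneg (hW i).le (sq_nonneg _)) (Real.rpow_nonneg (hW i).le _) (by ring)
  refine le_of_eq_of_le ?_ h3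
  have hw := hW i
  rw [Real.mul_rpow hw.le (sq_nonneg _), ← Real.rpow_mul hw.le, ← Real.rpow_natCast (a i),
    ← Real.rpow_mul (ha i)]
  have e1 : -(p / (2 - p)) * (1 - p / 2) = -(p / 2) := by
    have : 2 - p ≠ 0 := by linarith
    field_simp
  have e2 : ((2 : ℕ) : ℝ) * (p / 2) = p := by push_cast; ring
  rw [e1, e2, mul_right_comm, ← Real.rpow_add hw, add_neg_cancel, Real.rpow_zero, one_mul]

end Weights

/-! ### Best n-term approximation of sequences. -/

section BestTerms

variable {ι : Type*} {a : ι → ℝ}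

lemma exists_forall_notMem_le [Infinite ι] (ha : ∀ i, 0 ≤ a i) (h : Tendsto a cofinite (𝓝 0))
    (S : Finset ι) : ∃ i ∉ S, ∀ j ∉ S, a j ≤ a i := by
  classical
  by_cases h0 : ∃ i ∉ S, 0 < a i
  · obtain ⟨i, hi, hpos⟩ := h0
    have hfin := h.eventually (gt_mem_nhds hpos)
    rw [eventually_cofinite] at hfin
    obtain ⟨k, hk, hmax⟩ := (hfin.toFinset \ S).exists_max_image a
      ⟨i, by simpa using hi⟩
    simp only [Finset.mem_sdiff, Set.Finite.mem_toFinset, not_lt] at hk hmax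
    refine ⟨k, hk.2, fun j hj => ?_⟩
    rcases lt_or_ge (a j) (a i) with hji | hji
    · exact hji.le.trans hk.1
    · exact hmax j ⟨hji, hj⟩
  · push Not at h0
    -- No value outside `S` is positive, so any index outside `S` is maximal.
    obtain ⟨i, hi⟩ := Infinite.exists_notMem_finset S
    exact ⟨i, hi, fun j hj => (h0 j hj).trans (ha i)⟩

lemma exists_card_eq_and_forall_le [Infinite ι] (ha : ∀ i, 0 ≤ a i)
    (h : Tendsto a cofinite (𝓝 0)) (n : ℕ) :
    ∃ S : Finset ι, S.card = n ∧ ∀ i ∈ S, ∀ j ∉ S, a j ≤ a i := by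
  classical
  induction n with
  | zero => exact ⟨∅, by simp⟩
  | succ n ih =>
    obtain ⟨S, hS, hle⟩ := ih
    obtain ⟨i, hi, hmax⟩ := exists_forall_notMem_le ha h S
    refine ⟨insert i S, by rw [Finset.card_insert_of_notMem hi, hS], fun k hk j hj => ?_⟩
    rw [Finset.mem_insert, not_or] at hj
    rcases Finset.mem_insert.1 hk with rfl | hk
    · exact hmax j hj.2
    · exact hle k hk j hj.2

/-- Stechkin's estimate of the tail of a sequence after its `n` largest terms. -/
lemma hasSum_sq_compl_le (ha : ∀ i, 0 ≤ a i) {p : ℝ} (hp : 0 < p) (hp2 : p < 2)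
    (h : Summable fun i => a i ^ p) {S : Finset ι} {n : ℕ} (hn : 1 ≤ n) (hS : S.card = n)
    (hle : ∀ i ∈ S, ∀ j ∉ S, a j ≤ a i) {T : ℝ}
    (hT : HasSum (fun i : {i // i ∉ S} => a i ^ 2) T) :
    T ≤ ((∑' i, a i ^ p) ^ (1 / p) * (n : ℝ) ^ (-(1 / p - 1 / 2))) ^ 2 := by
  set A := ∑' i, a i ^ p with hA
  have hA0 : 0 ≤ A := tsum_nonneg fun i => Real.rpow_nonneg (ha i) _
  have hn' : (0 : ℝ) < n := by exact_mod_cast hn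
  -- Each of the `n` values on `S` is at least `a_j`, so `n a_j^p ≤ A`.
  have hj : ∀ j ∉ S, a j ≤ (A / n) ^ (1 / p) := by
    intro j hj
    have h1 : n * a j ^ p ≤ A := by
      calc n * a j ^ p = ∑ i ∈ S, a j ^ p := by rw [Finset.sum_const, hS, nsmul_eq_mul]
        _ ≤ ∑ i ∈ S, a i ^ p := Finset.sum_le_sum fun i hi =>
            Real.rpow_le_rpow (ha j) (hle i hi j hj) hp.le
        _ ≤ A := h.sum_le_tsum _ fun i _ => Real.rpow_nonneg (ha i) _
    rw [one_div, Real.le_rpow_inv_iff_of_pos (ha j) (by positivity) hp, le_div_iff₀ hn', mul_comm]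
    exact h1
  have hbound : ∀ i : {i // i ∉ S}, a i ^ 2 ≤ (A / n) ^ ((2 - p) / p) * a i ^ p := by
    intro i
    have e : a (i : ι) ^ 2 = a i ^ (2 - p) * a i ^ p := by
      rw [← Real.rpow_add_of_nonneg (ha i) (by linarith) hp.le, sub_add_cancel, Real.rpow_two]
    rw [e]
    refine mul_le_mul_of_nonneg_right ?_ (Real.rpow_nonneg (ha i) _)
    refine (Real.rpow_le_rpow (ha i) (hj i i.2) (by linarith)).trans_eq ?_
    rw [← Real.rpow_mul (by positivity)]
    congr 1
    ring
  have hsub : Summable fun i : {i // i ∉ S} => a i ^ p := h.comp_injective Subtype.val_injective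
  have h2 : T ≤ (A / n) ^ ((2 - p) / p) * A := by
    refine (hasSum_le hbound hT (hsub.hasSum.mul_left _)).trans ?_
    refine mul_le_mul_of_nonneg_left ?_ (by positivity)
    exact Summable.tsum_subtype_le (fun i => a i ^ p) {i | i ∉ S}
      (fun i => Real.rpow_nonneg (ha i) p) h
  refine h2.trans_eq ?_
  rcases hA0.eq_or_lt with h0 | h0
  · rw [← h0, mul_zero, Real.zero_rpow (by positivity), zero_mul, zero_pow two_ne_zero]
  · rw [Real.div_rpow hA0 hn'.le, mul_pow, ← Real.rpow_natCast (A ^ (1 / p)), ← Real.rpow_mul hA0,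
      ← Real.rpow_natCast ((n : ℝ) ^ _), ← Real.rpow_mul hn'.le, div_eq_mul_inv,
      ← Real.rpow_neg hn'.le, mul_right_comm]
    nth_rewrite 2 [← Real.rpow_one A]
    rw [← Real.rpow_add h0]
    congr 2
    · push_cast
      field_simp
      ring
    · push_cast
      field_simp

end BestTerms

/-! ### Assembly of the estimates. -/

variable {d : ℕ} {D : Set (E d)}

lemma exists_isAdmissible {ψ : ℕ → LInfty D} {level : ℕ → ℕ} {M : ℕ} {C α : ℝ}
    (h : IsWaveletType ψ level M C α) {q q' : ℝ} (hq : 0 < q) (hqq : q < q')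
    (hsum : Summable fun j => ‖ψ j‖ ^ q) : ∃ (ρ : ℕ → ℝ) (c K : ℝ) (m : ℕ),
      IsAdmissible ψ ρ c K m ∧ c ≤ 1 ∧ Summable fun j => ρ j ^ (-q') := by
  have hK : 0 < Real.log (3 / 2) := Real.log_pos (by norm_num)
  obtain ⟨ρ, c, hc, hcρ, hle, hs⟩ := exists_weights h hq hqq hsum hK
  -- An integer exponent serves the moment estimates; as `ρ_j ≥ c`, summability passes from `q'` to
  -- any `m ≥ q'`.
  obtain ⟨m, hm⟩ := exists_nat_ge q'
  have hm0 : m ≠ 0 := by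
    rintro rfl
    rw [Nat.cast_zero] at hm
    linarith
  refine ⟨ρ, min c 1, Real.log (3 / 2), m, ⟨lt_min hc one_pos, fun j => (min_le_left _ _).trans
    (hcρ j), hK.le, (Real.exp_log (by norm_num)).le, hle, hm0, ?_⟩, min_le_right _ _, hs⟩
  refine Summable.of_nonneg_of_le (fun j => ?_) (fun j => ?_) (hs.mul_left (c ^ (q' - m)))
  · have := hc.trans_le (hcρ j)
    positivity
  · have h0 := hc.trans_le (hcρ j)
    calc (ρ j ^ m)⁻¹ = ρ j ^ (q' - m) * ρ j ^ (-q') := by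
          rw [← Real.rpow_add h0, ← Real.rpow_natCast, ← Real.rpow_neg h0.le]
          congr 1
          ring
      _ ≤ c ^ (q' - m) * ρ j ^ (-q') := by
          refine mul_le_mul_of_nonneg_right ?_ (Real.rpow_nonneg h0.le _)
          exact Real.rpow_le_rpow_of_nonpos hc (hcρ j) (by linarith)

lemma gradL_hermiteCoeff {u : (ℕ → ℝ) → H10 D} (hu : MemLp u 2 γ) (ν : ℕ →₀ ℕ) :
    gradL (hermiteCoeff u ν) = ∫ y, hermite ν y • gradL (u y) ∂γ := by
  rw [hermiteCoeff, ← gradL.integral_comp_comm (integrable_hermite_smul ν hu)]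
  simp_rw [map_smul]

lemma normV_hermiteCoeff {u : (ℕ → ℝ) → H10 D} (hu : MemLp u 2 γ) (ν : ℕ →₀ ℕ) :
    normV (hermiteCoeff u ν) = ‖∫ y, hermite ν y • gradL (u y) ∂γ‖ := by
  rw [← norm_gradL_apply, gradL_hermiteCoeff hu]

/-- Parseval's identity is applied to the gradient of `u` in `L²(D; ℝ^d)`, because `normV` is not
the norm of the type `H10 D`. -/
lemma hasSum_normV_hermiteCoeff_sq {u : (ℕ → ℝ) → H10 D} (hu : MemLp u 2 γ)
    (S : Finset (ℕ →₀ ℕ)) :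
    HasSum (fun ν : {ν // ν ∉ S} => normV (hermiteCoeff u ν) ^ 2)
      ((truncationError u S).toReal ^ 2) ∧ truncationError u S ≠ ⊤ := by
  have hg : MemLp (fun y => gradL (u y)) 2 γ := gradL.comp_memLp' hu
  have hr : MemLp (fun y => gradL (u y) -
      ∑ ν ∈ S, hermite ν y • ∫ z, hermite ν z • gradL (u z) ∂γ) 2 γ :=
    hg.sub (memLp_finsetSum S fun ν _ => memLp_hermite_smul_const ν _)
  have e : truncationError u S = eLpNorm (fun y => gradL (u y) -
      ∑ ν ∈ S, hermite ν y • ∫ z, hermite ν z • gradL (u z) ∂γ) 2 γ := by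
    rw [← eLpNorm_norm, truncationError]
    congr 1
    funext y
    rw [← norm_gradL_apply, map_sub, map_sum]
    simp_rw [map_smul, gradL_hermiteCoeff hu]
  refine ⟨?_, e ▸ hr.2.ne⟩
  have h := hasSum_norm_integral_hermite_smul_sq hg S
  rw [← norm_toLp_sq hr, Lp.norm_toLp, ← e] at h
  simp_rw [normV_hermiteCoeff hu]
  exact h

lemma summable_normV_hermiteCoeff_rpow {ψ : ℕ → LInfty D} {ρ : ℕ → ℝ} {c K : ℝ} {m : ℕ}
    (h : IsAdmissible ψ ρ c K m) (hc : c ≤ 1) {P : ℝ} (hP0 : 0 < P)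
    (hP : ∀ v : H10 D, ‖v‖ ≤ P * normV v) (f : StrongDual ℝ (H10 D)) {p : ℝ} (hp : 0 < p)
    (hp2 : p < 2) (hs : Summable fun j => ρ j ^ (-(2 * p / (2 - p)))) :
    Summable fun ν => normV (hermiteCoeff (solutionMap ψ f) ν) ^ p := by
  have ht : 0 < p / (2 - p) := div_pos hp (by linarith)
  -- The cut-off order `r` satisfies `r p / (2 - p) > 1`, as the summability of the weights
  -- requires.
  obtain ⟨r, hr⟩ := exists_nat_gt (1 / (p / (2 - p)))
  rw [div_lt_iff₀ ht] at hr
  rw [mul_div_assoc] at hs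
  have e : ∀ ν, normV (hermiteCoeff (solutionMap ψ f) ν)
      = ‖∫ y, hermite ν y • gradL (taylor hP0 hP ψ f 0 (field ψ y)) ∂γ‖ := fun ν => by
    rw [normV_hermiteCoeff (h.memLp_solutionMap hP0 hP f)]
    congr 1
    refine integral_congr_ae ((h.solutionMap_ae_eq hP0 hP f).mono fun y hy => ?_)
    change hermite ν y • gradL (solutionMap ψ f y) = _
    rw [hy]
  have hF : ∀ ν : ℕ →₀ ℕ, 0 < ν.prod fun j n => factor r (ρ j) n := fun ν =>
    Finset.prod_pos fun j _ => factor_pos r (h.pos j) _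
  simp_rw [e]
  refine summable_rpow_of_weights (fun ν => norm_nonneg _) hF hp hp2 ?_
    (summable_prod_factor_rpow h.c_pos hc h.c_le ht hr hs)
  exact summable_of_sum_le (fun ν => mul_nonneg (hF ν).le (sq_nonneg _))
    (sum_prod_factor_mul_norm_sq_le (g := fun μ y => gradL (taylor hP0 hP ψ f μ (field ψ y)))
      (h.memLp_gradL_taylor hP0 hP f) (h.hasDerivAt_gradL_taylor hP0 hP f)
      (h.sum_wt_integral_le hP0 hP f) r)

lemma truncationError_le {u : (ℕ → ℝ) → H10 D} (hu : MemLp u 2 γ) {p : ℝ} (hp : 0 < p)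
    (hp2 : p < 2) (h : Summable fun ν => normV (hermiteCoeff u ν) ^ p) {n : ℕ} (hn : 1 ≤ n)
    {S : Finset (ℕ →₀ ℕ)} (hS : IsBestIndexSet u n S) :
    truncationError u S ≤ ENNReal.ofReal ((∑' ν, normV (hermiteCoeff u ν) ^ p) ^ (1 / p) *
      (n : ℝ) ^ (-(1 / p - 1 / 2))) := by
  obtain ⟨h1, h2⟩ := hasSum_normV_hermiteCoeff_sq hu S
  have hnn : ∀ ν, 0 ≤ normV (hermiteCoeff u ν) := fun ν => norm_nonneg _
  have h3 := hasSum_sq_compl_le hnn hp hp2 h hn hS.1 hS.2 h1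
  rw [← ENNReal.ofReal_toReal h2]
  refine ENNReal.ofReal_le_ofReal ((sq_le_sq₀ ENNReal.toReal_nonneg ?_).1 h3)
  have : 0 ≤ ∑' ν, normV (hermiteCoeff u ν) ^ p := tsum_nonneg fun ν => Real.rpow_nonneg (hnn ν) _
  positivity

end Lognormal

end

theorem corollary6p2 {d : ℕ} (hd : 1 ≤ d) {D : Set (Lognormal.E d)} (hDo : IsOpen D)
    (hDb : Bornology.IsBounded D) (f : StrongDual ℝ (Lognormal.H10 D))
    (ψ : ℕ → Lognormal.LInfty D) (level : ℕ → ℕ) (M : ℕ) (C α : ℝ)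
    (hψ : Lognormal.IsWaveletType ψ level M C α)
    (q : ℝ) (hq : 0 < q) (hsum : Summable fun j => ‖ψ j‖ ^ q) :
    -- the solution map is well defined almost everywhere and square integrable
    (∀ᵐ y ∂Lognormal.γ, ∃ b : Lognormal.LInfty D, Lognormal.IsField ψ y b ∧
      ∀ v : Lognormal.H10 D,
        Lognormal.IsWeakSolution b f v ↔ v = Lognormal.solutionMap ψ f y) ∧
    MemLp (Lognormal.solutionMap ψ f) 2 Lognormal.γ ∧
    -- summability of the Hermite coefficients
    (∀ p : ℝ, 0 < p → p < 2 → q < 2 * p / (2 - p) →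
      Summable fun ν : ℕ →₀ ℕ =>
        Lognormal.normV (Lognormal.hermiteCoeff (Lognormal.solutionMap ψ f) ν) ^ p) ∧
    -- rate of best n-term approximation
    (∀ n : ℕ, ∃ Λ, Lognormal.IsBestIndexSet (Lognormal.solutionMap ψ f) n Λ) ∧
    (∀ s : ℝ, s < 1 / q → ∃ K : ℝ, ∀ n : ℕ, 1 ≤ n → ∀ Λ : Finset (ℕ →₀ ℕ),
      Lognormal.IsBestIndexSet (Lognormal.solutionMap ψ f) n Λ →
        Lognormal.truncationError (Lognormal.solutionMap ψ f) Λ ≤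
          ENNReal.ofReal (K * (n : ℝ) ^ (-s))) := by
  obtain ⟨P, hP0, hP⟩ := Lognormal.exists_norm_le_normV hd hDb
  -- For existence and square integrability any exponent above `q` serves.
  obtain ⟨ρ, c, K, m, h, -, -⟩ :=
    Lognormal.exists_isAdmissible hψ hq (lt_add_one q) hsum
  have hu := h.memLp_solutionMap hP0 hP f
  have hsummable : ∀ p : ℝ, 0 < p → p < 2 → q < 2 * p / (2 - p) →
      Summable fun ν : ℕ →₀ ℕ =>
        Lognormal.normV (Lognormal.hermiteCoeff (Lognormal.solutionMap ψ f) ν) ^ p := by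
    intro p hp hp2 hqp
    obtain ⟨ρ, c, K, m, h, hc, hs⟩ := Lognormal.exists_isAdmissible hψ hq hqp hsum
    exact Lognormal.summable_normV_hermiteCoeff_rpow h hc hP0 hP f hp hp2 hs
  have hnn : ∀ ν, 0 ≤ Lognormal.normV
      (Lognormal.hermiteCoeff (Lognormal.solutionMap ψ f) ν) := fun ν => norm_nonneg _
  refine ⟨h.exists_isField_and_forall_isWeakSolution_iff hP0 hP f, hu, hsummable, fun n => ?_,
    fun s hs => ?_⟩
  · refine Lognormal.exists_card_eq_and_forall_le hnn ?_ n
    -- With no terms removed, Parseval gives square summability, so the norms tend to zero and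
    -- largest values exist.
    have h1 := (Lognormal.hasSum_normV_hermiteCoeff_sq hu ∅).1.summable
    have h2 : Summable fun ν => Lognormal.normV
        (Lognormal.hermiteCoeff (Lognormal.solutionMap ψ f) ν) ^ 2 :=
      (Finset.summable_compl_iff ∅).1 h1
    have h3 := h2.tendsto_cofinite_zero.sqrt
    rw [Real.sqrt_zero] at h3
    exact h3.congr fun ν => Real.sqrt_sq (hnn ν)
  -- Take `max(s, 0) < t < 1/q` and `p = 1 / (t + 1/2)`. Then `p < 2`, `2p / (2 - p) = 1/t > q`, and
  -- the Stechkin rate `1/p - 1/2` is `t > s`.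
  · obtain ⟨t, hst, htq⟩ := exists_between (max_lt hs (one_div_pos.2 hq))
    obtain ⟨hst, ht0⟩ := max_lt_iff.1 hst
    have ht : 0 < t + 1 / 2 := by linarith
    have hp2 : 1 / (t + 1 / 2) < 2 := by
      rw [div_lt_iff₀ ht]
      linarith
    have e : 2 * (1 / (t + 1 / 2)) / (2 - 1 / (t + 1 / 2)) = 1 / t := by
      have h1 : 2 - 1 / (t + 1 / 2) = 2 * t / (t + 1 / 2) := by
        field_simp
        ring
      rw [h1]
      field_simp
    have hsp := hsummable (1 / (t + 1 / 2)) (by positivity) hp2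
      (by rw [e]; exact (lt_one_div hq ht0).2 htq)
    refine ⟨_, fun n hn Λ hΛ =>
      (Lognormal.truncationError_le hu (by positivity) hp2 hsp hn hΛ).trans
        (ENNReal.ofReal_le_ofReal (mul_le_mul_of_nonneg_left ?_ (Real.rpow_nonneg
          (tsum_nonneg fun ν => Real.rpow_nonneg (hnn ν) _) _)))⟩
    refine Real.rpow_le_rpow_of_exponent_le (by exact_mod_cast hn) ?_
    rw [one_div_one_div]
    linarith
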